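/- Let $q=e^{h}\in\mathbb{C}^\times$ ($h\in\mathbb{C}$) be not a root of unity, put $q^{t}=e^{ht}$, $[t]=\frac{q^t-q^{-t}}{q-q^{-1}}$, $\rho(t)=t(t+1)$, and let $2s$ be a non-negative integer. Let $V_s$ be the $U_q(sl_2)$-module with basis $\omega_k$, $k=-s,\dots,s$, where $$X^\pm\omega_k=\sqrt{[s\mp k][s\pm k+1]}\,\omega_{k\pm1},\qquad q^{\pm H}\omega_k=q^{\pm k}\omega_k ,$$ and let tensor products be formed with $\Delta(X^\pm)=X^\pm\otimes q^{-H}+q^{H}\otimes X^\pm$, $\Delta(q^{\pm H})=q^{\pm H}\otimes q^{\pm H}$. On $V_s^{\otimes 2}$ let $$R^+=q^{H\otimes H}\sum_{m\ge0}\frac{q^{(m^2-m)/2}}{[1][2]\cdots[m]}\bigl((q-q^{-1})X^-\otimes X^+\bigr)^m q^{H\otimes H},\qquad R=PR^+,$$ with $P$ the permutation of the factors, and let $R_{12}=R\otimes\mathrm{id}$, $R_{23}=\mathrm{id}\otimes R$ on $V_s^{\otimes3}$. For an integer $0\le n\le\lfloor 3s\rfloor$ let $$W_n^{(s)}=\{\psi\in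 V_s^{\otimes3}: X^+_{123}\psi=0,\ q^{H_{123}}\psi=q^{3s-n}\psi\},$$ where the index $123$ denotes the action on $V_s^{\otimes3}$ through $(\Delta\otimes\mathrm{id})\Delta$. Let $k,k'$ run over $0\le k\le n$ if $n\le 2s$ and over $n-2s\le k\le 4s-n$ if $n\ge 2s$. Put $\xi_k=(-1)^kq^{\rho(2s-k)-2\rho(s)}$, let $D_0$ be the diagonal matrix with the entries $\xi_k$, and let $A=A^{(s,n)}$ be the matrix with the entries $$A_{kk'}=(-1)^{2s-n}\sqrt{[4s-2k+1]}\sqrt{[4s-2k'+1]}\left\{\begin{matrix}s&s&2s-k\\ s&3s-n&2s-k'\end{matrix}\right\}_q ,$$ where $\{\cdots\}_q$ is the $q$-$6j$ symbol, given by the $q$-analogue of Racah's formula. All square roots are principal. Let $\theta_n=(-1)^nq^{\rho(3s-n)-3\rho(s)}$. Then the following holds. (i) $A\,D_0\,A=\theta_n\,D_0^{-1}A\,D_0^{-1}$. (ii) $W_n^{(s)}$ is invariant under $R_{12}$ and $R_{23}$, and it has a basis in which $R_{12}|_{W_n^{(s)}}$ has the matrix $D_0$ and $R_{23}|_{W_n^{(s)}}$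 has the matrix $A D_0A$. In every such basis both $R_{12}R_{23}R_{12}|_{W_n^{(s)}}$ and $R_{23}R_{12}R_{23}|_{W_n^{(s)}}$ have the matrix $\theta_nA$. (iii) Let $\chi=q^{2H}\sum_a S(r^{(2)}_a)r^{(1)}_a$ be the ribbon element, where $R^+=\sum_a r^{(1)}_a\otimes r^{(2)}_a$ and $S$ is the antipode. Then $\Delta^{(2)}(\chi)$, with $\Delta^{(2)}=(\Delta\otimes\mathrm{id})\Delta$, acts invertibly on $V_s^{\otimes3}$, and on $V_s^{\otimes3}$ $$(R_{12}R_{23}R_{12})^2=(R_{23}R_{12}R_{23})^2=\chi_1\chi_2\chi_3\,\Delta^{(2)}(\chi^{-1}).$$ -/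

import Mathlib

open scoped TensorProduct

noncomputable section

namespace UqSl2

/-! Conventions: `h : ℂ` is a fixed logarithm of `q`, so `q = exp h` and `q ^ t = exp (h t)`;
the spin is `s = N / 2` with `N : ℕ`, so `N = 2s`. -/

/-- The power `q ^ t`, for `q = exp h`. -/
def qpow (h t : ℂ) : ℂ := Complex.exp (h * t)

/-- The `q`-number `[t] = (q ^ t - q ^ (-t)) / (q - q⁻¹)`. -/
def qnum (h t : ℂ) : ℂ := (qpow h t - qpow h (-t)) / (qpow h 1 - qpow h (-1))

/-- The `q`-factorial `[m]! = [1] [2] ⋯ [m]`. -/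
def qfact (h : ℂ) (m : ℕ) : ℂ := ∏ k ∈ Finset.range m, qnum h ((k : ℂ) + 1)

/-- The principal square root. -/
def csqrt (z : ℂ) : ℂ := z ^ (1 / 2 : ℂ)

/-- `ρ(t) = t (t + 1)`. -/
def rho (t : ℂ) : ℂ := t * (t + 1)

/-- The spin `s = N / 2`. -/
def spin (N : ℕ) : ℂ := (N : ℂ) / 2

/-! ### The representation of spin `s` -/

/-- The module `V_s`, of dimension `2s + 1`. -/
abbrev V (N : ℕ) : Type := Fin (N + 1) → ℂ

/-- The basis `ω_k`, `k = -s, …, s`; the index `i` stands for `k = i - s`. -/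
def om (N : ℕ) : Module.Basis (Fin (N + 1)) ℂ (V N) := Pi.basisFun ℂ (Fin (N + 1))

/-- The weight `k = i - s` of the `i`-th basis vector. -/
def wt (N : ℕ) (i : Fin (N + 1)) : ℂ := (i : ℕ) - spin N

/-- The operator that multiplies each vector `b i` of a basis by the scalar `f i`. -/
def diagOp {ι M : Type} [AddCommMonoid M] [Module ℂ M] (b : Module.Basis ι ℂ M) (f : ι → ℂ) :
    Module.End ℂ M :=
  b.constr ℂ fun i => f i • b i

/-- `X⁺ ω_k = √([s - k] [s + k + 1]) ω_{k+1}` (which is `0` for `k = s`). -/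
def Xp (N : ℕ) (h : ℂ) : Module.End ℂ (V N) :=
  (om N).constr ℂ fun i =>
    if hi : (i : ℕ) + 1 < N + 1 then
      csqrt (qnum h (spin N - wt N i) * qnum h (spin N + wt N i + 1)) • om N ⟨(i : ℕ) + 1, hi⟩
    else 0

/-- `X⁻ ω_k = √([s + k] [s - k + 1]) ω_{k-1}` (which is `0` for `k = -s`). -/
def Xm (N : ℕ) (h : ℂ) : Module.End ℂ (V N) :=
  (om N).constr ℂ fun i =>
    if 0 < (i : ℕ) then
      csqrt (qnum h (spin N + wt N i) * qnum h (spin N - wt N i + 1)) •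
        om N ⟨(i : ℕ) - 1, lt_of_le_of_lt (Nat.sub_le _ _) i.isLt⟩
    else 0

/-- `q ^ H ω_k = q ^ k ω_k`. -/
def qH (N : ℕ) (h : ℂ) : Module.End ℂ (V N) := diagOp (om N) fun i => qpow h (wt N i)

/-- `q ^ (-H) ω_k = q ^ (-k) ω_k`. -/
def qHinv (N : ℕ) (h : ℂ) : Module.End ℂ (V N) := diagOp (om N) fun i => qpow h (-wt N i)

/-! ### Tensor powers of `V_s` -/

/-- The action of `X^±` on a tensor product of two modules, through the comultiplication
`Δ(X^±) = X^± ⊗ q ^ (-H) + q ^ H ⊗ X^±`. The arguments are the actions of `q ^ H` and `X^±` on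
the first factor, and those of `X^±` and `q ^ (-H)` on the second. -/
def coprodX {M M' : Type} [AddCommMonoid M] [Module ℂ M] [AddCommMonoid M'] [Module ℂ M']
    (K X : Module.End ℂ M) (X' Kinv' : Module.End ℂ M') : Module.End ℂ (M ⊗[ℂ] M') :=
  TensorProduct.map X Kinv' + TensorProduct.map K X'

/-- `V_s ⊗ V_s`. -/
abbrev V2 (N : ℕ) : Type := V N ⊗[ℂ] V N

/-- `V_s ⊗ V_s ⊗ V_s`. -/
abbrev V3 (N : ℕ) : Type := (V N ⊗[ℂ] V N) ⊗[ℂ] V N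

/-- The basis `ω_k ⊗ ω_l` of `V_s ⊗ V_s`. -/
def om2 (N : ℕ) : Module.Basis (Fin (N + 1) × Fin (N + 1)) ℂ (V2 N) :=
  (om N).tensorProduct (om N)

/-- The basis `ω_j ⊗ ω_k ⊗ ω_l` of `V_s ⊗ V_s ⊗ V_s`. -/
def om3 (N : ℕ) : Module.Basis ((Fin (N + 1) × Fin (N + 1)) × Fin (N + 1)) ℂ (V3 N) :=
  (om2 N).tensorProduct (om N)

/-- `q ^ H` on `V_s ⊗ V_s`, through `Δ(q ^ H) = q ^ H ⊗ q ^ H`. -/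
def qH2 (N : ℕ) (h : ℂ) : Module.End ℂ (V2 N) := TensorProduct.map (qH N h) (qH N h)

/-- `X⁺` on `V_s ⊗ V_s ⊗ V_s`, through `(Δ ⊗ id) Δ`. -/
def Xp3 (N : ℕ) (h : ℂ) : Module.End ℂ (V3 N) :=
  coprodX (qH2 N h) (coprodX (qH N h) (Xp N h) (Xp N h) (qHinv N h)) (Xp N h) (qHinv N h)

/-- `X⁻` on `V_s ⊗ V_s ⊗ V_s`, through `(Δ ⊗ id) Δ`. -/
def Xm3 (N : ℕ) (h : ℂ) : Module.End ℂ (V3 N) :=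
  coprodX (qH2 N h) (coprodX (qH N h) (Xm N h) (Xm N h) (qHinv N h)) (Xm N h) (qHinv N h)

/-- `q ^ H` on `V_s ⊗ V_s ⊗ V_s`, through `(Δ ⊗ id) Δ`. -/
def qH3 (N : ℕ) (h : ℂ) : Module.End ℂ (V3 N) := TensorProduct.map (qH2 N h) (qH N h)

/-- The space `W_n^{(s)}` of highest weight vectors of weight `3s - n` in `V_s ⊗ V_s ⊗ V_s`. -/
def W (N n : ℕ) (h : ℂ) : Submodule ℂ (V3 N) where
  carrier := {ψ | Xp3 N h ψ = 0 ∧ qH3 N h ψ = qpow h (3 * spin N - n) • ψ}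
  add_mem' := by
    rintro x y ⟨h1, h2⟩ ⟨h3, h4⟩
    exact ⟨by rw [map_add, h1, h3, add_zero], by rw [map_add, h2, h4, smul_add]⟩
  zero_mem' := ⟨map_zero _, by rw [map_zero, smul_zero]⟩
  smul_mem' := by
    rintro c x ⟨h1, h2⟩
    exact ⟨by rw [map_smul, h1, smul_zero], by rw [map_smul, h2, smul_comm]⟩

/-! ### The R-matrix -/

/-- `q ^ (H ⊗ H)` on `V_s ⊗ V_s`. -/
def qHH (N : ℕ) (h : ℂ) : Module.End ℂ (V2 N) :=
  diagOp (om2 N) fun p => qpow h (wt N p.1 * wt N p.2)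

/-- The coefficient `q ^ ((m² - m) / 2) (q - q⁻¹) ^ m / [m]!` of the universal R-matrix. -/
def rCoeff (h : ℂ) (m : ℕ) : ℂ :=
  qpow h (((m : ℂ) ^ 2 - m) / 2) * (qpow h 1 - qpow h (-1)) ^ m / qfact h m

/-- The action on `V_s ⊗ V_s` of the universal R-matrix
`R⁺ = q^{H ⊗ H} (∑_m q^{(m² - m)/2} / [m]! ((q - q⁻¹) X⁻ ⊗ X⁺)^m) q^{H ⊗ H}`.
The series stops at `m = N`, since `X^±` to the power `N + 1` is zero on `V_s`. -/
def Rplus (N : ℕ) (h : ℂ) : Module.End ℂ (V2 N) :=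
  qHH N h *
    (∑ m ∈ Finset.range (N + 1), rCoeff h m • (TensorProduct.map (Xm N h) (Xp N h)) ^ m) *
    qHH N h

/-- The R-matrix in the braid group form, `R = P R⁺`, where `P` permutes the two factors. -/
def R (N : ℕ) (h : ℂ) : Module.End ℂ (V2 N) :=
  (TensorProduct.comm ℂ (V N) (V N)).toLinearMap * Rplus N h

/-- `R` acting on the first two factors. -/
def R12 (N : ℕ) (h : ℂ) : Module.End ℂ (V3 N) := LinearMap.rTensor (V N) (R N h)

/-- `R` acting on the last two factors. -/
def R23 (N : ℕ) (h : ℂ) : Module.End ℂ (V3 N) :=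
  (TensorProduct.assoc ℂ (V N) (V N) (V N)).symm.toLinearMap ∘ₗ
    LinearMap.lTensor (V N) (R N h) ∘ₗ (TensorProduct.assoc ℂ (V N) (V N) (V N)).toLinearMap

/-! ### The ribbon element -/

/-- The action of the ribbon element `χ = q^{2H} ∑_a S(r_a^{(2)}) r_a^{(1)}`, where
`R⁺ = ∑_a r_a^{(1)} ⊗ r_a^{(2)}` and `S` is the antipode, `S(H) = -H`, `S(X⁺) = -q⁻¹ X⁺`,
on a module with a basis `b` of weight vectors (`H (b i) = w i • b i`) on which `X⁻` to the
power `L` is zero.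

Expanding both factors `q^{H ⊗ H}` of `R⁺` in powers of `H ⊗ H`, the `m`-th term of `R⁺`
contributes, with `c_m = rCoeff h m`,
`c_m ∑_{a, b} (h^a / a!) (h^b / b!) S(H^a (X⁺)^m H^b) H^a (X⁻)^m H^b`
`= c_m (-q⁻¹)^m ∑_{a, b} ((-h)^a / a!) ((-h)^b / b!) H^b (X⁺)^m H^{2a} (X⁻)^m H^b`
`= c_m (-q⁻¹)^m q^{-H²} (X⁺)^m q^{-H²} (X⁻)^m`,
because `(X⁺)^m q^{-H²} (X⁻)^m` commutes with `H`. -/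
def ribbon {ι M : Type} [AddCommMonoid M] [Module ℂ M] (h : ℂ) (b : Module.Basis ι ℂ M)
    (w : ι → ℂ) (Xp Xm : Module.End ℂ M) (L : ℕ) : Module.End ℂ M :=
  diagOp b (fun i => qpow h (2 * w i)) *
    ∑ m ∈ Finset.range L, (rCoeff h m * (-qpow h (-1)) ^ m) •
      (diagOp b (fun i => qpow h (-(w i) ^ 2)) * Xp ^ m *
        diagOp b (fun i => qpow h (-(w i) ^ 2)) * Xm ^ m)

/-- The ribbon element on `V_s`. -/
def chi (N : ℕ) (h : ℂ) : Module.End ℂ (V N) :=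
  ribbon h (om N) (wt N) (Xp N h) (Xm N h) (N + 1)

/-- The ribbon element on `V_s ⊗ V_s ⊗ V_s`, that is, the action of `Δ^{(2)}(χ)`. -/
def chi3 (N : ℕ) (h : ℂ) : Module.End ℂ (V3 N) :=
  ribbon h (om3 N) (fun p => wt N p.1.1 + wt N p.1.2 + wt N p.2) (Xp3 N h) (Xm3 N h) (3 * N + 1)

/-- The operator `χ₁ χ₂ χ₃ = χ ⊗ χ ⊗ χ` on `V_s ⊗ V_s ⊗ V_s`. -/
def chi123 (N : ℕ) (h : ℂ) : Module.End ℂ (V3 N) :=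
  TensorProduct.map (TensorProduct.map (chi N h) (chi N h)) (chi N h)

/-! ### The 6-j symbols and the matrices `D₀` and `A` -/

/-- The triangle conditions for the spins `a / 2`, `b / 2`, `c / 2`. -/
def Triad (a b c : ℕ) : Prop := Even (a + b + c) ∧ a ≤ b + c ∧ b ≤ a + c ∧ c ≤ a + b

instance (a b c : ℕ) : Decidable (Triad a b c) := by unfold Triad; infer_instance

/-- The triangle coefficient
`√([x + y - z]! [x - y + z]! [-x + y + z]! / [x + y + z + 1]!)`
of a triad of spins `x = a / 2`, `y = b / 2`, `z = c / 2`. -/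
def triangle (h : ℂ) (a b c : ℕ) : ℂ :=
  csqrt (qfact h ((a + b - c) / 2) * qfact h ((a + c - b) / 2) * qfact h ((b + c - a) / 2) /
    qfact h ((a + b + c) / 2 + 1))

/-- The 6-j symbol of `U_q(sl_2)` with first row the spins `a / 2`, `b / 2`, `e / 2`
and second row the spins `d / 2`, `c / 2`, `f / 2`, by Racah's formula.
It is zero unless the four triangle conditions hold. -/
def sixJ (h : ℂ) (a b e d c f : ℕ) : ℂ :=
  if Triad a b e ∧ Triad a c f ∧ Triad d b f ∧ Triad d c e then
    triangle h a b e * triangle h a c f * triangle h d b f * triangle h d c e *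
      ∑ z ∈ Finset.Icc
          (max (max ((a + b + e) / 2) ((a + c + f) / 2)) (max ((d + b + f) / 2) ((d + c + e) / 2)))
          (min (min ((a + b + d + c) / 2) ((a + d + e + f) / 2)) ((b + c + e + f) / 2)),
        (-1 : ℂ) ^ z * qfact h (z + 1) /
          (qfact h (z - (a + b + e) / 2) * qfact h (z - (a + c + f) / 2) *
            qfact h (z - (d + b + f) / 2) * qfact h (z - (d + c + e) / 2) *
            qfact h ((a + b + d + c) / 2 - z) * qfact h ((a + d + e + f) / 2 - z) *
            qfact h ((b + c + e + f) / 2 - z))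
  else 0

/-- The index set of the matrices: `0 ≤ k ≤ n` if `n ≤ 2s`, and `n - 2s ≤ k ≤ 4s - n` if
`2s ≤ n ≤ 3s` (the subtraction of natural numbers makes `n - 2s` zero in the first case). -/
abbrev Idx (N n : ℕ) : Type := ↥(Finset.Icc (n - N) (min n (2 * N - n)))

/-- `ξ_k = (-1)^k q^{ρ(2s - k) - 2 ρ(s)}`. -/
def xi (N : ℕ) (h : ℂ) (k : ℕ) : ℂ := (-1) ^ k * qpow h (rho (N - k) - 2 * rho (spin N))

/-- `θ_n = (-1)^n q^{ρ(3s - n) - 3 ρ(s)}`. -/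
def theta (N n : ℕ) (h : ℂ) : ℂ :=
  (-1) ^ n * qpow h (rho (3 * spin N - n) - 3 * rho (spin N))

/-- The diagonal matrix `D₀^{(n)}` with the entries `ξ_k`. -/
def D0 (N n : ℕ) (h : ℂ) : Matrix (Idx N n) (Idx N n) ℂ :=
  Matrix.diagonal fun k => xi N h k

/-- The matrix `A^{(s,n)}`, with the entries
`(-1)^{2s - n} √[4s - 2k + 1] √[4s - 2k' + 1] {s, s, 2s - k; s, 3s - n, 2s - k'}_q`. -/
def A (N n : ℕ) (h : ℂ) : Matrix (Idx N n) (Idx N n) ℂ :=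
  Matrix.of fun k k' =>
    (-1 : ℂ) ^ ((N : ℤ) - (n : ℤ)) *
      (csqrt (qnum h (2 * N - 2 * (k : ℕ) + 1)) * csqrt (qnum h (2 * N - 2 * (k' : ℕ) + 1))) *
      sixJ h N N (2 * N - 2 * (k : ℕ)) N (3 * N - 2 * n) (2 * N - 2 * (k' : ℕ))

end UqSl2

end

/-! Let `U_k ⊂ V_s ⊗ V_s` be the submodule of highest weight `2s - k`. The space `W_n` has two
distinguished bases: `hwL`, with its `k`-th vector in `U_k ⊗ V_s`, and `hwR`, with its `k`-th vector
in `V_s ⊗ U_k`. Since `R` is a module map, it acts on `U_k` by a scalar, which is `ξ_k` (`R_phi`).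
Hence `R₁₂` is diagonal on the first family and `R₂₃` on the second one, with the same eigenvalues.

A highest weight vector is determined by its component along `ω_s` in the last factor
(`UqModule.eq_zero_of_slotR`). Because `X⁻` never produces `ω_s`, the matrix `R` carries the
`ω_s`-component of the first factor to the second factor, up to `q^{2sH}` on the remaining one
(`slotR_R`). It follows that `R₁₂ R₂₃ R₁₂` maps each vector of `hwR` to a multiple of the
corresponding vector of `hwL` (`braid_hwR`). The Yang–Baxter equation is not needed.

The transition matrix is read off from the coordinates at `(X⁻)^i ω_s ⊗ ω_s ⊗ (X⁻)^(n-i) ω_s`. There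
the first family is triangular with an explicit inverse (`Generic.sum_triG_mul_triGinv`), and the
second one has entries that are products of factorials. The resulting sum is a balanced `₄φ₃`, which
Whipple's transformation turns into Racah's sum (`Generic.sum_midH_mul_triGinv`). After rescaling,
the transition matrix is `A` (`smul_hwR`). With `M` the matrix of `R₂₃`, this gives `M A = A D₀` and
`D₀ M D₀ A = θ_n` (`exists_basis_braid`).

The same relations hold at `q⁻¹`, where `A` is unchanged while `D₀` and `θ_n` are inverted. Matrix
algebra alone then forces `A² = 1` (`mul_self_eq_one_of_braid`), so `M = A D₀ A`, and (i) and (ii)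
follow.

For (iii), the squared half twists act by `θ_n²` on `W_n` and commute with `X⁻`, while the ribbon
element acts by `q^{-2ρ(3s-n)}` on everything generated from `W_n` (`UqModule.ribbon_apply`). The
product of the two scalars is `q^{-6ρ(s)}` for every `n`, and the descendants of highest weight
vectors span (`UqModule.exists_sum`). -/

noncomputable section

namespace UqSl2

/-! ### Arithmetic of `q`-numbers -/

variable {h : ℂ}

/-- `q = exp h` is not a root of unity. -/
def Generic (h : ℂ) : Prop := ∀ m : ℕ, 0 < m → Complex.exp h ^ m ≠ 1

lemma qpow_add (h a b : ℂ) : qpow h (a + b) = qpow h a * qpow h b := by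
  simp only [qpow, mul_add, Complex.exp_add]

lemma qpow_neg (h a : ℂ) : qpow h (-a) = (qpow h a)⁻¹ := by
  simp only [qpow, mul_neg, Complex.exp_neg]

lemma qpow_sub (h a b : ℂ) : qpow h (a - b) = qpow h a / qpow h b := by
  rw [sub_eq_add_neg, qpow_add, qpow_neg, div_eq_mul_inv]

@[simp] lemma qpow_zero (h : ℂ) : qpow h 0 = 1 := by simp [qpow]

@[simp] lemma qpow_ne_zero (h a : ℂ) : qpow h a ≠ 0 := Complex.exp_ne_zero _

lemma qpow_natCast_mul (h a : ℂ) (n : ℕ) : qpow h (n * a) = qpow h a ^ n := by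
  simp only [qpow]
  rw [← Complex.exp_nat_mul]
  ring_nf

lemma qpow_neg_left (h a : ℂ) : qpow (-h) a = qpow h (-a) := by
  simp [qpow]

/-- Replacing `h` by `-h` replaces `q` by `q⁻¹`; the proof of `A² = 1` runs the whole construction
at both values. -/
lemma Generic.neg (hq : Generic h) : Generic (-h) := by
  intro m hm H
  apply hq m hm
  rw [Complex.exp_neg, inv_pow, inv_eq_one] at H
  exact H

/-- Weights are half-integers, so this is what separates weight spaces: `q^{c/2} = 1` gives `q^c =
1` on squaring. -/
lemma Generic.qpow_half_injective (hq : Generic h) {a b : ℤ}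
    (H : qpow h ((a : ℂ) / 2) = qpow h ((b : ℂ) / 2)) : a = b := by
  have key : ∀ c : ℤ, 0 ≤ c → qpow h ((c : ℂ) / 2) = 1 → c = 0 := by
    intro c hc h1
    by_contra hne
    obtain ⟨m, rfl⟩ := Int.eq_ofNat_of_zero_le hc
    apply hq m (by omega)
    have : qpow h (((m : ℤ) : ℂ) / 2) ^ 2 = 1 := by rw [h1, one_pow]
    rw [qpow, ← Complex.exp_nat_mul] at this
    rw [← Complex.exp_nat_mul, ← this]
    congr 1
    push_cast
    ring
  have h1 : qpow h (((a - b : ℤ) : ℂ) / 2) = 1 := by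
    rw [Int.cast_sub, sub_div, qpow_sub, H, div_self (qpow_ne_zero _ _)]
  have h2 : qpow h (((b - a : ℤ) : ℂ) / 2) = 1 := by
    rw [Int.cast_sub, sub_div, qpow_sub, H, div_self (qpow_ne_zero _ _)]
  rcases le_total a b with hab | hab
  · have := key _ (by omega) h2; omega
  · have := key _ (by omega) h1; omega

lemma Generic.qpow_injective (hq : Generic h) {a b : ℤ}
    (H : qpow h (a : ℂ) = qpow h (b : ℂ)) : a = b := by
  have := hq.qpow_half_injective (a := 2 * a) (b := 2 * b) (by
    push_cast
    rw [mul_div_cancel_left₀ _ two_ne_zero, mul_div_cancel_left₀ _ two_ne_zero, H])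
  omega

/-- The denominator `q - q⁻¹`. -/
lemma Generic.sub_ne_zero (hq : Generic h) : qpow h 1 - qpow h (-1) ≠ 0 := by
  intro H
  have := hq.qpow_injective (a := 1) (b := -1) (by simpa using sub_eq_zero.mp H)
  omega

@[simp] lemma qnum_zero (h : ℂ) : qnum h 0 = 0 := by simp [qnum]

lemma qnum_neg (h t : ℂ) : qnum h (-t) = -qnum h t := by
  simp only [qnum, neg_neg]
  rw [← neg_div, neg_sub]

lemma qnum_neg_left (h t : ℂ) : qnum (-h) t = qnum h t := by
  simp only [qnum, qpow_neg_left, neg_neg]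
  rw [← neg_sub (qpow h t), ← neg_sub (qpow h 1), neg_div_neg_eq]

lemma Generic.qnum_one (hq : Generic h) : qnum h 1 = 1 := div_self hq.sub_ne_zero

lemma Generic.mul_qnum (hq : Generic h) (t : ℂ) :
    (qpow h 1 - qpow h (-1)) * qnum h t = qpow h t - qpow h (-t) := by
  rw [qnum, mul_div_cancel₀ _ hq.sub_ne_zero]

lemma Generic.qnum_ne_zero (hq : Generic h) {m : ℤ} (hm : m ≠ 0) : qnum h (m : ℂ) ≠ 0 := by
  intro H
  have h1 := hq.mul_qnum (m : ℂ)
  rw [H, mul_zero] at h1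
  have := hq.qpow_injective (a := m) (b := -m) (by push_cast; exact (sub_eq_zero.mp h1.symm))
  omega

lemma Generic.qnum_natCast_ne_zero (hq : Generic h) {m : ℕ} (hm : m ≠ 0) :
    qnum h (m : ℂ) ≠ 0 := by
  have := hq.qnum_ne_zero (m := (m : ℤ)) (by omega)
  exact_mod_cast this

/-- The three-term relation of `q`-numbers. Different choices of `Z` give the Pascal-type step of
Saalschütz's sum and the commutators of `X⁺` and `X⁻`. -/
lemma qnum_mul_qnum (h X Y Z : ℂ) :
    qnum h X * qnum h Y =
      qnum h (X + Y - Z) * qnum h Z + qnum h (Z - X) * qnum h (Z - Y) := by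
  simp only [qnum, div_mul_div_comm, ← add_div]
  congr 1
  have hx := qpow_ne_zero h X
  have hy := qpow_ne_zero h Y
  have hz := qpow_ne_zero h Z
  simp only [qpow_sub, qpow_neg, qpow_add]
  field_simp
  ring

@[simp] lemma qfact_zero (h : ℂ) : qfact h 0 = 1 := by simp [qfact]

lemma qfact_succ (h : ℂ) (m : ℕ) : qfact h (m + 1) = qfact h m * qnum h (m + 1) := by
  simp [qfact, Finset.prod_range_succ]

lemma qfact_neg_left (h : ℂ) (m : ℕ) : qfact (-h) m = qfact h m := by
  simp [qfact, qnum_neg_left]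

lemma Generic.qfact_ne_zero (hq : Generic h) (m : ℕ) : qfact h m ≠ 0 := by
  rw [qfact, Finset.prod_ne_zero_iff]
  intro k _
  have := hq.qnum_natCast_ne_zero (m := k + 1) (by omega)
  exact_mod_cast this

/-! ### Pochhammer symbols and `q`-binomial coefficients. -/

/-- The `q`-Pochhammer symbol `[x] [x + 1] ⋯ [x + m - 1]`. -/
def qpoch (h x : ℂ) (m : ℕ) : ℂ := ∏ j ∈ Finset.range m, qnum h (x + j)

@[simp] lemma qpoch_zero (h x : ℂ) : qpoch h x 0 = 1 := by simp [qpoch]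

lemma qpoch_succ (h x : ℂ) (m : ℕ) : qpoch h x (m + 1) = qpoch h x m * qnum h (x + m) := by
  simp [qpoch, Finset.prod_range_succ]

lemma qpoch_succ' (h x : ℂ) (m : ℕ) : qpoch h x (m + 1) = qnum h x * qpoch h (x + 1) m := by
  simp only [qpoch, Finset.prod_range_succ', Nat.cast_zero, add_zero, mul_comm (qnum h x)]
  congr 1
  refine Finset.prod_congr rfl fun j _ => ?_
  push_cast
  ring_nf

lemma qpoch_add (h x : ℂ) (m n : ℕ) :
    qpoch h x (m + n) = qpoch h x m * qpoch h (x + m) n := by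
  simp only [qpoch, Finset.prod_range_add]
  congr 1
  refine Finset.prod_congr rfl fun j _ => ?_
  push_cast
  ring_nf

lemma qpoch_neg (h x : ℂ) (m : ℕ) :
    qpoch h (-x) m = (-1) ^ m * qpoch h (x - m + 1) m := by
  rw [qpoch, qpoch, ← Finset.prod_range_reflect, ← Finset.card_range m, ← Finset.prod_const,
    Finset.card_range, ← Finset.prod_mul_distrib]
  refine Finset.prod_congr rfl fun j hj => ?_
  rw [Finset.mem_range] at hj
  rw [neg_one_mul, ← qnum_neg, Nat.sub_sub, Nat.cast_sub (by omega)]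
  push_cast
  ring_nf

/-- `[a + 1] ⋯ [a + m] = [a + m]! / [a]!`. -/
lemma qfact_mul_qpoch (h : ℂ) (a m : ℕ) :
    qfact h a * qpoch h (a + 1) m = qfact h (a + m) := by
  induction m with
  | zero => simp
  | succ m ih =>
    rw [qpoch_succ, ← mul_assoc, ih, ← add_assoc, qfact_succ]
    push_cast
    ring_nf

lemma qpoch_one (h : ℂ) (m : ℕ) : qpoch h 1 m = qfact h m := by
  simpa using qfact_mul_qpoch h 0 m

/-- `[-a] [-a + 1] ⋯ [-a + m - 1] = (-1) ^ m [a]! / [a - m]!` for `m ≤ a`. -/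
lemma qfact_mul_qpoch_neg (h : ℂ) {a m : ℕ} (hm : m ≤ a) :
    qfact h (a - m) * qpoch h (-a) m = (-1) ^ m * qfact h a := by
  rw [qpoch_neg, mul_left_comm]
  congr 1
  have := qfact_mul_qpoch h (a - m) m
  rw [Nat.sub_add_cancel hm, Nat.cast_sub hm] at this
  exact this

lemma qpoch_neg_eq_zero (h : ℂ) {a m : ℕ} (hm : a < m) : qpoch h (-a) m = 0 :=
  Finset.prod_eq_zero (Finset.mem_range.mpr hm) (by simp)

/-- The `q`-binomial coefficient. -/
def qbinom (h : ℂ) (n r : ℕ) : ℂ := qfact h n / (qfact h r * qfact h (n - r))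

lemma Generic.qbinom_zero_right (hq : Generic h) (n : ℕ) : qbinom h n 0 = 1 := by
  simp [qbinom, div_self (hq.qfact_ne_zero n)]

lemma Generic.qbinom_self (hq : Generic h) (n : ℕ) : qbinom h n n = 1 := by
  simp [qbinom, div_self (hq.qfact_ne_zero n)]

/-- Trinomial revision, needed to interchange the two sums in `Generic.whipple`. -/
lemma Generic.qbinom_mul (hq : Generic h) {n i r : ℕ} (hr : r ≤ i) (hi : i ≤ n) :
    qbinom h n i * qbinom h i r = qbinom h n r * qbinom h (n - r) (i - r) := by
  have h1 := hq.qfact_ne_zero i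
  have h2 := hq.qfact_ne_zero r
  have h3 := hq.qfact_ne_zero (n - r)
  have h4 := hq.qfact_ne_zero (n - i)
  have h5 := hq.qfact_ne_zero (i - r)
  simp only [qbinom]
  rw [show n - r - (i - r) = n - i by omega]
  field_simp

/-! ### Terminating `q`-hypergeometric sums. -/

/-- A sum whose terms split by a Pascal rule. -/
lemma sum_range_succ_eq_of_pascal {R : Type*} [CommRing R] (n : ℕ) (u v f : ℕ → R)
    (h0 : f 0 = u 0) (hlast : f (n + 1) = v n)
    (hmid : ∀ r < n, f (r + 1) = u (r + 1) + v r) :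
    ∑ r ∈ Finset.range (n + 2), f r = ∑ r ∈ Finset.range (n + 1), (u r + v r) := by
  rw [Finset.sum_add_distrib, Finset.sum_range_succ f, Finset.sum_range_succ' f,
    Finset.sum_range_succ' u, Finset.sum_range_succ v, h0, hlast,
    Finset.sum_congr rfl fun r hr => hmid r (Finset.mem_range.mp hr), Finset.sum_add_distrib]
  ring

/-- The terminating `q`-Saalschütz sum, in polynomial form. -/
lemma Generic.saalschutz (hq : Generic h) (b c d : ℂ) (i : ℕ) :
    ∑ r ∈ Finset.range (i + 1), qbinom h i r * qpoch h (d - b) r * qpoch h (d - c) r *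
      qpoch h (b + c - d) (i - r) * qpoch h (d + r) (i - r) = qpoch h b i * qpoch h c i := by
  induction i with
  | zero => simp [qbinom]
  | succ i ih =>
    have hi := hq.qnum_natCast_ne_zero (m := i + 1) (by omega)
    push_cast at hi
    rw [qpoch_succ, qpoch_succ, mul_mul_mul_comm, ← ih, Finset.sum_mul]
    -- The new factor `[b + i] [c + i]` is split, in the `r`-th term, as `[b + c - d + i - r] [d + i
    -- + r] + [d - b + r] [d - c + r]`. The first part stays at `r`, the second part moves to `r +
    -- 1`.
    rw [sum_range_succ_eq_of_pascal i
      (fun r => qbinom h i r * qpoch h (d - b) r * qpoch h (d - c) r *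
        qpoch h (b + c - d) (i - r) * qpoch h (d + r) (i - r) *
          (qnum h (b + c - d + i - r) * qnum h (d + i + r)))
      (fun r => qbinom h i r * qpoch h (d - b) r * qpoch h (d - c) r *
        qpoch h (b + c - d) (i - r) * qpoch h (d + r) (i - r) *
          (qnum h (d - b + r) * qnum h (d - c + r)))]
    · refine Finset.sum_congr rfl fun r _ => ?_
      rw [qnum_mul_qnum h (b + i) (c + i) (d + i + r)]
      ring_nf
    · simp only [hq.qbinom_zero_right, qpoch_zero, Nat.sub_zero, Nat.cast_zero, add_zero, sub_zero,
        qpoch_succ]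
      ring
    · simp only [hq.qbinom_self, Nat.sub_self, qpoch_zero, qpoch_succ]
      ring
    · intro r hr
      obtain ⟨p, rfl⟩ : ∃ p, i = r + 1 + p := ⟨i - (r + 1), by omega⟩
      have e1 : r + 1 + p + 1 - (r + 1) = p + 1 := by omega
      have e2 : r + 1 + p - (r + 1) = p := by omega
      have e3 : r + 1 + p - r = p + 1 := by omega
      simp only [qbinom, e1, e2, e3]
      rw [qpoch_succ h (b + c - d) p, qpoch_succ h (d + (r + 1 : ℕ)) p,
        qpoch_succ' h (d + r) p, qpoch_succ h (d - b) r, qpoch_succ h (d - c) r,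
        qfact_succ h (r + 1 + p), qfact_succ h r, qfact_succ h p]
      have f1 := hq.qfact_ne_zero r
      have f2 := hq.qfact_ne_zero p
      have n1 := hq.qnum_natCast_ne_zero (m := r + 1) (by omega)
      have n2 := hq.qnum_natCast_ne_zero (m := p + 1) (by omega)
      push_cast at n1 n2 hi ⊢
      -- After cancellation of the common factors, the Pascal rule reads `[i + 1] [d + i] = [p + 1]
      -- [d + i + r + 1] + [d + r] [r + 1]` with `i = r + 1 + p`.
      have key := qnum_mul_qnum h (r + 1 + p + 1 : ℂ) (d + (r + 1 + p)) (d + r + 1 + (r + 1 + p))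
      rw [show (r + 1 + p + 1 : ℂ) + (d + (r + 1 + p)) - (d + r + 1 + (r + 1 + p)) = p + 1 by ring,
        show d + r + 1 + (r + 1 + p) - (r + 1 + p + 1 : ℂ) = d + r by ring,
        show d + r + 1 + (r + 1 + p) - (d + (r + 1 + p)) = (r + 1 : ℂ) by ring] at key
      rw [show d + ((r : ℂ) + 1) = d + r + 1 by ring,
        show d + (r : ℂ) + 1 + p = d + (r + 1 + p) by ring,
        show b + c - d + (r + 1 + p : ℂ) - (r + 1) = b + c - d + p by ring,
        show d + (r + 1 + p : ℂ) + (r + 1) = d + r + 1 + (r + 1 + p) by ring]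
      field_simp
      linear_combination (qfact h (r + 1 + p) * qpoch h (d - b) r * qnum h (d - b + r) *
        qpoch h (d - c) r * qnum h (d - c + r) * qpoch h (b + c - d) p *
        qnum h (b + c - d + p) * qpoch h (d + r + 1) p) * key

/-- The terminating balanced `₃φ₂` sum. -/
lemma Generic.balanced_three_two (hq : Generic h) (a g e f : ℂ) (L : ℕ)
    (hb : e + f = a + g - L + 1) :
    ∑ t ∈ Finset.range (L + 1), qbinom h L t * (-1) ^ t * qpoch h a t * qpoch h g t *
      qpoch h (e + t) (L - t) * qpoch h (f + t) (L - t) =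
        qpoch h (e - a) L * qpoch h (f - a) L := by
  -- With this choice the symbols of `d - b` and `d - c` become those of `a` and `g`, and the
  -- balancing condition turns the other two symbols that involve `g` into reversed symbols of `f -
  -- a` and `f + t`.
  have key := hq.saalschutz (e - a) (e - g) e L
  have h1 : qpoch h (e - g) L = (-1) ^ L * qpoch h (f - a) L := by
    rw [show e - g = -(g - e) by ring, qpoch_neg]
    congr 2
    linear_combination -hb
  rw [h1] at key
  have h2 : qpoch h (e - a) L * qpoch h (f - a) L =
      (-1) ^ L * (qpoch h (e - a) L * ((-1) ^ L * qpoch h (f - a) L)) := by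
    have : ((-1 : ℂ) ^ L) * (-1) ^ L = 1 := by rw [← mul_pow]; simp
    linear_combination (-qpoch h (e - a) L * qpoch h (f - a) L) * this
  rw [h2, ← key, Finset.mul_sum]
  refine Finset.sum_congr rfl fun t ht => ?_
  have ht : t ≤ L := by simpa [Nat.lt_succ_iff] using ht
  rw [sub_sub_cancel, sub_sub_cancel,
    show e - a + (e - g) - e = -(f + t + (L - t : ℕ) - 1) by
      rw [Nat.cast_sub ht]; linear_combination hb,
    qpoch_neg, show f + t + (L - t : ℕ) - 1 - (L - t : ℕ) + 1 = f + t by ring]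
  have : ((-1 : ℂ) ^ L) * (-1) ^ (L - t) = (-1) ^ t := by
    rw [← pow_add, show L + (L - t) = 2 * (L - t) + t by omega, pow_add, pow_mul]
    simp
  rw [← this]
  ring

/-- Whipple's transformation of terminating balanced `₄φ₃` sums, in polynomial form. -/
lemma Generic.whipple (hq : Generic h) (a b c d e f : ℂ) (l : ℕ)
    (hb : d + e + f = a + b + c + 1 - l) :
    ∑ i ∈ Finset.range (l + 1), qbinom h l i * (-1) ^ i * qpoch h a i * qpoch h b i *
      qpoch h c i * qpoch h (d + i) (l - i) * qpoch h (e + i) (l - i) * qpoch h (f + i) (l - i) =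
    ∑ r ∈ Finset.range (l + 1), qbinom h l r * (-1) ^ r * qpoch h a r * qpoch h (d - b) r *
      qpoch h (d - c) r * qpoch h (d + r) (l - r) * qpoch h (e - a) (l - r) *
        qpoch h (f - a) (l - r) := by
  have step : ∀ r ∈ Finset.range (l + 1), qbinom h l r * (-1) ^ r * qpoch h a r *
      qpoch h (d - b) r * qpoch h (d - c) r * qpoch h (d + r) (l - r) * qpoch h (e - a) (l - r) *
        qpoch h (f - a) (l - r) =
      ∑ i ∈ Finset.Ico r (l + 1), qbinom h l i * (-1) ^ i * qpoch h a i *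
        qpoch h (d + i) (l - i) * qpoch h (e + i) (l - i) * qpoch h (f + i) (l - i) *
        (qbinom h i r * qpoch h (d - b) r * qpoch h (d - c) r * qpoch h (b + c - d) (i - r) *
          qpoch h (d + r) (i - r)) := by
    intro r hr
    have hr : r ≤ l := by simpa [Nat.lt_succ_iff] using hr
    -- The product of the symbols of `e - a` and `f - a` is expanded as a balanced `₃φ₂` sum over `t
    -- = i - r`.
    have key := hq.balanced_three_two (a + r) (b + c - d) (e + r) (f + r) (l - r)
      (by rw [Nat.cast_sub hr]; linear_combination hb)
    rw [add_sub_add_right_eq_sub, add_sub_add_right_eq_sub] at key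
    rw [mul_assoc _ (qpoch h (e - a) _), ← key, Finset.sum_Ico_eq_sum_range, Finset.mul_sum,
      show l + 1 - r = l - r + 1 by omega]
    refine Finset.sum_congr rfl fun t ht => ?_
    have ht : t ≤ l - r := by simpa [Nat.lt_succ_iff] using ht
    have h1 := hq.qbinom_mul (n := l) (i := r + t) (r := r) (by omega) (by omega)
    have h2 : qpoch h (d + r) (l - r) = qpoch h (d + r) t * qpoch h (d + (r + t : ℕ)) (l - r - t) := by
      rw [← Nat.add_sub_of_le ht, qpoch_add, Nat.add_sub_cancel_left]
      push_cast
      ring_nf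
    rw [Nat.add_sub_cancel_left] at h1 ⊢
    rw [h2, qpoch_add, pow_add, Nat.sub_sub]
    push_cast
    rw [add_assoc e, add_assoc f]
    linear_combination (-(-1) ^ r * (-1) ^ t * qpoch h a r * qpoch h (a + r) t *
      qpoch h (d - b) r * qpoch h (d - c) r * qpoch h (b + c - d) t * qpoch h (d + r) t *
      qpoch h (d + (r + t)) (l - (r + t)) * qpoch h (e + (r + t)) (l - (r + t)) *
      qpoch h (f + (r + t)) (l - (r + t))) * h1
  -- After the interchange, the inner sum over `r` is Saalschütz's sum and contributes the symbols
  -- of `b` and `c` of length `i`.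
  rw [Finset.sum_congr rfl step, Finset.range_eq_Ico, Finset.sum_Ico_Ico_comm]
  refine Finset.sum_congr rfl fun i _ => ?_
  have := hq.saalschutz b c d i
  rw [Finset.range_eq_Ico] at this
  rw [← Finset.mul_sum, this]
  ring

/-- The sum behind the eigenvalues of the ribbon element. -/
lemma Generic.ribbon_sum (hq : Generic h) (n : ℕ) (x : ℂ) :
    ∑ r ∈ Finset.range (n + 1), qbinom h n r * (-1) ^ r * (qpow h 1 - qpow h (-1)) ^ r *
      qpow h (-(r * (r + 1) / 2) + (n - x) * r) * qpoch h x r = qpow h (-2 * n * x) := by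
  induction n generalizing x with
  | zero => simp [qbinom]
  | succ n ih =>
    have hs := hq.mul_qnum x
    -- The right side at `(n + 1, x)` is expressed by its values at `(n, x)` and `(n, x + 1)`. The
    -- left side obeys the same recursion by the `q`-Pascal rule below, so `x` must stay free in the
    -- induction.
    have : qpow h (-2 * (n + 1 : ℕ) * x) = qpow h (-2 * n * x) -
        (qpow h 1 - qpow h (-1)) * qnum h x * qpow h (2 * n - x) * qpow h (-2 * n * (x + 1)) := by
      rw [hs, sub_mul, sub_mul, ← qpow_add, ← qpow_add, ← qpow_add, ← qpow_add]
      push_cast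
      ring_nf
    rw [this, ← ih, ← ih]
    rw [sum_range_succ_eq_of_pascal n
      (fun r => qbinom h n r * (-1) ^ r * (qpow h 1 - qpow h (-1)) ^ r *
        qpow h (-(r * (r + 1) / 2) + (n - x) * r) * qpoch h x r)
      (fun r => -((qpow h 1 - qpow h (-1)) * qnum h x * qpow h (2 * n - x) *
        (qbinom h n r * (-1) ^ r * (qpow h 1 - qpow h (-1)) ^ r *
        qpow h (-(r * (r + 1) / 2) + (n - (x + 1)) * r) * qpoch h (x + 1) r)))]
    · rw [Finset.sum_add_distrib, Finset.sum_neg_distrib, Finset.mul_sum, ← sub_eq_add_neg]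
    · simp [hq.qbinom_zero_right]
    · simp only [hq.qbinom_self, qpoch_succ']
      have : qpow h (-(((n + 1 : ℕ) : ℂ) * ((n + 1 : ℕ) + 1) / 2) + ((n + 1 : ℕ) - x) * (n + 1 : ℕ)) =
          qpow h (2 * n - x) * qpow h (-(n * (n + 1) / 2) + (n - (x + 1)) * n) := by
        rw [← qpow_add]
        push_cast
        ring_nf
      rw [this]
      ring
    · intro r hr
      obtain ⟨p, rfl⟩ : ∃ p, n = r + 1 + p := ⟨n - (r + 1), by omega⟩
      have e1 : r + 1 + p + 1 - (r + 1) = p + 1 := by omega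
      have e2 : r + 1 + p - (r + 1) = p := by omega
      have e3 : r + 1 + p - r = p + 1 := by omega
      simp only [qbinom, e1, e2, e3]
      rw [qfact_succ h (r + 1 + p), qfact_succ h r, qfact_succ h p, qpoch_succ']
      have f1 := hq.qfact_ne_zero r
      have f2 := hq.qfact_ne_zero p
      have n1 := hq.qnum_natCast_ne_zero (m := r + 1) (by omega)
      have n2 := hq.qnum_natCast_ne_zero (m := p + 1) (by omega)
      have pascal : qnum h ((r + 1 : ℂ) + p + 1) =
          qpow h (-(r + 1)) * qnum h (p + 1) + qpow h (p + 1) * qnum h (r + 1) := by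
        simp only [qnum, mul_div_assoc', ← add_div]
        congr 1
        simp only [mul_sub, ← qpow_add]
        ring_nf
      push_cast at n1 n2 ⊢
      rw [pascal]
      have q1 : qpow h (-((r + 1) * (r + 1 + 1) / 2) + ((r + 1 + p + 1 - x) * (r + 1))) =
          qpow h (r + 1) * qpow h (-((r + 1) * (r + 1 + 1) / 2) + ((r + 1 + p - x) * (r + 1))) := by
        rw [← qpow_add]; ring_nf
      have q2 : qpow h (2 * (r + 1 + p) - x) *
          qpow h (-(r * (r + 1) / 2) + (r + 1 + p - (x + 1)) * r) = qpow h (r + 1) * qpow h (p + 1) *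
          qpow h (-((r + 1) * (r + 1 + 1) / 2) + ((r + 1 + p - x) * (r + 1))) := by
        rw [← qpow_add, ← qpow_add, ← qpow_add]; ring_nf
      have q3 : qpow h (-(r + 1)) * qpow h (r + 1) = 1 := by rw [← qpow_add]; simp
      rw [q1]
      set F := qfact h (r + 1 + p) /
        (qfact h r * qnum h (r + 1) * (qfact h p * qnum h (p + 1))) with hF
      have d1 : qfact h (r + 1 + p) / (qfact h r * qnum h (r + 1) * qfact h p) =
          F * qnum h (p + 1) := by rw [hF]; field_simp
      have d2 : qfact h (r + 1 + p) / (qfact h r * (qfact h p * qnum h (p + 1))) =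
          F * qnum h (r + 1) := by rw [hF]; field_simp
      rw [d1, d2, mul_div_right_comm, ← hF]
      linear_combination (F * (-1) ^ (r + 1) * (qpow h 1 - qpow h (-1)) ^ (r + 1) * qnum h x *
        qpoch h (x + 1) r) * (qnum h (p + 1) *
          qpow h (-((r + 1) * (r + 1 + 1) / 2) + ((r + 1 + p - x) * (r + 1))) * q3 -
          qnum h (r + 1) * q2)

/-! ### Racah's sum -/

lemma Generic.qpoch_add_one (hq : Generic h) (a m : ℕ) :
    qpoch h (a + 1) m = qfact h (a + m) / qfact h a := by
  rw [← qfact_mul_qpoch, mul_div_cancel_left₀ _ (hq.qfact_ne_zero a)]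

lemma Generic.qpoch_neg_natCast (hq : Generic h) {a m : ℕ} (hm : m ≤ a) :
    qpoch h (-a) m = (-1) ^ m * qfact h a / qfact h (a - m) := by
  rw [← qfact_mul_qpoch_neg h hm, mul_div_cancel_left₀ _ (hq.qfact_ne_zero _)]

lemma neg_one_pow_mul_self (n : ℕ) : (-1 : ℂ) ^ n * (-1) ^ n = 1 := by
  rw [← mul_pow]; simp

lemma neg_one_pow_sub {m n : ℕ} (hm : m ≤ n) : (-1 : ℂ) ^ (n - m) = (-1) ^ n * (-1) ^ m := by
  conv_rhs => rw [← Nat.sub_add_cancel hm, pow_add, mul_assoc, neg_one_pow_mul_self, mul_one]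

/-- A balanced `₃φ₂` whose value contains the symbol of `e - a = 1 - L` of length `L`, hence the
factor `[0]`. These sums are the entries off the diagonal in `Generic.sum_triG_mul_triGinv`. -/
lemma Generic.alternating_sum_eq_zero (hq : Generic h) {P L : ℕ} (hL : 0 < L) (hP : 2 * L ≤ P) :
    ∑ t ∈ Finset.range (L + 1), (-1) ^ t * qfact h (P - t) /
      (qfact h t * qfact h (L - t) * qfact h (P - L + 1 - t)) = 0 := by
  have key := hq.balanced_three_two (-((P - L + 1 : ℕ) : ℂ)) 1 (-(P : ℂ)) 1 L
    (by rw [Nat.cast_add, Nat.cast_sub (by omega)]; push_cast; ring)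
  have h0 : qpoch h (-(P : ℂ) - -((P - L + 1 : ℕ) : ℂ)) L = 0 := by
    have : -(P : ℂ) - -((P - L + 1 : ℕ) : ℂ) = -((L - 1 : ℕ) : ℂ) := by
      rw [Nat.cast_add, Nat.cast_sub (by omega), Nat.cast_sub (by omega)]; push_cast; ring
    rw [this]
    exact qpoch_neg_eq_zero h (by omega)
  rw [h0, zero_mul] at key
  have hc : (-1 : ℂ) ^ L * qfact h (P - L + 1) * qfact h L * qfact h L / qfact h (P - L) ≠ 0 := by
    have := hq.qfact_ne_zero
    simp [this]
  refine (mul_eq_zero.mp ?_).resolve_left hc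
  rw [← key, Finset.mul_sum]
  refine Finset.sum_congr rfl fun t ht => ?_
  have ht : t ≤ L := by simpa [Nat.lt_succ_iff] using ht
  have h1 : qpoch h (1 : ℂ) t * qpoch h (1 + (t : ℂ)) (L - t) = qfact h L := by
    rw [← qpoch_add, Nat.add_sub_of_le ht, qpoch_one]
  have h2 : -(P : ℂ) + t = -((P - t : ℕ) : ℂ) := by rw [Nat.cast_sub (by omega)]; ring
  rw [hq.qpoch_neg_natCast (a := P - L + 1) (m := t) (by omega), h2,
    hq.qpoch_neg_natCast (a := P - t) (m := L - t) (by omega),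
    show P - t - (L - t) = P - L by omega, qbinom, neg_one_pow_sub ht]
  have n := hq.qfact_ne_zero
  have n1 := n t
  have n2 := n (L - t)
  have n3 := n (P - L + 1 - t)
  have n4 := n (P - L)
  have hε := neg_one_pow_mul_self t
  generalize (-1 : ℂ) ^ t = ε at hε ⊢
  generalize (-1 : ℂ) ^ L = σ
  field_simp
  linear_combination (-qfact h (P - L + 1) * qfact h L * qfact h (P - t) * σ * ε ^ 3) * h1 -
    (σ * ε * qfact h (P - L + 1) * qfact h L ^ 2 * qfact h (P - t)) * hε

/-- Entries of the triangular matrix of middle coordinates of the highest weight vectors. -/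
def triG (h : ℂ) (N l i : ℕ) : ℂ :=
  if l ≤ i then qfact h (2 * N - l - i) / qfact h (i - l) else 0

/-- Entries of the inverse of `triG`. -/
def triGinv (h : ℂ) (N i l : ℕ) : ℂ :=
  if i ≤ l then (-1) ^ (l + i) * qnum h (2 * N - 2 * l + 1) /
    (qfact h (l - i) * qfact h (2 * N - l - i + 1)) else 0

/-- Both matrices are upper triangular, so only `l ≤ i ≤ l'` contributes. Above the diagonal the sum
is `Generic.alternating_sum_eq_zero` with `P = 2N - 2l` and `L = l' - l`. -/
lemma Generic.sum_triG_mul_triGinv (hq : Generic h) {N lo hi l l' : ℕ} (hhi : hi ≤ N)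
    (hl : l ∈ Finset.Icc lo hi) (hl' : l' ∈ Finset.Icc lo hi) :
    ∑ i ∈ Finset.Icc lo hi, triG h N l i * triGinv h N i l' = if l = l' then 1 else 0 := by
  rw [Finset.mem_Icc] at hl hl'
  have hsub : Finset.Icc l l' ⊆ Finset.Icc lo hi := Finset.Icc_subset_Icc hl.1 hl'.2
  rw [← Finset.sum_subset hsub]
  swap
  · intro i _ hi
    rw [Finset.mem_Icc, not_and_or] at hi
    rcases hi with hi | hi
    · rw [triG, if_neg hi, zero_mul]
    · rw [triGinv, if_neg hi, mul_zero]
  rcases lt_trichotomy l l' with hlt | rfl | hgt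
  · rw [if_neg hlt.ne, ← Finset.Ico_add_one_right_eq_Icc, Finset.sum_Ico_eq_sum_range]
    have key := hq.alternating_sum_eq_zero (P := 2 * N - 2 * l) (L := l' - l) (by omega) (by omega)
    rw [← mul_zero ((-1) ^ (l + l') * qnum h (2 * N - 2 * l' + 1)), ← key, Finset.mul_sum,
      show l' + 1 - l = l' - l + 1 by omega]
    refine Finset.sum_congr rfl fun t ht => ?_
    have ht : t ≤ l' - l := by simpa [Nat.lt_succ_iff] using ht
    rw [triG, if_pos (by omega), triGinv, if_pos (by omega),
      show 2 * N - l - (l + t) = 2 * N - 2 * l - t by omega, show l + t - l = t by omega,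
      show l' - (l + t) = l' - l - t by omega,
      show 2 * N - l' - (l + t) + 1 = 2 * N - 2 * l - (l' - l) + 1 - t by omega,
      show l' + (l + t) = l + l' + t by ring, pow_add _ (l + l')]
    ring
  · rw [if_pos rfl, Finset.Icc_self, Finset.sum_singleton, triG, if_pos le_rfl, triGinv,
      if_pos le_rfl, Nat.sub_self, qfact_zero, pow_add, neg_one_pow_mul_self, qfact_succ,
      show 2 * N - l - l = 2 * N - 2 * l by omega, Nat.cast_sub (by omega)]
    have h1 := hq.qfact_ne_zero (2 * N - 2 * l)
    have h2 := hq.qnum_natCast_ne_zero (m := 2 * N - 2 * l + 1) (by omega)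
    rw [Nat.cast_add, Nat.cast_sub (by omega)] at h2
    push_cast at h2 ⊢
    have h3 : 2 * ((N : ℂ) - l) + 1 = 2 * N - 2 * l + 1 := by ring
    rw [← mul_sub, h3] at *
    field_simp
  · rw [if_neg hgt.ne', Finset.Icc_eq_empty (by omega), Finset.sum_empty]

/-- Middle coordinates of the highest weight vectors of the opposite coupling. -/
def midH (h : ℂ) (N n k i : ℕ) : ℂ :=
  if i + k ≤ n then qfact h (2 * N - k - n + i) * qfact h (N - i) * qfact h (n - i) /
    (qfact h (n - i - k) * qfact h i * qfact h (N + i - n)) else 0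

/-- The sum in Racah's formula for the entries of `A`. -/
def racahSum (h : ℂ) (N n l k : ℕ) : ℂ :=
  ∑ z ∈ Finset.Icc (max (max (2 * N - l) (3 * N - n - k)) (max (2 * N - k) (3 * N - n - l)))
      (min (min (3 * N - n) (3 * N - l - k)) (4 * N - n - l - k)),
    (-1 : ℂ) ^ z * qfact h (z + 1) /
      (qfact h (z - (2 * N - l)) * qfact h (z - (3 * N - n - k)) * qfact h (z - (2 * N - k)) *
        qfact h (z - (3 * N - n - l)) * qfact h (3 * N - n - z) * qfact h (3 * N - l - k - z) *
        qfact h (4 * N - n - l - k - z))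

/-- The factor of `triG⁻¹ * midH` that depends on the row. -/
def rowFactor (h : ℂ) (N n l : ℕ) : ℂ :=
  qnum h (2 * N - 2 * l + 1) * qfact h (N - l) * qfact h (n - l) /
    (qfact h (3 * N - n - l + 1) * qfact h (2 * N - l + 1))

/-- The factor of `triG⁻¹ * midH` that depends on the column. -/
def colFactor (h : ℂ) (N n k : ℕ) : ℂ :=
  qfact h (N - k) * qfact h (N + k - n) * qfact h k * qfact h (2 * N - k - n)

lemma mem_Idx {N n k : ℕ} :
    k ∈ Finset.Icc (n - N) (min n (2 * N - n)) ↔ n ≤ k + N ∧ k ≤ n ∧ k ≤ 2 * N - n := by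
  rw [Finset.mem_Icc, le_min_iff]
  omega

/-- `[x + 1 + i] ⋯ [x + l]` for an integer `x = N - n`, as a quotient of factorials. -/
lemma Generic.qpoch_shift (hq : Generic h) {N n i l : ℕ} (hi : i ≤ l) (hl : n ≤ l + N) :
    qpoch h ((N : ℂ) - n + 1 + i) (l - i) =
      if n ≤ N + i then qfact h (N + l - n) / qfact h (N + i - n) else 0 := by
  split_ifs with hc
  · rw [show (N : ℂ) - n + 1 + i = ((N + i - n : ℕ) : ℂ) + 1 by
      rw [Nat.cast_sub hc]; push_cast; ring, hq.qpoch_add_one,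
      show N + i - n + (l - i) = N + l - n by omega]
  · rw [show (N : ℂ) - n + 1 + i = -((n - N - i - 1 : ℕ) : ℂ) by
      rw [Nat.sub_sub, Nat.sub_sub, Nat.cast_sub (by omega)]; push_cast; ring]
    exact qpoch_neg_eq_zero h (by omega)

lemma Generic.qpoch_neg_eq_ite (hq : Generic h) (a m : ℕ) :
    qpoch h (-a) m = if m ≤ a then (-1) ^ m * qfact h a / qfact h (a - m) else 0 := by
  split_ifs with hc
  · exact hq.qpoch_neg_natCast hc
  · exact qpoch_neg_eq_zero h (by omega)

/-- The sum on the left of Whipple's transformation. -/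
lemma Generic.whipple_left (hq : Generic h) {N n k l : ℕ}
    (hk : n ≤ k + N ∧ k ≤ n ∧ k ≤ 2 * N - n) (hl : n ≤ l + N ∧ l ≤ n ∧ l ≤ 2 * N - n) :
    ∑ i ∈ Finset.range (l + 1), qbinom h l i * (-1) ^ i * qpoch h ((k : ℂ) - n) i *
      qpoch h (2 * N - k - n + 1) i * qpoch h ((l : ℂ) - 2 * N - 1) i *
      qpoch h ((N : ℂ) - n + 1 + i) (l - i) * qpoch h (-(N : ℂ) + i) (l - i) *
      qpoch h (-(n : ℂ) + i) (l - i) =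
    (qfact h l * qfact h (n - k) * qfact h (2 * N + 1 - l) * qfact h (N + l - n)) /
      (qfact h (2 * N - k - n) * qfact h (N - l) * qfact h (n - l)) *
      ∑ i ∈ Finset.Icc (n - N) l, (-1) ^ i * midH h N n k i /
        (qfact h (l - i) * qfact h (2 * N - l - i + 1)) := by
  rw [Finset.mul_sum]
  have hsub : Finset.Icc (n - N) l ⊆ Finset.range (l + 1) := by
    intro i hi
    rw [Finset.mem_Icc] at hi
    rw [Finset.mem_range]
    omega
  rw [← Finset.sum_subset hsub]
  swap
  · intro i hi hi'
    rw [Finset.mem_range] at hi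
    rw [Finset.mem_Icc] at hi'
    -- For `i < n - N` the symbol `[N - n + 1 + i] ⋯ [N - n + l]` contains `[0]`, so the range of
    -- Whipple's sum shrinks by itself to the range of coordinates.
    rw [hq.qpoch_shift (by omega) hl.1, if_neg (by omega)]
    ring
  refine Finset.sum_congr rfl fun i hi => ?_
  rw [Finset.mem_Icc] at hi
  rw [hq.qpoch_shift (by omega) hl.1, if_pos (by omega)]
  have e1 : (k : ℂ) - n = -((n - k : ℕ) : ℂ) := by rw [Nat.cast_sub hk.2.1]; ring
  have e2 : 2 * (N : ℂ) - k - n + 1 = ((2 * N - k - n : ℕ) : ℂ) + 1 := by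
    rw [Nat.cast_sub (by omega), Nat.cast_sub (by omega)]; push_cast; ring
  have e3 : (l : ℂ) - 2 * N - 1 = -((2 * N + 1 - l : ℕ) : ℂ) := by
    rw [Nat.cast_sub (by omega)]; push_cast; ring
  have e4 : -(N : ℂ) + i = -((N - i : ℕ) : ℂ) := by rw [Nat.cast_sub (by omega)]; ring
  have e5 : -(n : ℂ) + i = -((n - i : ℕ) : ℂ) := by rw [Nat.cast_sub (by omega)]; ring
  rw [e1, e2, e3, e4, e5, hq.qpoch_neg_eq_ite (n - k), hq.qpoch_add_one,
    hq.qpoch_neg_natCast (a := 2 * N + 1 - l) (by omega),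
    hq.qpoch_neg_natCast (a := N - i) (by omega), hq.qpoch_neg_natCast (a := n - i) (by omega),
    midH]
  by_cases hc : i + k ≤ n
  · rw [if_pos hc, if_pos (by omega), show N - i - (l - i) = N - l by omega,
      show n - i - (l - i) = n - l by omega, show 2 * N + 1 - l - i = 2 * N - l - i + 1 by omega,
      show n - i - k = n - k - i by omega, qbinom]
    simp only [div_eq_mul_inv, mul_inv]
    ring_nf
    simp only [pow_mul', neg_one_sq, one_pow, mul_one]
    norm_num
  · rw [if_neg hc, if_neg (by omega)]
    ring

/-- The sum on the right of Whipple's transformation. -/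
lemma Generic.whipple_right (hq : Generic h) {N n k l : ℕ} (hn : 2 * n ≤ 3 * N)
    (hk : n ≤ k + N ∧ k ≤ n ∧ k ≤ 2 * N - n) (hl : n ≤ l + N ∧ l ≤ n ∧ l ≤ 2 * N - n) :
    ∑ r ∈ Finset.range (l + 1), qbinom h l r * (-1) ^ r * qpoch h ((k : ℂ) - n) r *
      qpoch h ((k : ℂ) - N) r * qpoch h ((3 * N - n - l + 1 : ℕ) + 1) r *
      qpoch h ((N : ℂ) - n + 1 + r) (l - r) * qpoch h ((n : ℂ) - N - k) (l - r) *
      qpoch h (-(k : ℂ)) (l - r) =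
    (-1) ^ (3 * N - n - l) * (qfact h l * qfact h (n - k) * qfact h (N - k) * qfact h (N + l - n) *
      qfact h (N + k - n) * qfact h k / qfact h (3 * N - n - l + 1)) * racahSum h N n l k := by
  rw [racahSum, Finset.mul_sum]
  set B := 3 * N - n - l with hB
  -- The index of Racah's sum is `z = B + r`, and the bounds on `z` single out exactly those `r` for
  -- which none of the Pochhammer symbols vanishes.
  have hbij : ∀ F : ℕ → ℂ,
      ∑ z ∈ Finset.Icc (max (max (2 * N - l) (3 * N - n - k)) (max (2 * N - k) B))
        (min (min (3 * N - n) (3 * N - l - k)) (4 * N - n - l - k)), F z =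
      ∑ r ∈ (Finset.range (l + 1)).filter (fun r => (r ≤ n - k ∧ r ≤ N - k) ∧ n ≤ N + r ∧
        l - r ≤ N + k - n ∧ l - r ≤ k), F (B + r) := by
    intro F
    refine Finset.sum_nbij' (fun z => z - B) (fun r => B + r) ?_ ?_ ?_ ?_ ?_
    · intro z hz
      simp only [Finset.mem_Icc, max_le_iff, le_min_iff, Finset.mem_filter, Finset.mem_range] at hz ⊢
      omega
    · intro r hr
      simp only [Finset.mem_Icc, max_le_iff, le_min_iff, Finset.mem_filter, Finset.mem_range] at hr ⊢
      omega
    · intro z hz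
      simp only [Finset.mem_Icc, max_le_iff, le_min_iff] at hz
      omega
    · intro r _
      simp
    · intro z hz
      simp only [Finset.mem_Icc, max_le_iff, le_min_iff] at hz
      rw [Nat.add_sub_of_le hz.1.2.2]
  rw [hbij, Finset.sum_filter]
  refine Finset.sum_congr rfl fun r hr => ?_
  have hr : r ≤ l := by simpa [Nat.lt_succ_iff] using hr
  have e1 : (k : ℂ) - n = -((n - k : ℕ) : ℂ) := by rw [Nat.cast_sub hk.2.1]; ring
  have e2 : (k : ℂ) - N = -((N - k : ℕ) : ℂ) := by rw [Nat.cast_sub (by omega)]; ring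
  have e3 : (n : ℂ) - N - k = -((N + k - n : ℕ) : ℂ) := by
    rw [Nat.cast_sub (by omega)]; push_cast; ring
  rw [hq.qpoch_shift hr hl.1, e1, e2, e3, hq.qpoch_add_one, hq.qpoch_neg_eq_ite,
    hq.qpoch_neg_eq_ite, hq.qpoch_neg_eq_ite, hq.qpoch_neg_eq_ite]
  by_cases hc : (r ≤ n - k ∧ r ≤ N - k) ∧ n ≤ N + r ∧ l - r ≤ N + k - n ∧ l - r ≤ k
  · rw [if_pos hc]
    obtain ⟨⟨c1, c2⟩, c3, c4, c5⟩ := hc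
    rw [if_pos c1, if_pos c2, if_pos c3, if_pos c4, if_pos c5,
      show B + r - (2 * N - l) = N + r - n by omega,
      show B + r - (3 * N - n - k) = k - (l - r) by omega,
      show B + r - (2 * N - k) = N + k - n - (l - r) by omega, Nat.add_sub_cancel_left,
      show 3 * N - n - (B + r) = l - r by omega,
      show 3 * N - l - k - (B + r) = n - k - r by omega,
      show 4 * N - n - l - k - (B + r) = N - k - r by omega, qbinom, pow_add,
      show B + 1 + r = B + r + 1 by omega]
    have s1 := neg_one_pow_mul_self r
    have s2 := neg_one_pow_mul_self (l - r)
    have s3 := neg_one_pow_mul_self B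
    simp only [div_eq_mul_inv, mul_inv]
    ring_nf
    have s4 : ((-1 : ℂ) ^ r) ^ 3 = (-1) ^ r := by rw [pow_succ, pow_two, s1, one_mul]
    have s5 : ((-1 : ℂ) ^ (l - r)) ^ 2 = 1 := by rw [pow_two, s2]
    have s6 : ((-1 : ℂ) ^ B) ^ 2 = 1 := by rw [pow_two, s3]
    simp only [pow_mul, mul_one, s4, s5, s6]
  · rw [if_neg hc]
    have : ¬ r ≤ n - k ∨ ¬ r ≤ N - k ∨ ¬ n ≤ N + r ∨ ¬ l - r ≤ N + k - n ∨ ¬ l - r ≤ k := by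
      omega
    rcases this with c | c | c | c | c <;> simp only [if_neg c, mul_zero, zero_mul]

/-- The left side is a terminating balanced `₄φ₃`, since `triGinv` and `midH` are ratios of
factorials. Whipple's transformation trades it for the `₄φ₃` of Racah's formula. -/
lemma Generic.sum_midH_mul_triGinv (hq : Generic h) {N n k l : ℕ} (hn : 2 * n ≤ 3 * N)
    (hk : k ∈ Finset.Icc (n - N) (min n (2 * N - n)))
    (hl : l ∈ Finset.Icc (n - N) (min n (2 * N - n))) :
    ∑ i ∈ Finset.Icc (n - N) (min n (2 * N - n)), midH h N n k i * triGinv h N i l =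
      (-1) ^ (N + n) * rowFactor h N n l * colFactor h N n k * racahSum h N n l k := by
  have hl' := mem_Idx.mp hl
  have hk' := mem_Idx.mp hk
  rw [Finset.mem_Icc] at hl
  have hsub : Finset.Icc (n - N) l ⊆ Finset.Icc (n - N) (min n (2 * N - n)) :=
    Finset.Icc_subset_Icc le_rfl hl.2
  rw [← Finset.sum_subset hsub]
  swap
  · intro i hi hi'
    rw [Finset.mem_Icc] at hi hi'
    rw [triGinv, if_neg (by omega), mul_zero]
  have key := hq.whipple ((k : ℂ) - n) (2 * N - k - n + 1) ((l : ℂ) - 2 * N - 1) ((N : ℂ) - n + 1)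
    (-N) (-n) l (by ring)
  rw [hq.whipple_left hk' hl',
    show (N : ℂ) - n + 1 - (2 * N - k - n + 1) = k - N by ring,
    show (N : ℂ) - n + 1 - (l - 2 * N - 1) = ((3 * N - n - l + 1 : ℕ) : ℂ) + 1 by
      rw [Nat.cast_add, Nat.cast_sub (by omega), Nat.cast_sub (by omega)]; push_cast; ring,
    show -(N : ℂ) - (k - n) = n - N - k by ring, show -(n : ℂ) - (k - n) = -k by ring,
    hq.whipple_right hn hk' hl'] at key
  have hsum : ∑ i ∈ Finset.Icc (n - N) l, midH h N n k i * triGinv h N i l =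
      (-1) ^ l * qnum h (2 * N - 2 * l + 1) * ∑ i ∈ Finset.Icc (n - N) l, (-1) ^ i *
        midH h N n k i / (qfact h (l - i) * qfact h (2 * N - l - i + 1)) := by
    rw [Finset.mul_sum]
    refine Finset.sum_congr rfl fun i hi => ?_
    rw [Finset.mem_Icc] at hi
    rw [triGinv, if_pos hi.2, pow_add]
    ring
  rw [hsum]
  have hs : (-1 : ℂ) ^ (3 * N - n - l) = (-1) ^ (N + n) * (-1) ^ l := by
    rw [Nat.sub_sub, neg_one_pow_sub (by omega), pow_mul]
    norm_num
    rw [pow_add, pow_add, mul_assoc]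
  rw [hs] at key
  have n0 := hq.qfact_ne_zero
  have n1 := n0 l
  have n2 := n0 (n - k)
  have n3 := n0 (N + l - n)
  have n4 := n0 (2 * N - k - n)
  have n5 := n0 (N - l)
  have n6 := n0 (n - l)
  have n7 := n0 (3 * N - n - l + 1)
  have n8 := n0 (2 * N + 1 - l)
  rw [rowFactor, colFactor, show 2 * N - l + 1 = 2 * N + 1 - l by omega]
  set S := ∑ i ∈ Finset.Icc (n - N) l, (-1) ^ i * midH h N n k i /
    (qfact h (l - i) * qfact h (2 * N - l - i + 1))
  have hS : S = (-1) ^ (N + n) * (-1) ^ l * (qfact h (N - k) * qfact h (N + k - n) * qfact h k *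
      qfact h (2 * N - k - n) * qfact h (N - l) * qfact h (n - l) /
        (qfact h (3 * N - n - l + 1) * qfact h (2 * N + 1 - l))) * racahSum h N n l k := by
    field_simp at key ⊢
    linear_combination key
  rw [hS]
  linear_combination (qnum h (2 * N - 2 * l + 1) * ((-1) ^ (N + n) * (qfact h (N - k) *
    qfact h (N + k - n) * qfact h k * qfact h (2 * N - k - n) * qfact h (N - l) * qfact h (n - l) /
    (qfact h (3 * N - n - l + 1) * qfact h (2 * N + 1 - l))) * racahSum h N n l k)) *
    neg_one_pow_mul_self l

/-! ### From Racah's sum to the matrix `A`. -/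

lemma csqrt_sq (z : ℂ) : csqrt z ^ 2 = z := by
  rw [csqrt, ← Complex.cpow_nat_mul]
  norm_num

/-- The factor of the entries of `A` that comes from the triangle coefficients. -/
def normFactor (h : ℂ) (N n k : ℕ) : ℂ :=
  csqrt (qnum h (2 * N - 2 * k + 1)) * triangle h N N (2 * N - 2 * k) *
    triangle h N (3 * N - 2 * n) (2 * N - 2 * k)

/-- The entries of `A` carry `normFactor` of row times `normFactor` of column, the computed
transition matrix carries `rowFactor` of row times `colFactor` of column. This identity makes the
two agree up to rescaling of the bases, and it holds for any choice of the square roots. -/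
lemma normFactor_sq {N n k : ℕ} (hn : 2 * n ≤ 3 * N)
    (hk : k ∈ Finset.Icc (n - N) (min n (2 * N - n))) :
    normFactor h N n k ^ 2 = rowFactor h N n k * colFactor h N n k := by
  rw [mem_Idx] at hk
  rw [normFactor, mul_pow, mul_pow, triangle, triangle, csqrt_sq, csqrt_sq, csqrt_sq, rowFactor,
    colFactor, show (N + N - (2 * N - 2 * k)) / 2 = k by omega,
    show (N + (2 * N - 2 * k) - N) / 2 = N - k by omega,
    show (N + N + (2 * N - 2 * k)) / 2 + 1 = 2 * N - k + 1 by omega,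
    show (N + (3 * N - 2 * n) - (2 * N - 2 * k)) / 2 = N + k - n by omega,
    show (N + (2 * N - 2 * k) - (3 * N - 2 * n)) / 2 = n - k by omega,
    show (3 * N - 2 * n + (2 * N - 2 * k) - N) / 2 = 2 * N - k - n by omega,
    show (N + (3 * N - 2 * n) + (2 * N - 2 * k)) / 2 + 1 = 3 * N - n - k + 1 by omega]
  simp only [div_eq_mul_inv, mul_inv]
  ring

lemma Generic.rowFactor_ne_zero (hq : Generic h) {N n k : ℕ} (hk : k ≤ N) :
    rowFactor h N n k ≠ 0 := by
  have h2 := hq.qnum_natCast_ne_zero (m := 2 * N - 2 * k + 1) (by omega)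
  rw [Nat.cast_add, Nat.cast_sub (by omega)] at h2
  push_cast at h2
  simp [rowFactor, hq.qfact_ne_zero, h2]

lemma Generic.colFactor_ne_zero (hq : Generic h) (N n k : ℕ) : colFactor h N n k ≠ 0 := by
  simp [colFactor, hq.qfact_ne_zero]

lemma Generic.normFactor_ne_zero (hq : Generic h) {N n k : ℕ} (hn : 2 * n ≤ 3 * N)
    (hk : k ∈ Finset.Icc (n - N) (min n (2 * N - n))) : normFactor h N n k ≠ 0 := by
  have h1 := hq.rowFactor_ne_zero (N := N) (n := n) (k := k) (by rw [mem_Idx] at hk; omega)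
  have h2 := hq.colFactor_ne_zero N n k
  intro H
  have := normFactor_sq (h := h) hn hk
  rw [H] at this
  exact mul_ne_zero h1 h2 (by rw [← this]; norm_num)

/-- On the index set all four triangle conditions hold. Two of the triangle coefficients depend on
the row only and two on the column only. -/
lemma A_apply {N n : ℕ} (hn : 2 * n ≤ 3 * N) (l k : Idx N n) :
    A N n h l k = (-1) ^ (N + n) * normFactor h N n l * normFactor h N n k *
      racahSum h N n l k := by
  obtain ⟨l, hl⟩ := l
  obtain ⟨k, hk⟩ := k
  rw [mem_Idx] at hl hk
  simp only [A, Matrix.of_apply, normFactor, sixJ, racahSum]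
  rw [if_pos (by
    simp only [Triad, Nat.even_iff]
    omega)]
  have hs : (-1 : ℂ) ^ ((N : ℤ) - n) = (-1) ^ (N + n) := by
    rw [zpow_sub₀ (by norm_num), zpow_natCast, zpow_natCast, pow_add, div_eq_mul_inv, ← inv_pow]
    norm_num
  rw [hs, show (N + N + (2 * N - 2 * l)) / 2 = 2 * N - l by omega,
    show (N + (3 * N - 2 * n) + (2 * N - 2 * k)) / 2 = 3 * N - n - k by omega,
    show (N + N + (2 * N - 2 * k)) / 2 = 2 * N - k by omega,
    show (N + (3 * N - 2 * n) + (2 * N - 2 * l)) / 2 = 3 * N - n - l by omega,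
    show (N + N + N + (3 * N - 2 * n)) / 2 = 3 * N - n by omega,
    show (N + N + (2 * N - 2 * l) + (2 * N - 2 * k)) / 2 = 3 * N - l - k by omega,
    show (N + (3 * N - 2 * n) + (2 * N - 2 * l) + (2 * N - 2 * k)) / 2 = 4 * N - n - l - k by omega]
  ring

/-- `A` is built from `q`-numbers alone, and these are invariant under `q ↦ q⁻¹`; the square roots
are taken of the same complex numbers. -/
lemma A_neg_left (N n : ℕ) (h : ℂ) : A N n (-h) = A N n h := by
  ext k k'
  simp only [A, Matrix.of_apply, sixJ, triangle, qnum_neg_left, qfact_neg_left]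

/-! ### Weight modules of `U_q(sl_2)` -/

/-- The space of vectors of weight `m / 2`. -/
def wtSpace {M : Type*} [AddCommGroup M] [Module ℂ M] (h : ℂ) (K : Module.End ℂ M) (m : ℤ) :
    Submodule ℂ M :=
  Module.End.eigenspace K (qpow h ((m : ℂ) / 2))

/-- The operators `E = X⁺`, `F = X⁻`, `K = q ^ H` and `Ki = q ^ (-H)` on a weight module whose
weights have absolute value at most `L / 2`. -/
structure UqModule {M : Type*} [AddCommGroup M] [Module ℂ M] (h : ℂ) (E F K Ki : Module.End ℂ M)
    (L : ℕ) : Prop where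
  K_mul_E : K * E = qpow h 1 • (E * K)
  K_mul_F : K * F = qpow h (-1) • (F * K)
  K_mul_Ki : K * Ki = 1
  Ki_mul_K : Ki * K = 1
  comm : (qpow h 1 - qpow h (-1)) • (E * F - F * E) = K * K - Ki * Ki
  span : ⊤ ≤ ⨆ m ∈ {m : ℤ | |m| ≤ L}, wtSpace h K m

lemma qpow_neg_one_mul_one (h : ℂ) : qpow h (-1) * qpow h 1 = 1 := by
  rw [← qpow_add]; simp

lemma qpow_one_mul_neg_one (h : ℂ) : qpow h 1 * qpow h (-1) = 1 := by
  rw [← qpow_add]; simp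

section Module

variable {M : Type*} [AddCommGroup M] [Module ℂ M] {E F K Ki : Module.End ℂ M} {L : ℕ}

lemma mem_wtSpace {m : ℤ} {x : M} : x ∈ wtSpace h K m ↔ K x = qpow h ((m : ℂ) / 2) • x :=
  Module.End.mem_eigenspace_iff

lemma UqModule.Ki_apply (hM : UqModule h E F K Ki L) {m : ℤ} {x : M} (hx : x ∈ wtSpace h K m) :
    Ki x = qpow h (-((m : ℂ) / 2)) • x := by
  rw [mem_wtSpace] at hx
  have h1 : Ki (K x) = x := by rw [← Module.End.mul_apply, hM.Ki_mul_K, Module.End.one_apply]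
  rw [hx, map_smul] at h1
  conv_rhs => rw [← h1, smul_smul, ← qpow_add, neg_add_cancel, qpow_zero, one_smul]

lemma UqModule.wtSpace_Ki (hM : UqModule h E F K Ki L) (m : ℤ) :
    wtSpace h Ki m = wtSpace h K (-m) := by
  ext x
  constructor
  · intro hx
    rw [mem_wtSpace] at hx ⊢
    have h1 : K (Ki x) = x := by rw [← Module.End.mul_apply, hM.K_mul_Ki, Module.End.one_apply]
    rw [hx, map_smul] at h1
    conv_rhs => rw [← h1, smul_smul, ← qpow_add]
    push_cast
    rw [neg_div, neg_add_cancel, qpow_zero, one_smul]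
  · intro hx
    rw [mem_wtSpace, hM.Ki_apply hx]
    push_cast
    rw [neg_div, neg_neg]

/-- Exchanging the roles of `X⁺` and `X⁻`. -/
lemma UqModule.swap (hM : UqModule h E F K Ki L) : UqModule h F E Ki K L where
  K_mul_E := by
    have : Ki * (K * F) * Ki = qpow h (-1) • (Ki * (F * K) * Ki) := by
      rw [hM.K_mul_F]; simp
    rw [← mul_assoc, hM.Ki_mul_K, one_mul, ← mul_assoc, mul_assoc _ K, hM.K_mul_Ki, mul_one] at this
    rw [this, smul_smul, qpow_one_mul_neg_one, one_smul]
  K_mul_F := by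
    have : Ki * (K * E) * Ki = qpow h 1 • (Ki * (E * K) * Ki) := by
      rw [hM.K_mul_E]; simp
    rw [← mul_assoc, hM.Ki_mul_K, one_mul, ← mul_assoc, mul_assoc _ K, hM.K_mul_Ki, mul_one] at this
    rw [this, smul_smul, qpow_neg_one_mul_one, one_smul]
  K_mul_Ki := hM.Ki_mul_K
  Ki_mul_K := hM.K_mul_Ki
  comm := by rw [← neg_sub (E * F), smul_neg, hM.comm, neg_sub]
  span := by
    refine hM.span.trans (iSup₂_le fun m hm => ?_)
    refine le_iSup₂_of_le (-m) (by simpa using hm) ?_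
    rw [hM.wtSpace_Ki, neg_neg]

lemma UqModule.E_mem (hM : UqModule h E F K Ki L) {m : ℤ} {x : M} (hx : x ∈ wtSpace h K m) :
    E x ∈ wtSpace h K (m + 2) := by
  rw [mem_wtSpace] at *
  rw [← Module.End.mul_apply, hM.K_mul_E, LinearMap.smul_apply, Module.End.mul_apply, hx, map_smul,
    smul_smul, ← qpow_add]
  push_cast
  ring_nf

lemma UqModule.F_mem (hM : UqModule h E F K Ki L) {m : ℤ} {x : M} (hx : x ∈ wtSpace h K m) :
    F x ∈ wtSpace h K (m - 2) := by
  rw [mem_wtSpace] at *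
  rw [← Module.End.mul_apply, hM.K_mul_F, LinearMap.smul_apply, Module.End.mul_apply, hx, map_smul,
    smul_smul, ← qpow_add]
  push_cast
  ring_nf

lemma UqModule.E_pow_mem (hM : UqModule h E F K Ki L) {m : ℤ} {x : M} (hx : x ∈ wtSpace h K m)
    (p : ℕ) : (E ^ p) x ∈ wtSpace h K (m + 2 * p) := by
  induction p with
  | zero => simpa using hx
  | succ p ih =>
    rw [pow_succ', Module.End.mul_apply]
    convert hM.E_mem ih using 1
    push_cast
    ring_nf

lemma UqModule.F_pow_mem (hM : UqModule h E F K Ki L) {m : ℤ} {x : M} (hx : x ∈ wtSpace h K m)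
    (p : ℕ) : (F ^ p) x ∈ wtSpace h K (m - 2 * p) := by
  induction p with
  | zero => simpa using hx
  | succ p ih =>
    rw [pow_succ', Module.End.mul_apply]
    convert hM.F_mem ih using 1
    push_cast
    ring_nf

lemma UqModule.E_F_apply (hM : UqModule h E F K Ki L) (hq : Generic h) {m : ℤ} {x : M}
    (hx : x ∈ wtSpace h K m) : E (F x) = F (E x) + qnum h m • x := by
  have h1 : (qpow h 1 - qpow h (-1)) • (E (F x) - F (E x)) =
      (qpow h 1 - qpow h (-1)) • qnum h m • x := by
    rw [smul_smul, hq.mul_qnum]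
    have := congrArg (fun T : Module.End ℂ M => T x) hM.comm
    simp only [LinearMap.smul_apply, LinearMap.sub_apply, Module.End.mul_apply] at this
    rw [this, hM.Ki_apply hx, map_smul, hM.Ki_apply hx, mem_wtSpace.mp hx, map_smul,
      mem_wtSpace.mp hx, smul_smul, smul_smul, ← sub_smul, ← qpow_add, ← qpow_add]
    ring_nf
  rw [← sub_eq_iff_eq_add']
  exact smul_right_injective M hq.sub_ne_zero h1

lemma UqModule.E_F_pow_apply (hM : UqModule h E F K Ki L) (hq : Generic h) {m : ℤ} {x : M}
    (hx : x ∈ wtSpace h K m) (p : ℕ) :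
    E ((F ^ (p + 1)) x) = (F ^ (p + 1)) (E x) + (qnum h (p + 1) * qnum h (m - p)) • (F ^ p) x := by
  induction p with
  | zero => simp [hM.E_F_apply hq hx, hq.qnum_one]
  | succ p ih =>
    rw [pow_succ' F (p + 1), Module.End.mul_apply, hM.E_F_apply hq (hM.F_pow_mem hx (p + 1)), ih,
      map_add, map_smul, Module.End.mul_apply, add_assoc, ← Module.End.mul_apply F (F ^ p),
      ← pow_succ' F p, ← add_smul]
    congr 2
    -- The commutator with the additional `F` contributes `[m - 2p - 2]`, and `[p + 1] [m - p] + [m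
    -- - 2p - 2] = [p + 2] [m - p - 1]`.
    have := qnum_mul_qnum h (p + 2) (m - p - 1) (m - p)
    rw [show (p + 2 : ℂ) + (m - p - 1) - (m - p) = p + 1 by ring,
      show (m : ℂ) - p - (m - p - 1) = 1 by ring, hq.qnum_one, mul_one] at this
    push_cast
    rw [show (p : ℂ) + 1 + 1 = p + 2 by ring, show (m : ℂ) - (p + 1) = m - p - 1 by ring, this]
    ring_nf

/-! ### Decomposition of weight vectors into descendants of highest weight vectors. -/

/-- The scalar by which `E ^ r F ^ r` acts on `F ^ p x`, for `x` of highest weight `m / 2`. -/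
def hwCoeff (h : ℂ) (m : ℤ) (p r : ℕ) : ℂ :=
  ∏ i ∈ Finset.range r, (qnum h (p + i + 1) * qnum h (m - p - i))

lemma Generic.hwCoeff_ne_zero (hq : Generic h) {m : ℤ} {p r : ℕ}
    (hm : ∀ i < r, m - p - i ≠ 0) : hwCoeff h m p r ≠ 0 := by
  rw [hwCoeff, Finset.prod_ne_zero_iff]
  intro i hi
  have h1 := hq.qnum_natCast_ne_zero (m := p + i + 1) (by omega)
  have h2 := hq.qnum_ne_zero (hm i (Finset.mem_range.mp hi))
  push_cast at h1 h2
  exact mul_ne_zero h1 h2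

lemma UqModule.E_F_pow_of_hw (hM : UqModule h E F K Ki L) (hq : Generic h) {m : ℤ} {x : M}
    (hx : x ∈ wtSpace h K m) (hE : E x = 0) (p : ℕ) :
    E ((F ^ (p + 1)) x) = (qnum h (p + 1) * qnum h (m - p)) • (F ^ p) x := by
  rw [hM.E_F_pow_apply hq hx, hE, map_zero, zero_add]

lemma UqModule.E_pow_F_pow (hM : UqModule h E F K Ki L) (hq : Generic h) {m : ℤ} {x : M}
    (hx : x ∈ wtSpace h K m) (hE : E x = 0) (p r : ℕ) :
    (E ^ r) ((F ^ (p + r)) x) = hwCoeff h m p r • (F ^ p) x := by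
  induction r with
  | zero => simp [hwCoeff]
  | succ r ih =>
    rw [pow_succ, Module.End.mul_apply, ← add_assoc, hM.E_F_pow_of_hw hq hx hE, map_smul, ih,
      smul_smul, hwCoeff, hwCoeff, Finset.prod_range_succ]
    push_cast
    rw [sub_sub]
    ring_nf

/-- Eigenspaces of `K` are independent, and those of the admissible weights already span. -/
lemma UqModule.eq_zero_of_lt (hM : UqModule h E F K Ki L) (hq : Generic h) {m : ℤ} (hm : L < |m|)
    {x : M} (hx : x ∈ wtSpace h K m) : x = 0 := by
  have hind := Module.End.eigenspaces_iSupIndep K (qpow h ((m : ℂ) / 2))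
  have h1 : x ∈ ⨆ μ, ⨆ (_ : μ ≠ qpow h ((m : ℂ) / 2)), Module.End.eigenspace K μ := by
    refine hM.span.trans ?_ (Submodule.mem_top (x := x))
    refine iSup₂_le fun m' hm' => ?_
    refine le_iSup₂_of_le (qpow h ((m' : ℂ) / 2)) ?_ le_rfl
    intro H
    have := hq.qpow_half_injective H
    subst this
    exact absurd hm' (not_le.mpr hm)
  exact Submodule.disjoint_def.mp hind x hx h1

/-- `F ^ L x` lies below all weights, hence is zero, but `E ^ L F ^ L` multiplies `x` by a product
of `q`-numbers that cannot vanish for `m < 0`. -/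
lemma UqModule.hw_eq_zero_of_neg (hM : UqModule h E F K Ki L) (hq : Generic h) {m : ℤ} (hm : m < 0)
    {x : M} (hx : x ∈ wtSpace h K m) (hE : E x = 0) : x = 0 := by
  have h1 := hM.E_pow_F_pow hq hx hE 0 L
  rw [zero_add, hM.eq_zero_of_lt hq (by rw [lt_abs]; right; omega) (hM.F_pow_mem hx L), map_zero,
    pow_zero, Module.End.one_apply] at h1
  exact (smul_eq_zero.mp h1.symm).resolve_left (hq.hwCoeff_ne_zero fun i _ => by push_cast; omega)

/-- `F ^ (m + 1) x` is again killed by `E`, and its weight is negative. -/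
lemma UqModule.F_pow_eq_zero (hM : UqModule h E F K Ki L) (hq : Generic h) {m p : ℕ} (hp : m < p)
    {x : M} (hx : x ∈ wtSpace h K m) (hE : E x = 0) : (F ^ p) x = 0 := by
  have h1 : (F ^ (m + 1)) x = 0 := by
    refine hM.hw_eq_zero_of_neg hq (m := (m : ℤ) - 2 * (m + 1 : ℕ)) (by push_cast; omega)
      (hM.F_pow_mem hx _) ?_
    rw [hM.E_F_pow_of_hw hq hx hE]
    simp
  rw [← Nat.sub_add_cancel (Nat.succ_le_of_lt hp), pow_add, Module.End.mul_apply, h1, map_zero]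

/-- `E ^ r v` is a highest weight vector when `E ^ (r + 1) v = 0`, and `E ^ r F ^ r` acts on it by a
nonzero scalar because `m ≥ 0`. Subtracting the matching descendant lowers the nilpotency order. -/
lemma UqModule.exists_sum_of_nonneg (hM : UqModule h E F K Ki L) (hq : Generic h) {m : ℤ}
    (hm : 0 ≤ m) (r : ℕ) {v : M} (hv : v ∈ wtSpace h K m) (hE : (E ^ r) v = 0) :
    ∃ x : ℕ → M, (∀ p : ℕ, x p ∈ wtSpace h K (m + 2 * p) ∧ E (x p) = 0) ∧
      v = ∑ p ∈ Finset.range r, (F ^ p) (x p) := by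
  induction r generalizing v with
  | zero =>
    refine ⟨fun _ => 0, fun p => ⟨zero_mem _, map_zero _⟩, ?_⟩
    simpa using hE
  | succ r ih =>
    have hw := hM.E_pow_mem hv r
    have hEw : E ((E ^ r) v) = 0 := by rw [← Module.End.mul_apply, ← pow_succ', hE]
    have hc : hwCoeff h (m + 2 * r) 0 r ≠ 0 := hq.hwCoeff_ne_zero fun i hi => by push_cast; omega
    set y := (hwCoeff h (m + 2 * r) 0 r)⁻¹ • (E ^ r) v with hy
    have hyw : y ∈ wtSpace h K (m + 2 * r) := Submodule.smul_mem _ _ hw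
    have hyE : E y = 0 := by rw [hy, map_smul, hEw, smul_zero]
    have h1 : (E ^ r) ((F ^ r) y) = (E ^ r) v := by
      have := hM.E_pow_F_pow hq hyw hyE 0 r
      rw [zero_add, pow_zero, Module.End.one_apply, hy, smul_smul, mul_inv_cancel₀ hc,
        one_smul] at this
      rw [hy, this]
    have h2 : (F ^ r) y ∈ wtSpace h K m := by
      have := hM.F_pow_mem hyw r
      rwa [add_sub_cancel_right] at this
    obtain ⟨x, hx, hsum⟩ := ih (v := v - (F ^ r) y) (Submodule.sub_mem _ hv h2)
      (by rw [map_sub, h1, sub_self])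
    refine ⟨fun p => if p = r then y else x p, fun p => ?_, ?_⟩
    · dsimp only
      split_ifs with hp
      · subst hp; exact ⟨hyw, hyE⟩
      · exact hx p
    · dsimp only
      rw [Finset.sum_range_succ, if_pos rfl, ← sub_eq_iff_eq_add, hsum]
      refine Finset.sum_congr rfl fun p hp => ?_
      rw [if_neg (Finset.mem_range.mp hp).ne]

lemma UqModule.exists_E_pow_eq_zero (hM : UqModule h E F K Ki L) (hq : Generic h) {m : ℤ} {v : M}
    (hv : v ∈ wtSpace h K m) : ∃ r, (E ^ r) v = 0 :=
  ⟨L + m.natAbs + 1, hM.eq_zero_of_lt hq (by rw [lt_abs]; left; omega)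
    (hM.E_pow_mem hv _)⟩

/-- With `E` and `F` exchanged the weight is positive, so `v` is a sum of `E ^ p y_p` with `F y_p =
0`; each of these is a nonzero multiple of `F E ^ (p + 1) y_p`. -/
lemma UqModule.exists_F_eq (hM : UqModule h E F K Ki L) (hq : Generic h) {m : ℤ} (hm : m < 0)
    {v : M} (hv : v ∈ wtSpace h K m) : ∃ v' ∈ wtSpace h K (m + 2), v = F v' := by
  have hv' : v ∈ wtSpace h Ki (-m) := by rwa [hM.wtSpace_Ki, neg_neg]
  obtain ⟨r, hr⟩ := hM.swap.exists_E_pow_eq_zero hq hv'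
  obtain ⟨y, hy, hsum⟩ := hM.swap.exists_sum_of_nonneg hq (by omega) r hv' hr
  have hc : ∀ p : ℕ, qnum h (p + 1) * qnum h ((-m + 2 * p : ℤ) - p) ≠ 0 := by
    intro p
    have h1 := hq.qnum_natCast_ne_zero (m := p + 1) (by omega)
    have h2 := hq.qnum_ne_zero (m := -m + 2 * p - p) (by omega)
    push_cast at h1 h2 ⊢
    exact mul_ne_zero h1 h2
  refine ⟨∑ p ∈ Finset.range r, (qnum h (p + 1) * qnum h ((-m + 2 * p : ℤ) - p))⁻¹ •
    (E ^ (p + 1)) (y p), ?_, ?_⟩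
  · refine Submodule.sum_mem _ fun p _ => Submodule.smul_mem _ _ ?_
    have := hM.swap.F_pow_mem (hy p).1 (p + 1)
    rw [hM.wtSpace_Ki] at this
    convert this using 1
    push_cast
    ring_nf
  · rw [hsum, map_sum]
    refine Finset.sum_congr rfl fun p _ => ?_
    rw [map_smul, hM.swap.E_F_pow_of_hw hq (hy p).1 (hy p).2, smul_smul, inv_mul_cancel₀ (hc p),
      one_smul]

/-- Every weight vector is a sum of descendants of highest weight vectors. -/
lemma UqModule.exists_sum (hM : UqModule h E F K Ki L) (hq : Generic h) {m : ℤ} {v : M}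
    (hv : v ∈ wtSpace h K m) : ∃ (r : ℕ) (x : ℕ → M),
      (∀ p : ℕ, x p ∈ wtSpace h K (m + 2 * p) ∧ E (x p) = 0) ∧
      v = ∑ p ∈ Finset.range r, (F ^ p) (x p) := by
  -- A negative weight is raised step by step by writing `v = F v'`, until the case of nonnegative
  -- weight applies.
  obtain ⟨d, hd⟩ : ∃ d : ℕ, -m ≤ d := ⟨m.natAbs, by omega⟩
  induction d generalizing m v with
  | zero =>
    obtain ⟨r, hr⟩ := hM.exists_E_pow_eq_zero hq hv
    exact ⟨r, hM.exists_sum_of_nonneg hq (by simpa using hd) r hv hr⟩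
  | succ d ih =>
    rcases lt_or_ge m 0 with hm | hm
    · obtain ⟨v', hv', rfl⟩ := hM.exists_F_eq hq hm hv
      obtain ⟨r, x, hx, rfl⟩ := ih hv' (by push_cast at hd; omega)
      refine ⟨r + 1, fun p => if p = 0 then 0 else x (p - 1), fun p => ?_, ?_⟩
      · rcases p with _ | p
        · exact ⟨zero_mem _, map_zero _⟩
        · have := hx p
          rwa [show m + 2 + 2 * (p : ℤ) = m + 2 * ((p + 1 : ℕ) : ℤ) by push_cast; ring] at this
      · rw [Finset.sum_range_succ', map_sum]
        simp [pow_succ', Module.End.mul_apply]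
    · obtain ⟨r, hr⟩ := hM.exists_E_pow_eq_zero hq hv
      exact ⟨r, hM.exists_sum_of_nonneg hq hm r hv hr⟩

/-- Two operators that agree on the descendants of all highest weight vectors are equal. -/
lemma UqModule.end_ext (hM : UqModule h E F K Ki L) (hq : Generic h) {T T' : Module.End ℂ M}
    (H : ∀ (m p : ℕ) (x : M), p ≤ m → x ∈ wtSpace h K m → E x = 0 →
      T ((F ^ p) x) = T' ((F ^ p) x)) : T = T' := by
  have h1 : (⊤ : Submodule ℂ M) ≤ LinearMap.eqLocus T T' := by
    refine hM.span.trans (iSup₂_le fun m _ v hv => ?_)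
    obtain ⟨r, x, hx, rfl⟩ := hM.exists_sum hq hv
    refine Submodule.sum_mem _ fun p _ => ?_
    rw [LinearMap.mem_eqLocus]
    rcases lt_or_ge (m + 2 * p) 0 with hneg | hpos
    · rw [hM.hw_eq_zero_of_neg hq hneg (hx p).1 (hx p).2]
      simp
    · obtain ⟨m', hm'⟩ := Int.eq_ofNat_of_zero_le hpos
      have hx1 := (hx p).1
      rw [hm'] at hx1
      rcases le_or_gt p m' with hp | hp
      · exact H m' p _ hp hx1 (hx p).2
      · rw [hM.F_pow_eq_zero hq hp hx1 (hx p).2]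
        simp
  ext v
  exact h1 Submodule.mem_top

end Module

/-! ### Diagonal operators and the ribbon element -/

section Ribbon

variable {ι M : Type} [AddCommGroup M] [Module ℂ M] {E F K Ki : Module.End ℂ M} {L : ℕ}

lemma diagOp_apply_basis (b : Module.Basis ι ℂ M) (f : ι → ℂ) (i : ι) :
    diagOp b f (b i) = f i • b i := by
  rw [diagOp, Module.Basis.constr_basis]

/-- A weight vector has zero coordinates at basis vectors of other weights, so only the values of
`f` at its own weight matter. -/
lemma diagOp_apply_of_mem (hq : Generic h) (b : Module.Basis ι ℂ M) (w : ι → ℤ)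
    (hb : ∀ i, b i ∈ wtSpace h K (w i)) (f : ι → ℂ) (c : ℂ) {m : ℤ} (hf : ∀ i, w i = m → f i = c)
    {x : M} (hx : x ∈ wtSpace h K m) : diagOp b f x = c • x := by
  have hK : K = diagOp b (fun i => qpow h ((w i : ℂ) / 2)) := by
    refine b.ext fun i => ?_
    rw [diagOp_apply_basis, mem_wtSpace.mp (hb i)]
  have hrepr : ∀ (g : ι → ℂ) (y : M) (i : ι), b.repr (diagOp b g y) i = g i * b.repr y i := by
    intro g y i
    have : (b.coord i) ∘ₗ diagOp b g = g i • b.coord i := by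
      refine b.ext fun j => ?_
      rw [LinearMap.comp_apply, diagOp_apply_basis, map_smul, LinearMap.smul_apply]
      by_cases hij : j = i
      · rw [hij]
      · simp [Finsupp.single_eq_of_ne' hij]
    exact congrArg (fun T => T y) this
  apply b.repr.injective
  ext i
  rw [hrepr, map_smul, Finsupp.smul_apply, smul_eq_mul]
  by_cases hi : w i = m
  · rw [hf i hi]
  · have h1 := congrArg (fun y => b.repr y i) (mem_wtSpace.mp hx)
    simp only [hK, hrepr, map_smul, Finsupp.smul_apply, smul_eq_mul] at h1
    have h2 : b.repr x i = 0 := by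
      by_contra hne
      exact hi (hq.qpow_half_injective (mul_right_cancel₀ hne h1))
    rw [h2, mul_zero, mul_zero]

/-- This is `Generic.ribbon_sum` with `n = d` and `x = p + 1`. The terms with `r > d` vanish since
`hwCoeff` then contains `[m - p - d] = [0]`; therefore the truncation `L'` is immaterial. -/
lemma Generic.ribbon_scalar (hq : Generic h) (m p d L' : ℕ) (hm : m = p + d) (hL : d < L') :
    ∑ r ∈ Finset.range L', (rCoeff h r * (-qpow h (-1)) ^ r) *
      (qpow h (-((m : ℂ) / 2 - p) ^ 2) * (qpow h (-((m : ℂ) / 2 - p - r) ^ 2) *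
        hwCoeff h m p r)) = qpow h (-2 * ((m : ℂ) / 2 - p)) * qpow h (-2 * rho ((m : ℂ) / 2)) := by
  have hsub : Finset.range (d + 1) ⊆ Finset.range L' := Finset.range_mono hL
  rw [← Finset.sum_subset hsub]
  swap
  · intro r _ hr
    rw [Finset.mem_range, not_lt] at hr
    rw [hwCoeff, Finset.prod_eq_zero (Finset.mem_range.mpr (show d < r by omega))
      (by rw [hm]; push_cast; rw [add_sub_cancel_left, sub_self, qnum_zero, mul_zero])]
    ring
  have key := hq.ribbon_sum d (p + 1)
  have : qpow h (-2 * ((m : ℂ) / 2 - p)) * qpow h (-2 * rho ((m : ℂ) / 2)) =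
      qpow h (-2 * ((m : ℂ) / 2 - p) ^ 2) * qpow h (-2 * d * (p + 1)) := by
    rw [← qpow_add, ← qpow_add, rho, hm]
    push_cast
    ring_nf
  rw [this, ← key, Finset.mul_sum]
  refine Finset.sum_congr rfl fun r hr => ?_
  have hr : r ≤ d := by simpa [Nat.lt_succ_iff] using hr
  have hc : hwCoeff h m p r = qpoch h (p + 1) r * (qfact h d / qfact h (d - r)) := by
    have h1 := hq.qpoch_add_one (d - r) r
    rw [Nat.sub_add_cancel hr] at h1
    rw [← h1, hwCoeff, Finset.prod_mul_distrib, qpoch, qpoch,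
      ← Finset.prod_range_reflect (fun j : ℕ => qnum h (((d - r : ℕ) : ℂ) + 1 + j))]
    congr 1
    · exact Finset.prod_congr rfl fun j _ => by ring_nf
    · refine Finset.prod_congr rfl fun j hj => ?_
      rw [Finset.mem_range] at hj
      rw [Nat.sub_sub, Nat.cast_sub hr, Nat.cast_sub (by omega), hm]
      push_cast
      ring_nf
  rw [hc, rCoeff, qbinom, neg_pow (qpow h (-1)), ← qpow_natCast_mul]
  have hp : qpow h (((r : ℂ) ^ 2 - r) / 2) * qpow h (r * -1) * qpow h (-((m : ℂ) / 2 - p) ^ 2) *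
      qpow h (-((m : ℂ) / 2 - p - r) ^ 2) = qpow h (-2 * ((m : ℂ) / 2 - p) ^ 2) *
      qpow h (-(r * (r + 1) / 2) + (d - (p + 1)) * r) := by
    rw [← qpow_add, ← qpow_add, ← qpow_add, ← qpow_add, hm]
    push_cast
    ring_nf
  simp only [div_eq_mul_inv, mul_inv] at hp ⊢
  linear_combination ((qpow h 1 - qpow h (-1)) ^ r * (qfact h r)⁻¹ * (-1) ^ r * qpoch h (p + 1) r *
    qfact h d * (qfact h (d - r))⁻¹) * hp

/-- The ribbon element acts on the irreducible module of highest weight `m / 2` by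
`q ^ (-2 ρ(m / 2))`. -/
lemma UqModule.ribbon_apply (hM : UqModule h E F K Ki L) (hq : Generic h)
    (b : Module.Basis ι ℂ M) (w : ι → ℂ) (w' : ι → ℤ) (hw : ∀ i, w i = (w' i : ℂ) / 2)
    (hb : ∀ i, b i ∈ wtSpace h K (w' i)) {m p L' : ℕ} (hp : p ≤ m) (hL : m < L') {x : M}
    (hx : x ∈ wtSpace h K m) (hE : E x = 0) :
    ribbon h b w E F L' ((F ^ p) x) = qpow h (-2 * rho ((m : ℂ) / 2)) • (F ^ p) x := by
  have hd : ∀ (g : ℂ → ℂ) {m' : ℤ} {y : M}, y ∈ wtSpace h K m' →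
      diagOp b (fun i => g (w i)) y = g ((m' : ℂ) / 2) • y := fun g m' y hy =>
    diagOp_apply_of_mem hq b w' hb _ _ (fun i hi => by rw [hw, hi]) hy
  have hy := hM.F_pow_mem hx p
  have hterm : ∀ r : ℕ, (diagOp b (fun i => qpow h (-(w i) ^ 2)) * E ^ r *
      diagOp b (fun i => qpow h (-(w i) ^ 2)) * F ^ r) ((F ^ p) x) =
      (qpow h (-((m : ℂ) / 2 - p) ^ 2) * (qpow h (-((m : ℂ) / 2 - p - r) ^ 2) *
        hwCoeff h m p r)) • (F ^ p) x := by
    intro r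
    simp only [Module.End.mul_apply]
    have h1 : (F ^ r) ((F ^ p) x) = (F ^ (p + r)) x := by
      rw [add_comm, pow_add, Module.End.mul_apply]
    rw [h1, hd (fun t => qpow h (-t ^ 2)) (hM.F_pow_mem hx (p + r)), map_smul,
      hM.E_pow_F_pow hq hx hE, map_smul, map_smul, hd (fun t => qpow h (-t ^ 2)) hy, smul_smul,
      smul_smul]
    congr 1
    push_cast
    ring_nf
  rw [ribbon, Module.End.mul_apply, LinearMap.sum_apply]
  simp only [LinearMap.smul_apply, hterm, smul_smul]
  rw [← Finset.sum_smul, hq.ribbon_scalar m p (m - p) L' (by omega) (by omega), map_smul,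
    hd (fun t => qpow h (2 * t)) hy, smul_smul, mul_right_comm, ← qpow_add]
  push_cast
  rw [show -2 * ((m : ℂ) / 2 - p) + 2 * ((m - 2 * p) / 2) = 0 by ring, qpow_zero, one_mul]

end Ribbon

/-! ### Tensor products -/

section Tensor

variable {M M' : Type} [AddCommGroup M] [Module ℂ M] [AddCommGroup M'] [Module ℂ M']
  {E F K Ki : Module.End ℂ M} {E' F' K' Ki' : Module.End ℂ M'} {L L' : ℕ}

lemma tensorMap_sub_left (f f' : Module.End ℂ M) (g : Module.End ℂ M') :
    TensorProduct.map (f - f') g = TensorProduct.map f g - TensorProduct.map f' g :=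
  TensorProduct.ext' fun x y => by simp [TensorProduct.sub_tmul]

lemma tensorMap_sub_right (f : Module.End ℂ M) (g g' : Module.End ℂ M') :
    TensorProduct.map f (g - g') = TensorProduct.map f g - TensorProduct.map f g' :=
  TensorProduct.ext' fun x y => by simp [TensorProduct.tmul_sub]

lemma tmul_mem_wtSpace {m m' : ℤ} {x : M} {y : M'} (hx : x ∈ wtSpace h K m)
    (hy : y ∈ wtSpace h K' m') :
    x ⊗ₜ[ℂ] y ∈ wtSpace h (TensorProduct.map K K' : Module.End ℂ (M ⊗[ℂ] M')) (m + m') := by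
  rw [mem_wtSpace] at *
  rw [TensorProduct.map_tmul, hx, hy, TensorProduct.smul_tmul_smul, ← qpow_add]
  push_cast
  ring_nf

lemma UqModule.tensor (hM : UqModule h E F K Ki L) (hM' : UqModule h E' F' K' Ki' L') :
    UqModule h (coprodX K E E' Ki') (coprodX K F F' Ki') (TensorProduct.map K K')
      (TensorProduct.map Ki Ki') (L + L') where
  K_mul_E := by
    rw [coprodX, mul_add, add_mul, ← TensorProduct.map_mul, ← TensorProduct.map_mul,
      ← TensorProduct.map_mul, ← TensorProduct.map_mul, hM.K_mul_E, hM'.K_mul_E, hM'.K_mul_Ki,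
      hM'.Ki_mul_K, TensorProduct.map_smul_left, TensorProduct.map_smul_right, smul_add]
  K_mul_F := by
    rw [coprodX, mul_add, add_mul, ← TensorProduct.map_mul, ← TensorProduct.map_mul,
      ← TensorProduct.map_mul, ← TensorProduct.map_mul, hM.K_mul_F, hM'.K_mul_F, hM'.K_mul_Ki,
      hM'.Ki_mul_K, TensorProduct.map_smul_left, TensorProduct.map_smul_right, smul_add]
  K_mul_Ki := by
    rw [← TensorProduct.map_mul, hM.K_mul_Ki, hM'.K_mul_Ki, TensorProduct.map_one]
  Ki_mul_K := by
    rw [← TensorProduct.map_mul, hM.Ki_mul_K, hM'.Ki_mul_K, TensorProduct.map_one]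
  comm := by
    have h1 : (qpow h 1 - qpow h (-1)) • TensorProduct.map (E * F - F * E) (Ki' * Ki') =
        TensorProduct.map (K * K - Ki * Ki) (Ki' * Ki') := by
      rw [← hM.comm, TensorProduct.map_smul_left]
    have h2 : (qpow h 1 - qpow h (-1)) • TensorProduct.map (K * K) (E' * F' - F' * E') =
        TensorProduct.map (K * K) (K' * K' - Ki' * Ki') := by
      rw [← hM'.comm, TensorProduct.map_smul_right]
    -- The mixed terms of the commutator cancel: the factors `q` and `q⁻¹` picked up in the two
    -- tensor factors compensate. What remains telescopes through `K² ⊗ Ki'²`.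
    have c1 : TensorProduct.map (E * K) (Ki' * F') = TensorProduct.map (K * E) (F' * Ki') := by
      rw [hM.K_mul_E, hM'.swap.K_mul_E, TensorProduct.map_smul_left, TensorProduct.map_smul_right]
    have c2 : TensorProduct.map (F * K) (Ki' * E') = TensorProduct.map (K * F) (E' * Ki') := by
      rw [hM.K_mul_F, hM'.swap.K_mul_F, TensorProduct.map_smul_left, TensorProduct.map_smul_right]
    have h3 : coprodX K E E' Ki' * coprodX K F F' Ki' - coprodX K F F' Ki' * coprodX K E E' Ki' =
        TensorProduct.map (E * F - F * E) (Ki' * Ki') +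
          TensorProduct.map (K * K) (E' * F' - F' * E') := by
      simp only [coprodX, mul_add, add_mul, ← TensorProduct.map_mul, tensorMap_sub_left,
        tensorMap_sub_right, c1, c2]
      abel
    rw [h3, smul_add, h1, h2, tensorMap_sub_left, tensorMap_sub_right,
      TensorProduct.map_mul, TensorProduct.map_mul, TensorProduct.map_mul]
    abel
  span := by
    rw [← TensorProduct.span_tmul_eq_top, Submodule.span_le]
    rintro _ ⟨x, y, rfl⟩
    set T := ⨆ m ∈ {m : ℤ | |m| ≤ ((L + L' : ℕ) : ℤ)},
      wtSpace h (TensorProduct.map K K' : Module.End ℂ (M ⊗[ℂ] M')) m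
    have h1 : ∀ x : M, ∀ m' ∈ {m : ℤ | |m| ≤ L'}, ∀ y ∈ wtSpace h K' m', x ⊗ₜ[ℂ] y ∈ T := by
      intro x m' hm' y hy
      have : (⊤ : Submodule ℂ M) ≤ T.comap ((TensorProduct.mk ℂ M M').flip y) := by
        refine hM.span.trans (iSup₂_le fun m hm x hx => ?_)
        refine (le_iSup₂_of_le (f := fun m (_ : m ∈ {m : ℤ | |m| ≤ ((L + L' : ℕ) : ℤ)}) =>
          wtSpace h (TensorProduct.map K K' : Module.End ℂ (M ⊗[ℂ] M')) m) (m + m') ?_ le_rfl)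
          (tmul_mem_wtSpace hx hy)
        simp only [Set.mem_ofPred_eq] at *
        push_cast
        exact (abs_add_le _ _).trans (add_le_add hm hm')
      exact this Submodule.mem_top
    have : (⊤ : Submodule ℂ M') ≤ T.comap (TensorProduct.mk ℂ M M' x) :=
      hM'.span.trans (iSup₂_le fun m' hm' y hy => h1 x m' hm' y hy)
    exact this Submodule.mem_top

end Tensor

/-! ### The module `V_s` -/

/-- The coefficient of `X⁺` from the `i`-th to the `(i + 1)`-st basis vector. -/
def stepCoeff (N : ℕ) (h : ℂ) (i : ℕ) : ℂ := csqrt (qnum h (N - i) * qnum h (i + 1))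

lemma Xp_om {N i : ℕ} (hi : i < N) :
    Xp N h (om N ⟨i, by omega⟩) = stepCoeff N h i • om N ⟨i + 1, by omega⟩ := by
  rw [Xp, Module.Basis.constr_basis, dif_pos (show i + 1 < N + 1 by omega), stepCoeff]
  simp only [wt, spin]
  ring_nf

lemma Xp_om_last (N : ℕ) : Xp N h (om N (Fin.last N)) = 0 := by
  rw [Xp, Module.Basis.constr_basis, dif_neg (by simp)]

lemma Xm_om {N i : ℕ} (hi : i < N) :
    Xm N h (om N ⟨i + 1, by omega⟩) = stepCoeff N h i • om N ⟨i, by omega⟩ := by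
  rw [Xm, Module.Basis.constr_basis, if_pos (show 0 < i + 1 by omega), stepCoeff, mul_comm]
  simp only [wt, spin, Nat.add_sub_cancel]
  push_cast
  ring_nf

lemma Xm_om_zero (N : ℕ) : Xm N h (om N ⟨0, by omega⟩) = 0 := by
  rw [Xm, Module.Basis.constr_basis, if_neg (by simp)]

lemma stepCoeff_mul_self (N : ℕ) (h : ℂ) (i : ℕ) :
    stepCoeff N h i * stepCoeff N h i = qnum h (N - i) * qnum h (i + 1) := by
  rw [← pow_two, stepCoeff, csqrt_sq]

lemma wt_eq (N : ℕ) (i : Fin (N + 1)) : wt N i = ((2 * (i : ℕ) - N : ℤ) : ℂ) / 2 := by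
  simp only [wt, spin]
  push_cast
  ring

lemma om_mem (N : ℕ) (i : Fin (N + 1)) : om N i ∈ wtSpace h (qH N h) (2 * (i : ℕ) - N) := by
  rw [mem_wtSpace, qH, diagOp_apply_basis, wt_eq]

lemma uqModule_V (hq : Generic h) (N : ℕ) :
    UqModule h (Xp N h) (Xm N h) (qH N h) (qHinv N h) N where
  K_mul_E := by
    refine (om N).ext fun i => ?_
    obtain ⟨i, hi⟩ := i
    rcases Nat.lt_or_ge i N with hlt | hge
    · simp only [Module.End.mul_apply, LinearMap.smul_apply, Xp_om hlt, map_smul, qH,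
        diagOp_apply_basis, smul_smul, wt]
      congr 1
      rw [mul_left_comm (qpow h 1), mul_comm (qpow h _), mul_right_comm, ← qpow_add, mul_comm]
      push_cast
      ring_nf
    · obtain rfl : i = N := by omega
      have := Xp_om_last (h := h) i
      rw [Fin.last] at this
      simp only [Module.End.mul_apply, LinearMap.smul_apply, qH, diagOp_apply_basis, map_smul, this,
        map_zero, smul_zero]
  K_mul_F := by
    refine (om N).ext fun i => ?_
    obtain ⟨i, hi⟩ := i
    rcases i with _ | i
    · simp only [Module.End.mul_apply, LinearMap.smul_apply, qH, diagOp_apply_basis, map_smul,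
        Xm_om_zero, map_zero, smul_zero]
    · simp only [Module.End.mul_apply, LinearMap.smul_apply, Xm_om (show i < N by omega), map_smul,
        qH, diagOp_apply_basis, smul_smul, wt]
      congr 1
      rw [← mul_assoc, ← qpow_add, mul_comm]
      push_cast
      ring_nf
  K_mul_Ki := by
    refine (om N).ext fun i => ?_
    rw [Module.End.mul_apply, qHinv, diagOp_apply_basis, map_smul, qH, diagOp_apply_basis,
      smul_smul, ← qpow_add, neg_add_cancel, qpow_zero, one_smul, Module.End.one_apply]
  Ki_mul_K := by
    refine (om N).ext fun i => ?_
    rw [Module.End.mul_apply, qH, diagOp_apply_basis, map_smul, qHinv, diagOp_apply_basis,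
      smul_smul, ← qpow_add, add_neg_cancel, qpow_zero, one_smul, Module.End.one_apply]
  comm := by
    refine (om N).ext fun i => ?_
    obtain ⟨i, hi⟩ := i
    have hEF : Xp N h (Xm N h (om N ⟨i, hi⟩)) =
        (qnum h (N - i + 1) * qnum h i) • om N ⟨i, hi⟩ := by
      rcases i with _ | i
      · rw [Xm_om_zero, map_zero, Nat.cast_zero, qnum_zero, mul_zero, zero_smul]
      · rw [Xm_om (by omega), map_smul, Xp_om (by omega), smul_smul, stepCoeff_mul_self]
        push_cast
        ring_nf
    have hFE : Xm N h (Xp N h (om N ⟨i, hi⟩)) =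
        (qnum h (N - i) * qnum h (i + 1)) • om N ⟨i, hi⟩ := by
      rcases Nat.lt_or_ge i N with hlt | hge
      · rw [Xp_om hlt, map_smul, Xm_om hlt, smul_smul, stepCoeff_mul_self]
      · obtain rfl : i = N := by omega
        have := Xp_om_last (h := h) i
        rw [Fin.last] at this
        rw [this, map_zero, sub_self, qnum_zero, zero_mul, zero_smul]
    simp only [LinearMap.smul_apply, LinearMap.sub_apply, Module.End.mul_apply, hEF, hFE]
    simp only [qH, qHinv, diagOp_apply_basis, map_smul, smul_smul, ← sub_smul, ← qpow_add]
    congr 1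
    -- This gives `[i] [N - i + 1] - [N - i] [i + 1] = [2i - N]`, and `2i - N` is twice the weight.
    have := qnum_mul_qnum h i (N - i + 1) (i + 1)
    rw [add_sub_cancel_left, hq.qnum_one, one_mul,
      show (i : ℂ) + (N - i + 1) - (i + 1) = N - i by ring] at this
    rw [mul_comm (qnum h (N - i + 1)), this, add_sub_cancel_left, hq.mul_qnum]
    simp only [wt, spin]
    ring_nf
  span := by
    rw [← (om N).span_eq, Submodule.span_le]
    rintro _ ⟨i, rfl⟩
    refine (le_iSup₂_of_le (f := fun m (_ : m ∈ {m : ℤ | |m| ≤ (N : ℤ)}) =>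
      wtSpace h (qH N h) m) (2 * (i : ℕ) - N : ℤ) ?_ le_rfl) (om_mem N i)
    rw [Set.mem_ofPred_eq, abs_le]
    omega

/-! ### A basis of `V_s` in which no square roots occur. -/

/-- The vector `(X⁻) ^ i ω_s`. -/
def e (N : ℕ) (h : ℂ) (i : ℕ) : V N := ((Xm N h) ^ i) (om N (Fin.last N))

lemma e_zero_mem (N : ℕ) : om N (Fin.last N) ∈ wtSpace h (qH N h) N := by
  have := om_mem (h := h) N (Fin.last N)
  rwa [Fin.val_last, two_mul, add_sub_cancel_right] at this

lemma Xm_e (N i : ℕ) : Xm N h (e N h i) = e N h (i + 1) := by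
  rw [e, e, pow_succ', Module.End.mul_apply]

lemma Xm_pow_e (N p i : ℕ) : ((Xm N h) ^ p) (e N h i) = e N h (i + p) := by
  rw [e, e, add_comm i p, pow_add, Module.End.mul_apply]

lemma e_mem (hq : Generic h) (N i : ℕ) : e N h i ∈ wtSpace h (qH N h) (N - 2 * i) :=
  (uqModule_V hq N).F_pow_mem (e_zero_mem N) i

lemma e_eq_zero (hq : Generic h) {N i : ℕ} (hi : N < i) : e N h i = 0 :=
  (uqModule_V hq N).F_pow_eq_zero hq hi (e_zero_mem N) (Xp_om_last N)

lemma Xp_e_zero (N : ℕ) : Xp N h (e N h 0) = 0 := Xp_om_last N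

lemma Xp_e_succ (hq : Generic h) (N i : ℕ) :
    Xp N h (e N h (i + 1)) = (qnum h (i + 1) * qnum h (N - i)) • e N h i := by
  have := (uqModule_V hq N).E_F_pow_of_hw hq (e_zero_mem N) (Xp_om_last N) i
  rwa [Int.cast_natCast] at this

lemma e_ne_zero (hq : Generic h) {N i : ℕ} (hi : i ≤ N) : e N h i ≠ 0 := by
  intro H
  have h1 := (uqModule_V hq N).E_pow_F_pow hq (e_zero_mem N) (Xp_om_last N) 0 i
  rw [zero_add, show ((Xm N h) ^ i) (om N (Fin.last N)) = 0 from H, map_zero, pow_zero,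
    Module.End.one_apply] at h1
  rcases smul_eq_zero.mp h1.symm with h2 | h2
  · exact hq.hwCoeff_ne_zero (fun j hj => by push_cast; omega) h2
  · exact (om N).ne_zero _ h2

lemma e_linearIndependent (hq : Generic h) (N : ℕ) :
    LinearIndependent ℂ fun i : Fin (N + 1) => e N h i := by
  refine Module.End.eigenvectors_linearIndependent' (qH N h)
    (fun i : Fin (N + 1) => qpow h (((N - 2 * (i : ℕ) : ℤ) : ℂ) / 2)) ?_ _ fun i =>
      ⟨e_mem hq N i, e_ne_zero hq (by omega)⟩
  intro i j hij
  have := hq.qpow_half_injective hij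
  exact Fin.ext (by omega)

/-- The basis of the vectors `(X⁻) ^ i ω_s`. -/
def eBasis (hq : Generic h) (N : ℕ) : Module.Basis (Fin (N + 1)) ℂ (V N) :=
  basisOfLinearIndependentOfCardEqFinrank (e_linearIndependent hq N) (by simp)

lemma eBasis_apply (hq : Generic h) (N : ℕ) (i : Fin (N + 1)) : eBasis hq N i = e N h i := by
  rw [eBasis, coe_basisOfLinearIndependentOfCardEqFinrank]

/-- The coordinates in the basis `eBasis`. -/
def ecoord (hq : Generic h) (N j : ℕ) : V N →ₗ[ℂ] ℂ :=
  if hj : j < N + 1 then (eBasis hq N).coord ⟨j, hj⟩ else 0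

lemma ecoord_e (hq : Generic h) (N j i : ℕ) :
    ecoord hq N j (e N h i) = if i = j ∧ i ≤ N then 1 else 0 := by
  rcases Nat.lt_or_ge N i with hi | hi
  · rw [e_eq_zero hq hi, map_zero, if_neg (by omega)]
  · have := eBasis_apply hq N ⟨i, by omega⟩
    simp only at this
    rw [ecoord]
    split_ifs with hj hc hc
    · obtain ⟨rfl, -⟩ := hc
      rw [← this]
      simp
    · rw [← this, Module.Basis.coord_apply, Module.Basis.repr_self, Finsupp.single_apply, if_neg]
      simp only [Fin.mk.injEq]
      omega
    · omega
    · rfl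

lemma hom_ext_e (hq : Generic h) {N : ℕ} {M : Type*} [AddCommGroup M] [Module ℂ M]
    {f g : V N →ₗ[ℂ] M} (H : ∀ i ≤ N, f (e N h i) = g (e N h i)) : f = g := by
  refine (eBasis hq N).ext fun i => ?_
  rw [eBasis_apply]
  exact H i (by omega)

/-- The image of `X⁻` has no component along `ω_s`. This removes all terms but the leading one of
the R-matrix in `slotR_R`. -/
lemma ecoord_zero_Xm (hq : Generic h) (N : ℕ) (x : V N) : ecoord hq N 0 (Xm N h x) = 0 := by
  have : ecoord hq N 0 ∘ₗ Xm N h = 0 := hom_ext_e hq fun i _ => by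
    rw [LinearMap.comp_apply, Xm_e, ecoord_e, if_neg (by omega), LinearMap.zero_apply]
  exact congrArg (fun T => T x) this

lemma ecoord_Xp (hq : Generic h) (N j : ℕ) (x : V N) :
    ecoord hq N j (Xp N h x) = qnum h (j + 1) * qnum h (N - j) * ecoord hq N (j + 1) x := by
  have : ecoord hq N j ∘ₗ Xp N h = (qnum h (j + 1) * qnum h (N - j)) • ecoord hq N (j + 1) :=
    hom_ext_e hq fun i hi => by
      rw [LinearMap.comp_apply, LinearMap.smul_apply, ecoord_e]
      rcases i with _ | i
      · rw [Xp_e_zero, map_zero, if_neg (by omega), smul_zero]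
      · rw [Xp_e_succ hq, map_smul, ecoord_e]
        by_cases hij : i = j
        · subst hij
          rw [if_pos (by omega), if_pos (by omega)]
        · rw [if_neg (by omega), if_neg (by omega), smul_zero, smul_zero]
  exact congrArg (fun T => T x) this

lemma ecoord_qH (hq : Generic h) (N j : ℕ) (x : V N) :
    ecoord hq N j (qH N h x) = qpow h (((N - 2 * j : ℤ) : ℂ) / 2) * ecoord hq N j x := by
  have : ecoord hq N j ∘ₗ qH N h = qpow h (((N - 2 * j : ℤ) : ℂ) / 2) • ecoord hq N j :=
    hom_ext_e hq fun i hi => by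
      rw [LinearMap.comp_apply, LinearMap.smul_apply, mem_wtSpace.mp (e_mem hq N i), map_smul,
        ecoord_e]
      by_cases hij : i = j
      · rw [hij]
      · rw [if_neg (by omega), smul_zero, smul_zero]
  exact congrArg (fun T => T x) this

lemma ecoord_qHinv (hq : Generic h) (N j : ℕ) (x : V N) :
    ecoord hq N j (qHinv N h x) = qpow h (-(((N - 2 * j : ℤ) : ℂ) / 2)) * ecoord hq N j x := by
  have h1 : x = qH N h (qHinv N h x) := by
    rw [← Module.End.mul_apply, (uqModule_V hq N).K_mul_Ki, Module.End.one_apply]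
  conv_rhs => rw [h1, ecoord_qH, ← mul_assoc, ← qpow_add, neg_add_cancel, qpow_zero, one_mul]

lemma Xp_pow_eq_zero (hq : Generic h) (N : ℕ) : (Xp N h) ^ (N + 1) = 0 := by
  refine hom_ext_e hq fun i hi => ?_
  have hM := uqModule_V hq N
  exact hM.eq_zero_of_lt hq (by rw [lt_abs]; left; push_cast; omega)
    (hM.E_pow_mem (e_mem hq N i) (N + 1))

lemma Xm_pow_eq_zero (hq : Generic h) (N : ℕ) : (Xm N h) ^ (N + 1) = 0 := by
  refine hom_ext_e hq fun i hi => ?_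
  rw [Xm_pow_e, e_eq_zero hq (by omega), LinearMap.zero_apply]

/-! ### The R-matrix on `V_s ⊗ V_s` -/

/-- `X⁺` on `V_s ⊗ V_s`. -/
def Xp2 (N : ℕ) (h : ℂ) : Module.End ℂ (V2 N) :=
  coprodX (qH N h) (Xp N h) (Xp N h) (qHinv N h)

/-- `X⁻` on `V_s ⊗ V_s`. -/
def Xm2 (N : ℕ) (h : ℂ) : Module.End ℂ (V2 N) :=
  coprodX (qH N h) (Xm N h) (Xm N h) (qHinv N h)

/-- `q ^ (-H)` on `V_s ⊗ V_s`. -/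
def qHinv2 (N : ℕ) (h : ℂ) : Module.End ℂ (V2 N) :=
  TensorProduct.map (qHinv N h) (qHinv N h)

/-- `q ^ (-H)` on `V_s ⊗ V_s ⊗ V_s`. -/
def qHinv3 (N : ℕ) (h : ℂ) : Module.End ℂ (V3 N) :=
  TensorProduct.map (qHinv2 N h) (qHinv N h)

lemma uqModule_V2 (hq : Generic h) (N : ℕ) :
    UqModule h (Xp2 N h) (Xm2 N h) (qH2 N h) (qHinv2 N h) (N + N) :=
  (uqModule_V hq N).tensor (uqModule_V hq N)

lemma uqModule_V3 (hq : Generic h) (N : ℕ) :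
    UqModule (M := V3 N) h (Xp3 N h) (Xm3 N h) (qH3 N h) (qHinv3 N h)
      (N + N + N) :=
  (uqModule_V2 hq N).tensor (uqModule_V hq N)

section RMatrix

variable {N : ℕ} {a b : ℤ} {x y : V N}

lemma qHH_tmul (hq : Generic h) (hx : x ∈ wtSpace h (qH N h) a) (hy : y ∈ wtSpace h (qH N h) b) :
    qHH N h (x ⊗ₜ y) = qpow h ((a : ℂ) * b / 4) • (x ⊗ₜ[ℂ] y) := by
  have h1 : ∀ j, qHH N h (x ⊗ₜ om N j) = qpow h ((a : ℂ) / 2 * wt N j) • (x ⊗ₜ[ℂ] om N j) := by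
    intro j
    have : qHH N h ∘ₗ (TensorProduct.mk ℂ (V N) (V N)).flip (om N j) =
        (TensorProduct.mk ℂ (V N) (V N)).flip (om N j) ∘ₗ
          diagOp (om N) fun i => qpow h (wt N i * wt N j) := by
      refine (om N).ext fun i => ?_
      simp only [LinearMap.comp_apply, LinearMap.flip_apply, TensorProduct.mk_apply,
        diagOp_apply_basis]
      have := diagOp_apply_basis (om2 N) (fun p => qpow h (wt N p.1 * wt N p.2)) (i, j)
      rw [om2, Module.Basis.tensorProduct_apply] at this
      rw [qHH, om2, this, TensorProduct.smul_tmul']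
    have := congrArg (fun T => T x) this
    simp only [LinearMap.comp_apply, LinearMap.flip_apply, TensorProduct.mk_apply] at this
    rw [this, diagOp_apply_of_mem hq (om N) _ (om_mem N) _ (qpow h ((a : ℂ) / 2 * wt N j)) _ hx,
      TensorProduct.smul_tmul']
    intro i hi
    rw [wt_eq, hi]
  have h2 : qHH N h ∘ₗ TensorProduct.mk ℂ (V N) (V N) x =
      TensorProduct.mk ℂ (V N) (V N) x ∘ₗ
        diagOp (om N) fun j => qpow h ((a : ℂ) / 2 * wt N j) := by
    refine (om N).ext fun j => ?_
    simp only [LinearMap.comp_apply, TensorProduct.mk_apply, diagOp_apply_basis, h1,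
      TensorProduct.tmul_smul]
  have h3 := congrArg (fun T => T y) h2
  simp only [LinearMap.comp_apply, TensorProduct.mk_apply] at h3
  rw [h3, diagOp_apply_of_mem hq (om N) _ (om_mem N) _ (qpow h ((a : ℂ) * b / 4)) _ hy,
    TensorProduct.tmul_smul]
  intro j hj
  rw [wt_eq, hj]
  ring_nf

lemma tensorMap_pow {M M' : Type*} [AddCommGroup M] [Module ℂ M] [AddCommGroup M'] [Module ℂ M']
    (f : Module.End ℂ M) (g : Module.End ℂ M') (m : ℕ) :
    (TensorProduct.map f g : Module.End ℂ (M ⊗[ℂ] M')) ^ m = TensorProduct.map (f ^ m) (g ^ m) := by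
  induction m with
  | zero => simp only [pow_zero, TensorProduct.map_one]
  | succ m ih => rw [pow_succ, pow_succ, pow_succ, ih, ← TensorProduct.map_mul]

/-- The `m`-th coefficient of the R-matrix on vectors of weights `a / 2` and `b / 2`. -/
def RCoeff (h : ℂ) (a b : ℤ) (m : ℕ) : ℂ :=
  rCoeff h m * qpow h ((a : ℂ) * b / 4 + ((a : ℂ) - 2 * m) * (b + 2 * m) / 4)

lemma R_tmul (hq : Generic h) (hx : x ∈ wtSpace h (qH N h) a) (hy : y ∈ wtSpace h (qH N h) b) :
    R N h (x ⊗ₜ y) = ∑ m ∈ Finset.range (N + 1),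
      RCoeff h a b m • (((Xp N h) ^ m) y ⊗ₜ[ℂ] ((Xm N h) ^ m) x) := by
  rw [R, Rplus, Module.End.mul_apply, Module.End.mul_apply, Module.End.mul_apply, qHH_tmul hq hx hy,
    map_smul, map_smul, map_smul, LinearMap.sum_apply, map_sum, map_sum, Finset.smul_sum]
  refine Finset.sum_congr rfl fun m _ => ?_
  rw [tensorMap_pow, LinearMap.smul_apply, TensorProduct.map_tmul, map_smul,
    qHH_tmul hq ((uqModule_V hq N).F_pow_mem hx m) ((uqModule_V hq N).E_pow_mem hy m), map_smul,
    map_smul, LinearEquiv.coe_coe, TensorProduct.comm_tmul, smul_smul, smul_smul, RCoeff, qpow_add]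
  push_cast
  congr 1
  ring

lemma Generic.rCoeff_succ (hq : Generic h) (m : ℕ) :
    rCoeff h (m + 1) * qnum h (m + 1) = rCoeff h m * (qpow h m * (qpow h 1 - qpow h (-1))) := by
  have h1 := hq.qnum_natCast_ne_zero (m := m + 1) (by omega)
  have h2 := hq.qfact_ne_zero m
  rw [rCoeff, rCoeff, qfact_succ]
  have : qpow h ((((m + 1 : ℕ) : ℂ) ^ 2 - (m + 1 : ℕ)) / 2) =
      qpow h (((m : ℂ) ^ 2 - m) / 2) * qpow h m := by
    rw [← qpow_add]
    push_cast
    ring_nf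
  rw [this, pow_succ]
  push_cast at h1
  field_simp
  ring

/-- The `q`-number `[m + 1]` produced by a commutator cancels the last factor of `[m + 1]!`, and `(q
- q⁻¹) [t]` opens up into two powers of `q`. This links consecutive terms of the R-matrix. -/
lemma RCoeff_succ_mul (hq : Generic h) (a b : ℤ) (m : ℕ) (t : ℂ) :
    RCoeff h a b (m + 1) * (qnum h (m + 1) * qnum h t) =
      rCoeff h m * qpow h m * (qpow h t - qpow h (-t)) *
        qpow h ((a : ℂ) * b / 4 + ((a : ℂ) - 2 * (m + 1)) * (b + 2 * (m + 1)) / 4) := by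
  rw [RCoeff, ← hq.mul_qnum]
  have := hq.rCoeff_succ m
  push_cast
  linear_combination (qnum h t *
    qpow h ((a : ℂ) * b / 4 + ((a : ℂ) - 2 * (m + 1)) * (b + 2 * (m + 1)) / 4)) * this

lemma coprodX_tmul {M M' : Type} [AddCommGroup M] [Module ℂ M] [AddCommGroup M'] [Module ℂ M']
    (K X : Module.End ℂ M) (X' Ki : Module.End ℂ M') (x : M) (y : M') :
    coprodX K X X' Ki (x ⊗ₜ y) = X x ⊗ₜ[ℂ] Ki y + K x ⊗ₜ[ℂ] X' y := by
  rw [coprodX, LinearMap.add_apply, TensorProduct.map_tmul, TensorProduct.map_tmul]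

lemma R_Xp2_tmul (hq : Generic h) (hx : x ∈ wtSpace h (qH N h) a)
    (hy : y ∈ wtSpace h (qH N h) b) :
    R N h (Xp2 N h (x ⊗ₜ y)) = Xp2 N h (R N h (x ⊗ₜ y)) := by
  have hM := uqModule_V hq N
  -- At `m = 0` the truncated exponent `m - 1` does no harm because of the factor `[0]`.
  have hF : ∀ m : ℕ, Xp N h (((Xm N h) ^ m) x) = ((Xm N h) ^ m) (Xp N h x) +
      (qnum h m * qnum h (a - m + 1)) • ((Xm N h) ^ (m - 1)) x := by
    intro m
    rcases m with _ | m
    · simp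
    · rw [hM.E_F_pow_apply hq hx]
      push_cast
      rw [show (a : ℂ) - (m + 1) + 1 = a - m by ring]
  have hL : R N h (Xp2 N h (x ⊗ₜ y)) =
      ∑ m ∈ Finset.range (N + 1), ((qpow h (-((b : ℂ) / 2)) * RCoeff h (a + 2) b m) •
        (((Xp N h) ^ m) y ⊗ₜ[ℂ] ((Xm N h) ^ m) (Xp N h x)) +
        (qpow h ((a : ℂ) / 2) * RCoeff h a (b + 2) m) •
        (((Xp N h) ^ (m + 1)) y ⊗ₜ[ℂ] ((Xm N h) ^ m) x)) := by
    rw [Xp2, coprodX_tmul, hM.Ki_apply hy, mem_wtSpace.mp hx, TensorProduct.tmul_smul,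
      ← TensorProduct.smul_tmul', map_add, map_smul, map_smul, R_tmul hq (hM.E_mem hx) hy,
      R_tmul hq hx (hM.E_mem hy), Finset.smul_sum, Finset.smul_sum, ← Finset.sum_add_distrib]
    refine Finset.sum_congr rfl fun m _ => ?_
    rw [smul_smul, smul_smul, pow_succ, Module.End.mul_apply]
  have hR : Xp2 N h (R N h (x ⊗ₜ y)) =
      ∑ m ∈ Finset.range (N + 1), ((RCoeff h a b m * qpow h (-(((a : ℂ) - 2 * m) / 2))) •
        (((Xp N h) ^ (m + 1)) y ⊗ₜ[ℂ] ((Xm N h) ^ m) x) +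
        (RCoeff h a b m * qpow h (((b : ℂ) + 2 * m) / 2)) •
        (((Xp N h) ^ m) y ⊗ₜ[ℂ] ((Xm N h) ^ m) (Xp N h x))) +
      ∑ m ∈ Finset.range (N + 1), (RCoeff h a b m * qpow h (((b : ℂ) + 2 * m) / 2) *
        (qnum h m * qnum h (a - m + 1))) •
        (((Xp N h) ^ m) y ⊗ₜ[ℂ] ((Xm N h) ^ (m - 1)) x) := by
    rw [R_tmul hq hx hy, map_sum, ← Finset.sum_add_distrib]
    refine Finset.sum_congr rfl fun m _ => ?_
    rw [map_smul, Xp2, coprodX_tmul, hM.Ki_apply (hM.F_pow_mem hx m),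
      mem_wtSpace.mp (hM.E_pow_mem hy m), hF, TensorProduct.tmul_smul, ← TensorProduct.smul_tmul',
      TensorProduct.tmul_add, TensorProduct.tmul_smul, pow_succ', Module.End.mul_apply]
    push_cast
    module
  -- The commutator terms are moved by one index. The new term at `m = N` is zero since `(X⁺)^(N +
  -- 1) = 0`, the old one at `m = 0` since `[0] = 0`. Then both sides involve the same two kinds of
  -- tensors.
  have hshift : ∑ m ∈ Finset.range (N + 1), (RCoeff h a b m * qpow h (((b : ℂ) + 2 * m) / 2) *
        (qnum h m * qnum h (a - m + 1))) •
        (((Xp N h) ^ m) y ⊗ₜ[ℂ] ((Xm N h) ^ (m - 1)) x) =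
      ∑ m ∈ Finset.range (N + 1), (RCoeff h a b (m + 1) * (qnum h (m + 1) * qnum h (a - m)) *
        qpow h (((b : ℂ) + 2 * (m + 1)) / 2)) •
        (((Xp N h) ^ (m + 1)) y ⊗ₜ[ℂ] ((Xm N h) ^ m) x) := by
    rw [Finset.sum_range_succ', Finset.sum_range_succ _ N, Xp_pow_eq_zero hq, LinearMap.zero_apply,
      TensorProduct.zero_tmul, smul_zero, Nat.cast_zero, qnum_zero, zero_mul, mul_zero, zero_smul]
    congr 1
    refine Finset.sum_congr rfl fun m _ => ?_
    push_cast
    rw [show (a : ℂ) - (m + 1) + 1 = a - m by ring]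
    congr 1
    ring
  rw [hL, hR, hshift, ← Finset.sum_add_distrib]
  refine Finset.sum_congr rfl fun m _ => ?_
  have c1 : qpow h (-((b : ℂ) / 2)) * RCoeff h (a + 2) b m =
      RCoeff h a b m * qpow h (((b : ℂ) + 2 * m) / 2) := by
    rw [RCoeff, RCoeff, mul_left_comm, mul_assoc, ← qpow_add, ← qpow_add]
    push_cast
    ring_nf
  have c2 : qpow h ((a : ℂ) / 2) * RCoeff h a (b + 2) m =
      RCoeff h a b m * qpow h (-(((a : ℂ) - 2 * m) / 2)) +
        RCoeff h a b (m + 1) * (qnum h (m + 1) * qnum h (a - m)) *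
          qpow h (((b : ℂ) + 2 * (m + 1)) / 2) := by
    rw [RCoeff_succ_mul hq, RCoeff, RCoeff]
    simp only [mul_sub, sub_mul, mul_assoc, ← qpow_add, mul_left_comm _ (rCoeff h m)]
    push_cast
    ring_nf
  rw [c1, c2]
  module

lemma R_Xm2_tmul (hq : Generic h) (hx : x ∈ wtSpace h (qH N h) a)
    (hy : y ∈ wtSpace h (qH N h) b) :
    R N h (Xm2 N h (x ⊗ₜ y)) = Xm2 N h (R N h (x ⊗ₜ y)) := by
  have hM := uqModule_V hq N
  have hE : ∀ m : ℕ, ((Xp N h) ^ m) (Xm N h y) = Xm N h (((Xp N h) ^ m) y) +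
      (qnum h m * qnum h (b + m - 1)) • ((Xp N h) ^ (m - 1)) y := by
    intro m
    rcases m with _ | m
    · simp
    -- The commutation rule with `X⁺` and `X⁻` exchanged; the weight of `y` changes its sign.
    · have hy' : y ∈ wtSpace h (qHinv N h) (-b) := by rwa [hM.wtSpace_Ki, neg_neg]
      rw [hM.swap.E_F_pow_apply hq hy', add_assoc, Nat.add_sub_cancel, ← add_smul]
      push_cast
      rw [show -(b : ℂ) - m = -(b + (m + 1) - 1) by ring, qnum_neg, mul_neg, neg_add_cancel,
        zero_smul, add_zero]
  have hL : R N h (Xm2 N h (x ⊗ₜ y)) =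
      ∑ m ∈ Finset.range (N + 1), ((qpow h (-((b : ℂ) / 2)) * RCoeff h (a - 2) b m) •
        (((Xp N h) ^ m) y ⊗ₜ[ℂ] ((Xm N h) ^ (m + 1)) x) +
        (qpow h ((a : ℂ) / 2) * RCoeff h a (b - 2) m) •
        (Xm N h (((Xp N h) ^ m) y) ⊗ₜ[ℂ] ((Xm N h) ^ m) x)) +
      ∑ m ∈ Finset.range (N + 1), (qpow h ((a : ℂ) / 2) * RCoeff h a (b - 2) m *
        (qnum h m * qnum h (b + m - 1))) •
        (((Xp N h) ^ (m - 1)) y ⊗ₜ[ℂ] ((Xm N h) ^ m) x) := by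
    rw [Xm2, coprodX_tmul, hM.Ki_apply hy, mem_wtSpace.mp hx, TensorProduct.tmul_smul,
      ← TensorProduct.smul_tmul', map_add, map_smul, map_smul, R_tmul hq (hM.F_mem hx) hy,
      R_tmul hq hx (hM.F_mem hy), Finset.smul_sum, Finset.smul_sum, ← Finset.sum_add_distrib,
      ← Finset.sum_add_distrib]
    refine Finset.sum_congr rfl fun m _ => ?_
    rw [smul_smul, smul_smul, pow_succ (Xm N h), Module.End.mul_apply, hE, TensorProduct.add_tmul,
      ← TensorProduct.smul_tmul']
    module
  have hR : Xm2 N h (R N h (x ⊗ₜ y)) =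
      ∑ m ∈ Finset.range (N + 1), ((RCoeff h a b m * qpow h (-(((a : ℂ) - 2 * m) / 2))) •
        (Xm N h (((Xp N h) ^ m) y) ⊗ₜ[ℂ] ((Xm N h) ^ m) x) +
        (RCoeff h a b m * qpow h (((b : ℂ) + 2 * m) / 2)) •
        (((Xp N h) ^ m) y ⊗ₜ[ℂ] ((Xm N h) ^ (m + 1)) x)) := by
    rw [R_tmul hq hx hy, map_sum]
    refine Finset.sum_congr rfl fun m _ => ?_
    rw [map_smul, Xm2, coprodX_tmul, hM.Ki_apply (hM.F_pow_mem hx m),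
      mem_wtSpace.mp (hM.E_pow_mem hy m), TensorProduct.tmul_smul, ← TensorProduct.smul_tmul',
      pow_succ' (Xm N h), Module.End.mul_apply]
    push_cast
    module
  have hshift : ∑ m ∈ Finset.range (N + 1), (qpow h ((a : ℂ) / 2) * RCoeff h a (b - 2) m *
        (qnum h m * qnum h (b + m - 1))) •
        (((Xp N h) ^ (m - 1)) y ⊗ₜ[ℂ] ((Xm N h) ^ m) x) =
      ∑ m ∈ Finset.range (N + 1), (RCoeff h a (b - 2) (m + 1) * (qnum h (m + 1) *
        qnum h (b + m)) * qpow h ((a : ℂ) / 2)) •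
        (((Xp N h) ^ m) y ⊗ₜ[ℂ] ((Xm N h) ^ (m + 1)) x) := by
    rw [Finset.sum_range_succ', Finset.sum_range_succ _ N, Xm_pow_eq_zero hq, LinearMap.zero_apply,
      TensorProduct.tmul_zero, smul_zero, Nat.cast_zero, qnum_zero, zero_mul, mul_zero, zero_smul]
    congr 1
    refine Finset.sum_congr rfl fun m _ => ?_
    push_cast
    rw [show (b : ℂ) + (m + 1) - 1 = b + m by ring]
    congr 1
    ring
  rw [hL, hR, hshift, ← Finset.sum_add_distrib]
  refine Finset.sum_congr rfl fun m _ => ?_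
  have c1 : qpow h ((a : ℂ) / 2) * RCoeff h a (b - 2) m =
      RCoeff h a b m * qpow h (-(((a : ℂ) - 2 * m) / 2)) := by
    rw [RCoeff, RCoeff, mul_left_comm, mul_assoc, ← qpow_add, ← qpow_add]
    push_cast
    ring_nf
  have c2 : RCoeff h a b m * qpow h (((b : ℂ) + 2 * m) / 2) =
      qpow h (-((b : ℂ) / 2)) * RCoeff h (a - 2) b m +
        RCoeff h a (b - 2) (m + 1) * (qnum h (m + 1) * qnum h (b + m)) * qpow h ((a : ℂ) / 2) := by
    rw [RCoeff_succ_mul hq, RCoeff, RCoeff]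
    simp only [mul_sub, sub_mul, mul_assoc, ← qpow_add, mul_left_comm _ (rCoeff h m)]
    push_cast
    ring_nf
  rw [c1, c2]
  module

end RMatrix

lemma end_ext_om2 {N : ℕ} {M : Type*} [AddCommGroup M] [Module ℂ M] {f g : V2 N →ₗ[ℂ] M}
    (H : ∀ i j, f (om N i ⊗ₜ om N j) = g (om N i ⊗ₜ om N j)) : f = g := by
  refine (om2 N).ext fun p => ?_
  rw [om2, Module.Basis.tensorProduct_apply]
  exact H _ _

lemma R_mul_Xp2 (hq : Generic h) (N : ℕ) : R N h * Xp2 N h = Xp2 N h * R N h :=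
  end_ext_om2 fun i j => by
    rw [Module.End.mul_apply, Module.End.mul_apply, R_Xp2_tmul hq (om_mem N i) (om_mem N j)]

lemma R_mul_Xm2 (hq : Generic h) (N : ℕ) : R N h * Xm2 N h = Xm2 N h * R N h :=
  end_ext_om2 fun i j => by
    rw [Module.End.mul_apply, Module.End.mul_apply, R_Xm2_tmul hq (om_mem N i) (om_mem N j)]

lemma R_mul_qH2 (hq : Generic h) (N : ℕ) : R N h * qH2 N h = qH2 N h * R N h := by
  refine end_ext_om2 fun i j => ?_
  have hM := uqModule_V hq N
  rw [Module.End.mul_apply, Module.End.mul_apply, qH2,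
    mem_wtSpace.mp (tmul_mem_wtSpace (om_mem N i) (om_mem N j)), map_smul,
    R_tmul hq (om_mem N i) (om_mem N j), map_sum, Finset.smul_sum]
  refine Finset.sum_congr rfl fun m _ => ?_
  rw [map_smul, mem_wtSpace.mp (tmul_mem_wtSpace (hM.E_pow_mem (om_mem N j) m)
    (hM.F_pow_mem (om_mem N i) m)), smul_comm]
  push_cast
  ring_nf

/-! ### Coordinates of a tensor factor -/

section Slots

variable {M : Type} [AddCommGroup M] [Module ℂ M] {N : ℕ}

/-- Apply a linear form to the right factor `V_s`. -/
def slotR (M : Type) [AddCommGroup M] [Module ℂ M] {N : ℕ} (f : V N →ₗ[ℂ] ℂ) :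
    M ⊗[ℂ] V N →ₗ[ℂ] M :=
  (TensorProduct.rid ℂ M).toLinearMap ∘ₗ LinearMap.lTensor M f

/-- Apply a linear form to the left factor `V_s`. -/
def slotL (M : Type) [AddCommGroup M] [Module ℂ M] {N : ℕ} (f : V N →ₗ[ℂ] ℂ) :
    V N ⊗[ℂ] M →ₗ[ℂ] M :=
  (TensorProduct.lid ℂ M).toLinearMap ∘ₗ LinearMap.rTensor M f

lemma slotR_tmul (f : V N →ₗ[ℂ] ℂ) (x : M) (y : V N) : slotR M f (x ⊗ₜ y) = f y • x := by
  simp [slotR]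

lemma slotL_tmul (f : V N →ₗ[ℂ] ℂ) (x : V N) (y : M) : slotL M f (x ⊗ₜ y) = f x • y := by
  simp [slotL]

lemma sum_ecoord_smul (hq : Generic h) (y : V N) :
    ∑ j ∈ Finset.range (N + 1), ecoord hq N j y • e N h j = y := by
  have : ∑ j ∈ Finset.range (N + 1), (ecoord hq N j).smulRight (e N h j) = LinearMap.id := by
    refine hom_ext_e hq fun i hi => ?_
    rw [LinearMap.sum_apply, Finset.sum_eq_single i, LinearMap.smulRight_apply, ecoord_e,
      if_pos ⟨rfl, hi⟩, one_smul, LinearMap.id_apply]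
    · intro j _ hj
      rw [LinearMap.smulRight_apply, ecoord_e, if_neg (by omega), zero_smul]
    · intro hc
      exact absurd (Finset.mem_range.mpr (by omega)) hc
  have := congrArg (fun T => T y) this
  simpa only [LinearMap.sum_apply, LinearMap.smulRight_apply, LinearMap.id_apply] using this

lemma sum_slotR (hq : Generic h) (z : M ⊗[ℂ] V N) :
    ∑ j ∈ Finset.range (N + 1), slotR M (ecoord hq N j) z ⊗ₜ[ℂ] e N h j = z := by
  induction z with
  | zero => simp
  | add x y hx hy =>
    conv_rhs => rw [← hx, ← hy, ← Finset.sum_add_distrib]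
    simp only [map_add, TensorProduct.add_tmul]
  | tmul x y =>
    simp only [slotR_tmul, TensorProduct.smul_tmul, ← TensorProduct.tmul_sum, sum_ecoord_smul]

lemma slotR_coprodX (hq : Generic h) (K E : Module.End ℂ M) (j : ℕ) (z : M ⊗[ℂ] V N) :
    slotR M (ecoord hq N j) (coprodX K E (Xp N h) (qHinv N h) z) =
      qpow h (-(((N - 2 * j : ℤ) : ℂ) / 2)) • E (slotR M (ecoord hq N j) z) +
        (qnum h (j + 1) * qnum h (N - j)) • K (slotR M (ecoord hq N (j + 1)) z) := by
  induction z with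
  | zero => simp
  | add x y hx hy => simp only [map_add, hx, hy, smul_add]; abel
  | tmul x y =>
    rw [coprodX_tmul, map_add, slotR_tmul, slotR_tmul, slotR_tmul, slotR_tmul, ecoord_qHinv,
      ecoord_Xp, map_smul, map_smul, smul_smul, smul_smul]

variable {E F K Ki : Module.End ℂ M} {L : ℕ}

/-- A highest weight vector is determined by its component along `ω_s` in the last factor. -/
lemma UqModule.eq_zero_of_slotR (hM : UqModule h E F K Ki L) (hq : Generic h) {z : M ⊗[ℂ] V N}
    (hz : coprodX K E (Xp N h) (qHinv N h) z = 0) (h0 : slotR M (ecoord hq N 0) z = 0) : z = 0 := by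
  have hj : ∀ j ≤ N, slotR M (ecoord hq N j) z = 0 := by
    intro j
    induction j with
    | zero => exact fun _ => h0
    | succ j ih =>
      intro hj
      -- The `j`-th component of `X⁺ z = 0` expresses `K` of the component `j + 1` by `E` of the
      -- component `j`; for `j < N` the coefficient is not zero, and `K` is invertible.
      have h1 := slotR_coprodX hq K E j z
      rw [hz, map_zero, ih (by omega), map_zero, smul_zero, zero_add] at h1
      have c1 := hq.qnum_natCast_ne_zero (m := j + 1) (by omega)
      have c2 := hq.qnum_natCast_ne_zero (m := N - j) (by omega)
      rw [Nat.cast_sub (by omega)] at c2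
      push_cast at c1
      have h2 := (smul_eq_zero.mp h1.symm).resolve_left (mul_ne_zero c1 c2)
      have h3 := congrArg Ki h2
      rwa [← Module.End.mul_apply, hM.Ki_mul_K, Module.End.one_apply, map_zero] at h3
  rw [← sum_slotR hq z]
  exact Finset.sum_eq_zero fun j hj' => by
    rw [hj j (by rw [Finset.mem_range] at hj'; omega), TensorProduct.zero_tmul]

lemma UqModule.E_pow_K_apply (hM : UqModule h E F K Ki L) (p : ℕ) {x : M} (hx : (E ^ p) x = 0) :
    (E ^ p) (K x) = 0 := by
  have : ∀ p : ℕ, ∃ c : ℂ, E ^ p * K = c • (K * E ^ p) := by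
    intro p
    induction p with
    | zero => exact ⟨1, by simp⟩
    | succ p ih =>
      obtain ⟨c, hc⟩ := ih
      refine ⟨qpow h (-1) * c, ?_⟩
      have : E * K = qpow h (-1) • (K * E) := by
        rw [hM.K_mul_E, smul_smul, qpow_neg_one_mul_one, one_smul]
      rw [pow_succ E, mul_assoc, this, mul_smul_comm, ← mul_assoc, hc, smul_mul_assoc, mul_assoc,
        smul_smul]
  obtain ⟨c, hc⟩ := this p
  rw [← Module.End.mul_apply, hc, LinearMap.smul_apply, Module.End.mul_apply, hx, map_zero,
    smul_zero]

/-- The same recursion read downwards: the component `N` is killed by `E`, and each lower one needs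
one more power. This yields the bound `n - k ≤ N` on the index set. -/
lemma UqModule.E_pow_slotR (hM : UqModule h E F K Ki L) (hq : Generic h) {z : M ⊗[ℂ] V N}
    (hz : coprodX K E (Xp N h) (qHinv N h) z = 0) :
    (E ^ (N + 1)) (slotR M (ecoord hq N 0) z) = 0 := by
  have key : ∀ d ≤ N, (E ^ (d + 1)) (slotR M (ecoord hq N (N - d)) z) = 0 := by
    intro d
    induction d with
    | zero =>
      intro _
      have h1 := slotR_coprodX hq K E N z
      rw [hz, map_zero, sub_self, qnum_zero, mul_zero, zero_smul, add_zero] at h1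
      simpa using (smul_eq_zero.mp h1.symm).resolve_left (qpow_ne_zero _ _)
    | succ d ih =>
      intro hd
      have h1 := slotR_coprodX hq K E (N - (d + 1)) z
      rw [hz, map_zero, show N - (d + 1) + 1 = N - d by omega] at h1
      have h2 := congrArg (fun x => (E ^ (d + 1)) x) h1
      simp only [map_zero, map_add, map_smul, hM.E_pow_K_apply (d + 1) (ih (by omega)), smul_zero,
        add_zero] at h2
      have h3 := (smul_eq_zero.mp h2.symm).resolve_left (qpow_ne_zero _ _)
      rwa [← Module.End.mul_apply, ← pow_succ] at h3
  simpa using key N le_rfl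

end Slots

lemma end_ext_e2 (hq : Generic h) {N : ℕ} {M : Type*} [AddCommGroup M] [Module ℂ M]
    {f g : V2 N →ₗ[ℂ] M} (H : ∀ i ≤ N, ∀ j ≤ N, f (e N h i ⊗ₜ e N h j) = g (e N h i ⊗ₜ e N h j)) :
    f = g :=
  TensorProduct.ext (hom_ext_e hq fun i hi => hom_ext_e hq fun j hj => H i hi j hj)

lemma qH_pow_apply {M : Type*} [AddCommGroup M] [Module ℂ M] {K : Module.End ℂ M} {m : ℤ} {x : M}
    (hx : x ∈ wtSpace h K m) (p : ℕ) : (K ^ p) x = qpow h (p * ((m : ℂ) / 2)) • x := by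
  induction p with
  | zero => simp
  | succ p ih =>
    rw [pow_succ', Module.End.mul_apply, ih, map_smul, mem_wtSpace.mp hx, smul_smul, ← qpow_add]
    push_cast
    ring_nf

/-- The component of `R x` along `ω_s` in the second factor comes from the component of `x` along
`ω_s` in the first factor. -/
lemma slotR_R (hq : Generic h) (N : ℕ) (z : V2 N) :
    slotR (V N) (ecoord hq N 0) (R N h z) = ((qH N h) ^ N) (slotL (V N) (ecoord hq N 0) z) := by
  have : slotR (V N) (ecoord hq N 0) ∘ₗ R N h =
      ((qH N h) ^ N) ∘ₗ slotL (V N) (ecoord hq N 0) := by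
    refine end_ext_e2 hq fun i hi j hj => ?_
    rw [LinearMap.comp_apply, LinearMap.comp_apply, R_tmul hq (e_mem hq N i) (e_mem hq N j),
      map_sum, slotL_tmul, map_smul, qH_pow_apply (e_mem hq N j), Finset.sum_eq_single 0]
    · rw [map_smul, slotR_tmul, pow_zero, pow_zero, Module.End.one_apply, Module.End.one_apply,
        ecoord_e]
      rcases i with _ | i
      · rw [if_pos (by omega), one_smul, one_smul, RCoeff, rCoeff]
        simp only [Nat.cast_zero, zero_pow (two_ne_zero), sub_zero, zero_div, qpow_zero, pow_zero,
          qfact_zero, mul_zero, add_zero, div_one, one_mul]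
        push_cast
        congr 2
        ring
      · rw [if_neg (by omega), zero_smul, zero_smul, smul_zero]
    · intro m _ hm
      obtain ⟨m, rfl⟩ := Nat.exists_eq_succ_of_ne_zero hm
      rw [map_smul, slotR_tmul, Nat.succ_eq_add_one, pow_succ' (Xm N h), Module.End.mul_apply,
        ecoord_zero_Xm, zero_smul, smul_zero]
    · simp
  exact congrArg (fun T => T z) this

lemma slotR_Xm2 (hq : Generic h) (N : ℕ) (z : V2 N) :
    slotR (V N) (ecoord hq N 0) (Xm2 N h z) =
      qpow h (-((N : ℂ) / 2)) • Xm N h (slotR (V N) (ecoord hq N 0) z) := by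
  induction z using TensorProduct.induction_on with
  | zero => simp
  | add x y hx hy => simp only [map_add, hx, hy, smul_add]
  | tmul x y =>
    rw [Xm2, coprodX_tmul, map_add, slotR_tmul, slotR_tmul, slotR_tmul, ecoord_qHinv,
      ecoord_zero_Xm, zero_smul, add_zero, map_smul, smul_smul]
    simp

lemma slotL_Xm2 (hq : Generic h) (N : ℕ) (z : V2 N) :
    slotL (V N) (ecoord hq N 0) (Xm2 N h z) =
      qpow h ((N : ℂ) / 2) • Xm N h (slotL (V N) (ecoord hq N 0) z) := by
  induction z using TensorProduct.induction_on with
  | zero => simp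
  | add x y hx hy => simp only [map_add, hx, hy, smul_add]
  | tmul x y =>
    rw [Xm2, coprodX_tmul, map_add, slotL_tmul, slotL_tmul, slotL_tmul, ecoord_qH,
      ecoord_zero_Xm, zero_smul, zero_add, map_smul, smul_smul]
    simp

lemma slotR_Xm2_pow (hq : Generic h) (N p : ℕ) (z : V2 N) :
    slotR (V N) (ecoord hq N 0) (((Xm2 N h) ^ p) z) =
      qpow h (p * -((N : ℂ) / 2)) • ((Xm N h) ^ p) (slotR (V N) (ecoord hq N 0) z) := by
  induction p with
  | zero => simp
  | succ p ih =>
    rw [pow_succ' (Xm2 N h), Module.End.mul_apply, slotR_Xm2, ih, map_smul, smul_smul, ← qpow_add,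
      pow_succ' (Xm N h), Module.End.mul_apply]
    push_cast
    ring_nf

lemma slotL_Xm2_pow (hq : Generic h) (N p : ℕ) (z : V2 N) :
    slotL (V N) (ecoord hq N 0) (((Xm2 N h) ^ p) z) =
      qpow h (p * ((N : ℂ) / 2)) • ((Xm N h) ^ p) (slotL (V N) (ecoord hq N 0) z) := by
  induction p with
  | zero => simp
  | succ p ih =>
    rw [pow_succ' (Xm2 N h), Module.End.mul_apply, slotL_Xm2, ih, map_smul, smul_smul, ← qpow_add,
      pow_succ' (Xm N h), Module.End.mul_apply]
    push_cast
    ring_nf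

/-! ### Highest weight vectors of `V_s ⊗ V_s` -/

/-- The coefficients of the highest weight vectors of a tensor product `U ⊗ V_s` or `V_s ⊗ U`. -/
def cgCoeff (h : ℂ) (N d B : ℕ) (σ : ℂ) (m : ℕ) : ℂ :=
  (-1) ^ m * qpow h (m * σ) * (qfact h d * qfact h (B + m) * qfact h (N - m) /
    (qfact h (d - m) * qfact h B * qfact h m * qfact h N))

lemma cgCoeff_zero (hq : Generic h) (N d B : ℕ) (σ : ℂ) : cgCoeff h N d B σ 0 = 1 := by
  have n := hq.qfact_ne_zero
  simp only [cgCoeff, pow_zero, Nat.cast_zero, zero_mul, qpow_zero, one_mul, add_zero, Nat.sub_zero,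
    qfact_zero, mul_one]
  have n1 := n d
  have n2 := n B
  have n3 := n N
  field_simp

/-- The condition for neighbouring terms to cancel when `X⁺` is applied to the sums `phi`, `hwTmulR`
and `hwTmulL`. -/
lemma cgCoeff_succ (hq : Generic h) {N d B m : ℕ} (σ : ℂ) (hm : m < d) (hd : d ≤ N) :
    cgCoeff h N d B σ (m + 1) * (qnum h (m + 1) * qnum h (N - m)) =
      -(qpow h σ * (qnum h (d - m) * qnum h (B + m + 1)) * cgCoeff h N d B σ m) := by
  obtain ⟨p, rfl⟩ : ∃ p, d = m + 1 + p := ⟨d - (m + 1), by omega⟩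
  obtain ⟨r, rfl⟩ : ∃ r, N = m + 1 + p + r := ⟨N - (m + 1 + p), by omega⟩
  have n := hq.qfact_ne_zero
  have c1 := hq.qnum_natCast_ne_zero (m := m + 1) (by omega)
  have c2 := hq.qnum_natCast_ne_zero (m := p + 1) (by omega)
  have n1 := n (m + 1 + p + r)
  have n2 := n B
  have n3 := n p
  have n4 := n m
  simp only [cgCoeff, show m + 1 + p + r - (m + 1) = p + r by omega,
    show m + 1 + p + r - m = p + r + 1 by omega, show m + 1 + p - (m + 1) = p by omega,
    show m + 1 + p - m = p + 1 by omega, ← add_assoc, qfact_succ, pow_succ]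
  have e1 : qpow h (((m + 1 : ℕ) : ℂ) * σ) = qpow h (m * σ) * qpow h σ := by
    rw [← qpow_add]; push_cast; ring_nf
  rw [e1]
  push_cast at c1 c2 ⊢
  rw [show (m : ℂ) + 1 + p + r - m = p + r + 1 by ring, show (m : ℂ) + 1 + p - m = p + 1 by ring]
  field_simp

/-- The highest weight vector of weight `2s - l` in `V_s ⊗ V_s`. -/
def phi (N : ℕ) (h : ℂ) (l : ℕ) : V2 N :=
  ∑ i ∈ Finset.range (l + 1),
    cgCoeff h N l (N - l) (N - l + 1) i • (e N h i ⊗ₜ[ℂ] e N h (l - i))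

lemma phi_mem (hq : Generic h) (N l : ℕ) : phi N h l ∈ wtSpace h (qH2 N h) (2 * N - 2 * l) := by
  refine Submodule.sum_mem _ fun i hi => Submodule.smul_mem _ _ ?_
  have hi : i ≤ l := by simpa [Nat.lt_succ_iff] using hi
  rw [show (2 * N - 2 * l : ℤ) = (N - 2 * i) + (N - 2 * (l - i : ℕ)) by
    rw [Nat.cast_sub hi]; ring]
  exact tmul_mem_wtSpace (e_mem hq N i) (e_mem hq N (l - i))

lemma Xp2_phi (hq : Generic h) {N l : ℕ} (hl : l ≤ N) : Xp2 N h (phi N h l) = 0 := by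
  rcases l with _ | l
  · simp only [phi, zero_add, Finset.sum_range_one, map_smul, Xp2, coprodX_tmul, Nat.sub_self,
      Xp_e_zero, TensorProduct.zero_tmul, TensorProduct.tmul_zero, add_zero, smul_zero]
  · have hM := uqModule_V hq N
    rw [phi, map_sum]
    simp only [map_smul, Xp2, coprodX_tmul, smul_add]
    -- The term with `X⁺` on the first factor at `i + 1` is paired with the one with `X⁺` on the
    -- second factor at `i`; the unpaired end terms contain `X⁺ ω_s = 0`.
    rw [Finset.sum_add_distrib, Finset.sum_range_succ', Finset.sum_range_succ
      (fun i => cgCoeff h N (l + 1) (N - (l + 1)) (N - (l + 1 : ℕ) + 1) i •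
        (qH N h (e N h i) ⊗ₜ[ℂ] Xp N h (e N h (l + 1 - i)))), Nat.sub_self, Xp_e_zero,
      TensorProduct.zero_tmul, TensorProduct.tmul_zero, smul_zero, smul_zero, add_zero, add_zero,
      ← Finset.sum_add_distrib]
    refine Finset.sum_eq_zero fun i hi => ?_
    have hi : i ≤ l := by simpa [Nat.lt_succ_iff] using hi
    rw [show l + 1 - (i + 1) = l - i by omega, show l + 1 - i = l - i + 1 by omega, Xp_e_succ hq,
      Xp_e_succ hq, hM.Ki_apply (e_mem hq N (l - i)), mem_wtSpace.mp (e_mem hq N i),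
      TensorProduct.smul_tmul_smul, TensorProduct.smul_tmul_smul, smul_smul, smul_smul, ← add_smul]
    have key := cgCoeff_succ hq (N := N) (d := l + 1) (B := N - (l + 1)) (m := i)
      (N - (l + 1 : ℕ) + 1) (by omega) hl
    rw [← mul_assoc, key]
    rw [Nat.cast_sub (R := ℂ) hl, Nat.cast_sub (R := ℤ) hi, Nat.cast_sub (R := ℂ) hi]
    push_cast
    rw [show (l : ℂ) + 1 - i = l - i + 1 by ring,
      show (N : ℂ) - (l + 1) + i + 1 = N - (l - i) by ring]
    have e1 : qpow h ((N : ℂ) - (l + 1) + 1) * qpow h (-((N - 2 * (l - i)) / 2)) =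
        qpow h ((N - 2 * i) / 2) := by
      rw [← qpow_add]; ring_nf
    rw [show ∀ x : V2 N, ∀ c : ℂ, c = 0 → c • x = 0 from fun x c hc => by rw [hc, zero_smul]]
    linear_combination (-(qnum h ((l : ℂ) - i + 1) * qnum h ((N : ℂ) - (l - i)) *
      cgCoeff h N (l + 1) (N - (l + 1)) (N - (l + 1) + 1) i)) * e1

/-- The coefficient of `phi` at `ω_{s - l} ⊗ ω_s`. -/
lemma cgCoeff_phi_last (hq : Generic h) {N l : ℕ} (hl : l ≤ N) :
    cgCoeff h N l (N - l) (N - l + 1) l = (-1) ^ l * qpow h (l * (N - l + 1)) := by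
  have n := hq.qfact_ne_zero
  have n1 := n l
  have n2 := n (N - l)
  have n3 := n N
  rw [cgCoeff, Nat.sub_self, qfact_zero, Nat.sub_add_cancel hl]
  field_simp

lemma slotR_phi (hq : Generic h) {N l : ℕ} (hl : l ≤ N) :
    slotR (V N) (ecoord hq N 0) (phi N h l) = ((-1) ^ l * qpow h (l * (N - l + 1))) • e N h l := by
  rw [phi, map_sum, Finset.sum_eq_single l]
  · rw [map_smul, slotR_tmul, Nat.sub_self, ecoord_e, if_pos (by omega), one_smul,
      cgCoeff_phi_last hq hl]
  · intro i hi hil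
    rw [Finset.mem_range] at hi
    rw [map_smul, slotR_tmul, ecoord_e, if_neg (by omega), zero_smul, smul_zero]
  · simp

lemma slotL_phi (hq : Generic h) (N l : ℕ) :
    slotL (V N) (ecoord hq N 0) (phi N h l) = e N h l := by
  rw [phi, map_sum, Finset.sum_eq_single 0]
  · rw [map_smul, slotL_tmul, Nat.sub_zero, ecoord_e, if_pos (by omega), one_smul,
      cgCoeff_zero hq, one_smul]
  · intro i hi hil
    rw [map_smul, slotL_tmul, ecoord_e, if_neg (by omega), zero_smul, smul_zero]
  · simp

/-- Both sides are highest weight vectors, so only the components along `ω_s` in the second factor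
need comparison. These are multiples of `(X⁻)^l ω_s`, known from `slotR_R`, `slotL_phi` and
`slotR_phi`, and `ξ_l` is their quotient. -/
lemma R_phi (hq : Generic h) {N l : ℕ} (hl : l ≤ N) :
    R N h (phi N h l) = xi N h l • phi N h l := by
  rw [← sub_eq_zero]
  refine (uqModule_V hq N).eq_zero_of_slotR hq ?_ ?_
  · change Xp2 N h _ = 0
    rw [map_sub, map_smul, ← Module.End.mul_apply, ← R_mul_Xp2 hq, Module.End.mul_apply,
      Xp2_phi hq hl, map_zero, smul_zero, sub_zero]
  · rw [map_sub, map_smul, slotR_R, slotL_phi, slotR_phi hq hl, qH_pow_apply (e_mem hq N l),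
      smul_smul, ← sub_smul, xi]
    have : qpow h (rho ((N : ℂ) - l) - 2 * rho (spin N)) * qpow h (l * (N - l + 1)) =
        qpow h (N * (((N - 2 * l : ℤ) : ℂ) / 2)) := by
      rw [← qpow_add, rho, rho, spin]
      push_cast
      ring_nf
    rw [show ∀ x : V N, ∀ c : ℂ, c = 0 → c • x = 0 from fun x c hc => by rw [hc, zero_smul]]
    linear_combination (-qpow h (rho ((N : ℂ) - l) - 2 * rho (spin N)) *
      qpow h (l * (N - l + 1))) * neg_one_pow_mul_self l - this

lemma commute_R_Xm2_pow (hq : Generic h) (N p : ℕ) : Commute (R N h) ((Xm2 N h) ^ p) :=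
  Commute.pow_right (R_mul_Xm2 hq N) p

lemma R_Xm2_pow_phi (hq : Generic h) {N l : ℕ} (hl : l ≤ N) (p : ℕ) :
    R N h (((Xm2 N h) ^ p) (phi N h l)) = xi N h l • ((Xm2 N h) ^ p) (phi N h l) := by
  rw [← Module.End.mul_apply, (commute_R_Xm2_pow hq N p).eq, Module.End.mul_apply, R_phi hq hl,
    map_smul]

lemma exists_eq_smul_e (hq : Generic h) {N l : ℕ} {x : V N}
    (hx : x ∈ wtSpace h (qH N h) (N - 2 * l)) : ∃ c : ℂ, x = c • e N h l := by
  refine ⟨ecoord hq N l x, ?_⟩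
  conv_lhs => rw [← sum_ecoord_smul hq x]
  have h0 : ∀ j, j ≠ l → ecoord hq N j x = 0 := by
    intro j hj
    have h1 := ecoord_qH hq N j x
    rw [mem_wtSpace.mp hx, map_smul, smul_eq_mul] at h1
    by_contra hne
    have := hq.qpow_half_injective (mul_right_cancel₀ hne h1)
    omega
  rcases Nat.lt_or_ge N l with hl | hl
  · rw [e_eq_zero hq hl, smul_zero]
    exact Finset.sum_eq_zero fun j hj => by
      rw [Finset.mem_range] at hj
      rw [h0 j (by omega), zero_smul]
  · refine Finset.sum_eq_single l (fun j _ hj => by rw [h0 j hj, zero_smul]) fun hc => ?_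
    exact absurd (Finset.mem_range.mpr (by omega)) hc

/-- The highest weight vectors of `V_s ⊗ V_s`. -/
lemma eq_smul_phi (hq : Generic h) {N l : ℕ} {x : V2 N}
    (hx : x ∈ wtSpace h (qH2 N h) (2 * N - 2 * l)) (hE : Xp2 N h x = 0) :
    (l ≤ N → ∃ c : ℂ, x = c • phi N h l) ∧ (N < l → x = 0) := by
  have hw : slotR (V N) (ecoord hq N 0) x ∈ wtSpace h (qH N h) (N - 2 * l) := by
    have h1 : ∀ z : V2 N, slotR (V N) (ecoord hq N 0) (qH2 N h z) =
        qpow h ((N : ℂ) / 2) • qH N h (slotR (V N) (ecoord hq N 0) z) := by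
      intro z
      induction z using TensorProduct.induction_on with
      | zero => simp
      | add x y hx hy => simp only [map_add, hx, hy, smul_add]
      | tmul x y =>
        rw [qH2, TensorProduct.map_tmul, slotR_tmul, slotR_tmul, ecoord_qH, map_smul, smul_smul]
        simp
    have h2 := h1 x
    rw [mem_wtSpace.mp hx, map_smul] at h2
    have h3 := congrArg (fun y => qpow h (-((N : ℂ) / 2)) • y) h2
    simp only [smul_smul, ← qpow_add, neg_add_cancel, qpow_zero, one_smul] at h3
    rw [mem_wtSpace, ← h3]
    push_cast
    ring_nf
  obtain ⟨c, hc⟩ := exists_eq_smul_e hq hw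
  refine ⟨fun hl => ⟨c * ((-1) ^ l * qpow h (l * (N - l + 1)))⁻¹, ?_⟩, fun hl => ?_⟩
  · rw [← sub_eq_zero]
    refine (uqModule_V hq N).eq_zero_of_slotR hq ?_ ?_
    · change Xp2 N h _ = 0
      rw [map_sub, map_smul, hE, Xp2_phi hq hl, smul_zero, sub_zero]
    · rw [map_sub, map_smul, hc, slotR_phi hq hl, smul_smul, mul_assoc, inv_mul_cancel₀, mul_one,
        sub_self]
      simp
  · refine (uqModule_V hq N).eq_zero_of_slotR hq hE ?_
    rw [hc, e_eq_zero hq hl, smul_zero]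

/-! ### Highest weight vectors of `U ⊗ V_s` and `V_s ⊗ U` -/

section Tensor

variable {M : Type} [AddCommGroup M] [Module ℂ M] {E F K Ki : Module.End ℂ M} {L : ℕ}

/-- The highest weight vector of `U ⊗ V_s` with the component `F ^ d x ⊗ ω_s`, for a highest weight
vector `x` of weight `(B + d) / 2`. -/
def hwTmulR (h : ℂ) (F : Module.End ℂ M) (N d B : ℕ) (x : M) : M ⊗[ℂ] V N :=
  ∑ m ∈ Finset.range (d + 1), cgCoeff h N d B (-(((N : ℂ) + B - d) / 2 + 1)) m •
    ((F ^ (d - m)) x ⊗ₜ[ℂ] e N h m)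

/-- The highest weight vector of `V_s ⊗ U` with the component `ω_s ⊗ F ^ d x`, for a highest weight
vector `x` of weight `(B + d) / 2`. -/
def hwTmulL (h : ℂ) (F : Module.End ℂ M) (N d B : ℕ) (x : M) : V N ⊗[ℂ] M :=
  ∑ m ∈ Finset.range (d + 1), cgCoeff h N d B (((N : ℂ) + B - d) / 2 + 1) m •
    (e N h m ⊗ₜ[ℂ] (F ^ (d - m)) x)

lemma hwTmulR_mem (hM : UqModule h E F K Ki L) (hq : Generic h) {N d B : ℕ} {x : M}
    (hx : x ∈ wtSpace h K (B + d)) :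
    hwTmulR h F N d B x ∈
      wtSpace h (TensorProduct.map K (qH N h) : Module.End ℂ (M ⊗[ℂ] V N)) (N + B - d) := by
  refine Submodule.sum_mem _ fun m hm => Submodule.smul_mem _ _ ?_
  have hm : m ≤ d := by simpa [Nat.lt_succ_iff] using hm
  rw [show (N + B - d : ℤ) = (B + d - 2 * (d - m : ℕ)) + (N - 2 * m) by
    rw [Nat.cast_sub hm]; ring]
  exact tmul_mem_wtSpace (hM.F_pow_mem hx _) (e_mem hq N m)

lemma hwTmulL_mem (hM : UqModule h E F K Ki L) (hq : Generic h) {N d B : ℕ} {x : M}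
    (hx : x ∈ wtSpace h K (B + d)) :
    hwTmulL h F N d B x ∈
      wtSpace h (TensorProduct.map (qH N h) K : Module.End ℂ (V N ⊗[ℂ] M)) (N + B - d) := by
  refine Submodule.sum_mem _ fun m hm => Submodule.smul_mem _ _ ?_
  have hm : m ≤ d := by simpa [Nat.lt_succ_iff] using hm
  rw [show (N + B - d : ℤ) = (N - 2 * m) + (B + d - 2 * (d - m : ℕ)) by
    rw [Nat.cast_sub hm]; ring]
  exact tmul_mem_wtSpace (e_mem hq N m) (hM.F_pow_mem hx _)

lemma coprodX_hwTmulR (hM : UqModule h E F K Ki L) (hq : Generic h) {N d B : ℕ} (hd : d ≤ N)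
    {x : M} (hx : x ∈ wtSpace h K (B + d)) (hE : E x = 0) :
    coprodX K E (Xp N h) (qHinv N h) (hwTmulR h F N d B x) = 0 := by
  have hV := uqModule_V hq N
  rw [hwTmulR, map_sum]
  simp only [map_smul, coprodX_tmul, smul_add]
  rw [Finset.sum_add_distrib, Finset.sum_range_succ, Finset.sum_range_succ', Nat.sub_self,
    pow_zero, Module.End.one_apply, hE, Xp_e_zero, TensorProduct.zero_tmul,
    TensorProduct.tmul_zero, smul_zero, smul_zero, add_zero, add_zero, ← Finset.sum_add_distrib]
  refine Finset.sum_eq_zero fun m hm => ?_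
  have hm : m < d := by simpa using hm
  obtain ⟨p, rfl⟩ : ∃ p, d = m + 1 + p := ⟨d - (m + 1), by omega⟩
  rw [show m + 1 + p - (m + 1) = p by omega, show m + 1 + p - m = p + 1 by omega,
    hM.E_F_pow_of_hw hq hx hE, Xp_e_succ hq, hV.Ki_apply (e_mem hq N m),
    mem_wtSpace.mp (hM.F_pow_mem hx p), TensorProduct.smul_tmul_smul,
    TensorProduct.smul_tmul_smul, smul_smul, smul_smul, ← add_smul]
  have key := cgCoeff_succ hq (N := N) (d := m + 1 + p) (B := B) (m := m)
    (-(((N : ℂ) + B - (m + 1 + p : ℕ)) / 2 + 1)) hm hd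
  set c := cgCoeff h N (m + 1 + p) B (-(((N : ℂ) + B - (m + 1 + p : ℕ)) / 2 + 1)) m
  set c' := cgCoeff h N (m + 1 + p) B (-(((N : ℂ) + B - (m + 1 + p : ℕ)) / 2 + 1)) (m + 1)
  push_cast at key ⊢
  rw [show (m : ℂ) + 1 + p - m = p + 1 by ring] at key
  rw [show (B : ℂ) + (m + 1 + p) - p = B + m + 1 by ring]
  have e1 : qpow h (-(((N : ℂ) + B - (m + 1 + p)) / 2 + 1)) *
      qpow h ((B + (m + 1 + p) - 2 * p) / 2) = qpow h (-((N - 2 * m) / 2)) := by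
    rw [← qpow_add]; ring_nf
  rw [show ∀ x : M ⊗[ℂ] V N, ∀ c : ℂ, c = 0 → c • x = 0 from fun x c hc => by rw [hc, zero_smul]]
  linear_combination qpow h ((B + (m + 1 + p) - 2 * p) / 2) * key -
    (qnum h ((p : ℂ) + 1) * qnum h ((B : ℂ) + m + 1) * c) * e1

lemma coprodX_hwTmulL (hM : UqModule h E F K Ki L) (hq : Generic h) {N d B : ℕ} (hd : d ≤ N)
    {x : M} (hx : x ∈ wtSpace h K (B + d)) (hE : E x = 0) :
    coprodX (qH N h) (Xp N h) E Ki (hwTmulL h F N d B x) = 0 := by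
  rw [hwTmulL, map_sum]
  simp only [map_smul, coprodX_tmul, smul_add]
  rw [Finset.sum_add_distrib, Finset.sum_range_succ', Finset.sum_range_succ
    (fun m => cgCoeff h N d B (((N : ℂ) + B - d) / 2 + 1) m •
      (qH N h (e N h m) ⊗ₜ[ℂ] E ((F ^ (d - m)) x))), Nat.sub_self,
    pow_zero, Module.End.one_apply, hE, Xp_e_zero, TensorProduct.zero_tmul,
    TensorProduct.tmul_zero, smul_zero, smul_zero, add_zero, add_zero, ← Finset.sum_add_distrib]
  refine Finset.sum_eq_zero fun m hm => ?_
  have hm : m < d := by simpa using hm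
  obtain ⟨p, rfl⟩ : ∃ p, d = m + 1 + p := ⟨d - (m + 1), by omega⟩
  rw [show m + 1 + p - (m + 1) = p by omega, show m + 1 + p - m = p + 1 by omega,
    hM.E_F_pow_of_hw hq hx hE, Xp_e_succ hq, mem_wtSpace.mp (e_mem hq N m),
    hM.Ki_apply (hM.F_pow_mem hx p), TensorProduct.smul_tmul_smul,
    TensorProduct.smul_tmul_smul, smul_smul, smul_smul, ← add_smul]
  have key := cgCoeff_succ hq (N := N) (d := m + 1 + p) (B := B) (m := m)
    (((N : ℂ) + B - (m + 1 + p : ℕ)) / 2 + 1) hm hd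
  set c := cgCoeff h N (m + 1 + p) B (((N : ℂ) + B - (m + 1 + p : ℕ)) / 2 + 1) m
  set c' := cgCoeff h N (m + 1 + p) B (((N : ℂ) + B - (m + 1 + p : ℕ)) / 2 + 1) (m + 1)
  push_cast at key ⊢
  rw [show (m : ℂ) + 1 + p - m = p + 1 by ring] at key
  rw [show (B : ℂ) + (m + 1 + p) - p = B + m + 1 by ring]
  have e1 : qpow h (((N : ℂ) + B - (m + 1 + p)) / 2 + 1) *
      qpow h (-((B + (m + 1 + p) - 2 * p) / 2)) = qpow h ((N - 2 * m) / 2) := by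
    rw [← qpow_add]; ring_nf
  rw [show ∀ x : V N ⊗[ℂ] M, ∀ c : ℂ, c = 0 → c • x = 0 from fun x c hc => by rw [hc, zero_smul]]
  linear_combination qpow h (-((B + (m + 1 + p) - 2 * p) / 2)) * key -
    (qnum h ((p : ℂ) + 1) * qnum h ((B : ℂ) + m + 1) * c) * e1

lemma slotR_hwTmulR (hq : Generic h) (N d B : ℕ) (x : M) :
    slotR M (ecoord hq N 0) (hwTmulR h F N d B x) = (F ^ d) x := by
  rw [hwTmulR, map_sum, Finset.sum_eq_single 0]
  · rw [map_smul, slotR_tmul, Nat.sub_zero, ecoord_e, if_pos (by omega), one_smul,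
      cgCoeff_zero hq, one_smul]
  · intro i hi hil
    rw [map_smul, slotR_tmul, ecoord_e, if_neg (by omega), zero_smul, smul_zero]
  · simp

lemma slotL_hwTmulL (hq : Generic h) (N d B : ℕ) (x : M) :
    slotL M (ecoord hq N 0) (hwTmulL h F N d B x) = (F ^ d) x := by
  rw [hwTmulL, map_sum, Finset.sum_eq_single 0]
  · rw [map_smul, slotL_tmul, Nat.sub_zero, ecoord_e, if_pos (by omega), one_smul,
      cgCoeff_zero hq, one_smul]
  · intro i hi hil
    rw [map_smul, slotL_tmul, ecoord_e, if_neg (by omega), zero_smul, smul_zero]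
  · simp

/-- A weight vector killed by `E ^ r` involves the descendants `F ^ p x` with `p < r` only. -/
lemma UqModule.exists_sum_of_E_pow (hM : UqModule h E F K Ki L) (hq : Generic h) {m : ℤ} {v : M}
    (hv : v ∈ wtSpace h K m) {r : ℕ} (hE : (E ^ r) v = 0) : ∃ x : ℕ → M,
      (∀ p : ℕ, x p ∈ wtSpace h K (m + 2 * p) ∧ E (x p) = 0) ∧
      v = ∑ p ∈ Finset.range r, (F ^ p) (x p) := by
  obtain ⟨r', x, hx, hsum⟩ := hM.exists_sum hq hv
  obtain ⟨d, hd⟩ : ∃ d, r' ≤ r + d := ⟨r', by omega⟩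
  induction d generalizing r' with
  | zero =>
    refine ⟨fun p => if p < r' then x p else 0, fun p => ?_, ?_⟩
    · dsimp only
      split_ifs
      · exact hx p
      · exact ⟨zero_mem _, map_zero _⟩
    · rw [hsum, ← Finset.sum_subset (Finset.range_mono (by omega : r' ≤ r))]
      · exact Finset.sum_congr rfl fun p hp => by simp only [if_pos (Finset.mem_range.mp hp)]
      · intro p _ hp
        rw [Finset.mem_range] at hp
        simp only [if_neg hp, map_zero]
  | succ d ih =>
    rcases Nat.lt_or_ge r r' with hlt | hge
    · obtain ⟨r', rfl⟩ : ∃ k, r' = k + 1 := ⟨r' - 1, by omega⟩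
      refine ih r' ?_ (by omega)
      rw [hsum, Finset.sum_range_succ, add_eq_left]
      -- The top term is shown to vanish. If `m + r' < 0`, then `r'` exceeds `m + 2r'` and `F ^ r'`
      -- kills the vector. Otherwise `E ^ r'` kills `v` and all lower terms, and multiplies `x r'`
      -- by a nonzero scalar.
      rcases lt_or_ge (m + r') 0 with hneg | hpos
      · rcases lt_or_ge (m + 2 * r') 0 with h2 | h2
        · rw [hM.hw_eq_zero_of_neg hq h2 (hx r').1 (hx r').2, map_zero]
        · obtain ⟨m', hm'⟩ := Int.eq_ofNat_of_zero_le h2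
          have hx1 := (hx r').1
          rw [hm'] at hx1
          exact hM.F_pow_eq_zero hq (by omega) hx1 (hx r').2
      · have h1 : (E ^ r') v = 0 := by
          rw [show r' = r' - r + r by omega, pow_add, Module.End.mul_apply, hE, map_zero]
        rw [hsum, Finset.sum_range_succ, map_add, map_sum, Finset.sum_eq_zero, zero_add] at h1
        · have h2 := hM.E_pow_F_pow hq (hx r').1 (hx r').2 0 r'
          rw [zero_add, h1, pow_zero, Module.End.one_apply] at h2
          rw [(smul_eq_zero.mp h2.symm).resolve_left
            (hq.hwCoeff_ne_zero fun i hi => by push_cast; omega), map_zero]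
        · intro p hp
          rw [Finset.mem_range] at hp
          have h2 := hM.E_pow_F_pow hq (hx p).1 (hx p).2 0 p
          rw [zero_add, pow_zero, Module.End.one_apply] at h2
          rw [show r' = r' - (p + 1) + 1 + p by omega, pow_add, Module.End.mul_apply, h2, map_smul,
            pow_succ, Module.End.mul_apply, (hx p).2, map_zero, smul_zero]
    · exact ih r' hsum (by omega)

end Tensor

/-! ### The operators on `V_s ⊗ V_s ⊗ V_s` -/

/-- The canonical map `V_s ⊗ (V_s ⊗ V_s) → (V_s ⊗ V_s) ⊗ V_s`. -/
def reassoc (N : ℕ) : V N ⊗[ℂ] V2 N →ₗ[ℂ] V3 N :=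
  (TensorProduct.assoc ℂ (V N) (V N) (V N)).symm.toLinearMap

lemma reassoc_tmul {N : ℕ} (x y z : V N) : reassoc N (x ⊗ₜ (y ⊗ₜ z)) = (x ⊗ₜ y) ⊗ₜ z := by
  simp [reassoc]

lemma exists_reassoc {N : ℕ} (ψ : V3 N) : ∃ z, reassoc N z = ψ :=
  (TensorProduct.assoc ℂ (V N) (V N) (V N)).symm.surjective ψ

lemma ext_right {N : ℕ} {M : Type*} [AddCommGroup M] [Module ℂ M] {f g : V N ⊗[ℂ] V2 N →ₗ[ℂ] M}
    (H : ∀ x y z, f (x ⊗ₜ (y ⊗ₜ z)) = g (x ⊗ₜ (y ⊗ₜ z))) : f = g := by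
  refine TensorProduct.ext (LinearMap.ext fun x => TensorProduct.ext' fun y z => ?_)
  exact H x y z

lemma R23_reassoc {N : ℕ} (z : V N ⊗[ℂ] V2 N) :
    R23 N h (reassoc N z) = reassoc N (LinearMap.lTensor (V N) (R N h) z) := by
  simp [R23, reassoc]

/-- Coassociativity, which allows vectors to be built in `V_s ⊗ (V_s ⊗ V_s)`. -/
lemma coprodX_reassoc {N : ℕ} (X : Module.End ℂ (V N)) (z : V N ⊗[ℂ] V2 N) :
    coprodX (qH2 N h) (coprodX (qH N h) X X (qHinv N h)) X (qHinv N h) (reassoc N z) =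
      reassoc N (coprodX (qH N h) X (coprodX (qH N h) X X (qHinv N h)) (qHinv2 N h) z) := by
  have : coprodX (qH2 N h) (coprodX (qH N h) X X (qHinv N h)) X (qHinv N h) ∘ₗ reassoc N =
      reassoc N ∘ₗ coprodX (qH N h) X (coprodX (qH N h) X X (qHinv N h)) (qHinv2 N h) := by
    refine ext_right (M := V3 N) fun x y z => ?_
    simp only [LinearMap.comp_apply, reassoc_tmul, coprodX_tmul, map_add, qH2, qHinv2,
      TensorProduct.map_tmul, TensorProduct.add_tmul, TensorProduct.tmul_add]
    abel
  exact congrArg (fun T => T z) this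

lemma qH3_reassoc {N : ℕ} (z : V N ⊗[ℂ] V2 N) :
    qH3 N h (reassoc N z) = reassoc N (TensorProduct.map (qH N h) (qH2 N h) z) := by
  have : qH3 N h ∘ₗ reassoc N = reassoc N ∘ₗ TensorProduct.map (qH N h) (qH2 N h) := by
    refine ext_right (M := V3 N) fun x y z => ?_
    simp only [LinearMap.comp_apply, reassoc_tmul, qH2, qH3, TensorProduct.map_tmul]
  exact congrArg (fun T => T z) this

section Commutation

variable {N : ℕ} {X : Module.End ℂ (V N)}

lemma R12_coprodX (hq : Generic h)
    (hX : R N h * coprodX (qH N h) X X (qHinv N h) = coprodX (qH N h) X X (qHinv N h) * R N h)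
    (ψ : V3 N) :
    R12 N h (coprodX (qH2 N h) (coprodX (qH N h) X X (qHinv N h)) X (qHinv N h) ψ) =
      coprodX (qH2 N h) (coprodX (qH N h) X X (qHinv N h)) X (qHinv N h) (R12 N h ψ) := by
  have h1 : ∀ z, R N h (coprodX (qH N h) X X (qHinv N h) z) =
      coprodX (qH N h) X X (qHinv N h) (R N h z) := fun z => congrArg (fun T => T z) hX
  have h2 : ∀ z, R N h (qH2 N h z) = qH2 N h (R N h z) := fun z =>
    congrArg (fun T => T z) (R_mul_qH2 hq N)
  induction ψ using TensorProduct.induction_on with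
  | zero => simp only [map_zero]
  | add x y hx hy => simp only [map_add, hx, hy]
  | tmul z y =>
    simp only [R12, coprodX_tmul, LinearMap.rTensor_tmul, map_add, h1, h2]

lemma R23_coprodX (hq : Generic h)
    (hX : R N h * coprodX (qH N h) X X (qHinv N h) = coprodX (qH N h) X X (qHinv N h) * R N h)
    (ψ : V3 N) :
    R23 N h (coprodX (qH2 N h) (coprodX (qH N h) X X (qHinv N h)) X (qHinv N h) ψ) =
      coprodX (qH2 N h) (coprodX (qH N h) X X (qHinv N h)) X (qHinv N h) (R23 N h ψ) := by
  have h1 : ∀ z, R N h (coprodX (qH N h) X X (qHinv N h) z) =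
      coprodX (qH N h) X X (qHinv N h) (R N h z) := fun z => congrArg (fun T => T z) hX
  have h2 : ∀ z, R N h (qHinv2 N h z) = qHinv2 N h (R N h z) := by
    have hM := uqModule_V2 hq N
    have : R N h * qHinv2 N h = qHinv2 N h * R N h := by
      calc R N h * qHinv2 N h = qHinv2 N h * (qH2 N h * R N h) * qHinv2 N h := by
            rw [← mul_assoc (qHinv2 N h), hM.Ki_mul_K, one_mul]
        _ = _ := by rw [← R_mul_qH2 hq, mul_assoc, mul_assoc, hM.K_mul_Ki, mul_one]
    exact fun z => congrArg (fun T => T z) this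
  obtain ⟨z, rfl⟩ := exists_reassoc ψ
  rw [R23_reassoc, coprodX_reassoc, coprodX_reassoc, R23_reassoc]
  congr 1
  induction z using TensorProduct.induction_on with
  | zero => simp only [map_zero]
  | add x y hx hy => simp only [map_add, hx, hy]
  | tmul z y =>
    simp only [coprodX_tmul, LinearMap.lTensor_tmul, map_add, h1, h2]

lemma R12_qH3 (hq : Generic h) (ψ : V3 N) : R12 N h (qH3 N h ψ) = qH3 N h (R12 N h ψ) := by
  have h2 : ∀ z, R N h (qH2 N h z) = qH2 N h (R N h z) := fun z =>
    congrArg (fun T => T z) (R_mul_qH2 hq N)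
  induction ψ using TensorProduct.induction_on with
  | zero => simp only [map_zero]
  | add x y hx hy => simp only [map_add, hx, hy]
  | tmul z y => simp only [R12, qH3, TensorProduct.map_tmul, LinearMap.rTensor_tmul, h2]

lemma R23_qH3 (hq : Generic h) (ψ : V3 N) : R23 N h (qH3 N h ψ) = qH3 N h (R23 N h ψ) := by
  have h2 : ∀ z, R N h (qH2 N h z) = qH2 N h (R N h z) := fun z =>
    congrArg (fun T => T z) (R_mul_qH2 hq N)
  obtain ⟨z, rfl⟩ := exists_reassoc ψ
  rw [R23_reassoc, qH3_reassoc, qH3_reassoc, R23_reassoc]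
  congr 1
  induction z using TensorProduct.induction_on with
  | zero => simp only [map_zero]
  | add x y hx hy => simp only [map_add, hx, hy]
  | tmul z y => simp only [TensorProduct.map_tmul, LinearMap.lTensor_tmul, h2]

end Commutation

lemma commute_R12_Xm3 (hq : Generic h) (N : ℕ) : Commute (R12 N h) (Xm3 N h) :=
  LinearMap.ext fun ψ => R12_coprodX hq (R_mul_Xm2 hq N) ψ

lemma commute_R23_Xm3 (hq : Generic h) (N : ℕ) : Commute (R23 N h) (Xm3 N h) :=
  LinearMap.ext fun ψ => R23_coprodX hq (R_mul_Xm2 hq N) ψ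

lemma mem_W {N n : ℕ} {ψ : V3 N} :
    ψ ∈ W N n h ↔ Xp3 N h ψ = 0 ∧ ψ ∈ wtSpace h (qH3 N h) (3 * N - 2 * n) := by
  rw [mem_wtSpace]
  change _ ∧ qH3 N h ψ = qpow h (3 * spin N - n) • ψ ↔ _
  rw [spin]
  push_cast
  rw [show (3 * ((N : ℂ) / 2) - n) = (3 * N - 2 * n) / 2 by ring]

lemma R12_mem_W (hq : Generic h) {N n : ℕ} {ψ : V3 N} (hψ : ψ ∈ W N n h) :
    R12 N h ψ ∈ W N n h := by
  rw [mem_W, mem_wtSpace] at *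
  refine ⟨?_, by rw [← R12_qH3 hq, hψ.2, map_smul]⟩
  have := R12_coprodX hq (R_mul_Xp2 hq N) ψ
  change R12 N h (Xp3 N h ψ) = Xp3 N h (R12 N h ψ) at this
  rw [← this, hψ.1, map_zero]

lemma R23_mem_W (hq : Generic h) {N n : ℕ} {ψ : V3 N} (hψ : ψ ∈ W N n h) :
    R23 N h ψ ∈ W N n h := by
  rw [mem_W, mem_wtSpace] at *
  refine ⟨?_, by rw [← R23_qH3 hq, hψ.2, map_smul]⟩
  have := R23_coprodX hq (R_mul_Xp2 hq N) ψ
  change R23 N h (Xp3 N h ψ) = Xp3 N h (R23 N h ψ) at this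
  rw [← this, hψ.1, map_zero]

/-! ### The two families of highest weight vectors of `V_s ⊗ V_s ⊗ V_s` -/

/-- The highest weight vector of `V_s ⊗ V_s ⊗ V_s` of weight `3s - n` in `U_k ⊗ V_s`, where `U_k` is
the submodule of `V_s ⊗ V_s` of highest weight `2s - k`. -/
def hwL (N n : ℕ) (h : ℂ) (k : ℕ) : V3 N :=
  hwTmulR h (Xm2 N h) N (n - k) (2 * N - k - n) (phi N h k)

/-- The highest weight vector of `V_s ⊗ V_s ⊗ V_s` of weight `3s - n` in `V_s ⊗ U_k`, where `U_k` is
the submodule of `V_s ⊗ V_s` of highest weight `2s - k`. -/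
def hwR (N n : ℕ) (h : ℂ) (k : ℕ) : V3 N :=
  reassoc N (hwTmulL h (Xm2 N h) N (n - k) (2 * N - k - n) (phi N h k))

section Vectors

variable {N n k : ℕ}

lemma phi_mem' (hq : Generic h) (hk : k ∈ Finset.Icc (n - N) (min n (2 * N - n))) :
    phi N h k ∈ wtSpace h (qH2 N h) ((2 * N - k - n : ℕ) + (n - k : ℕ)) := by
  rw [mem_Idx] at hk
  convert phi_mem hq N k using 1
  congr 1
  omega

lemma hwL_mem (hq : Generic h) (hk : k ∈ Finset.Icc (n - N) (min n (2 * N - n))) :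
    hwL N n h k ∈ W N n h := by
  have hw := hwTmulR_mem (uqModule_V2 hq N) hq (N := N) (phi_mem' hq hk)
  have hX := fun hd => coprodX_hwTmulR (uqModule_V2 hq N) hq (N := N) hd (phi_mem' hq hk)
  rw [mem_Idx] at hk
  refine mem_W.mpr ⟨hX (by omega) (Xp2_phi hq (by omega)), ?_⟩
  rwa [show (N + (2 * N - k - n : ℕ) - (n - k : ℕ) : ℤ) = 3 * N - 2 * n by omega] at hw

lemma hwR_mem (hq : Generic h) (hk : k ∈ Finset.Icc (n - N) (min n (2 * N - n))) :
    hwR N n h k ∈ W N n h := by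
  have hw := hwTmulL_mem (uqModule_V2 hq N) hq (N := N) (phi_mem' hq hk)
  have hX := fun hd => coprodX_hwTmulL (uqModule_V2 hq N) hq (N := N) hd (phi_mem' hq hk)
  rw [mem_Idx] at hk
  refine mem_W.mpr ⟨?_, ?_⟩
  · rw [hwR, Xp3, coprodX_reassoc]
    exact (congrArg (reassoc N) (hX (by omega) (Xp2_phi hq (by omega)))).trans (map_zero _)
  · rw [show (N + (2 * N - k - n : ℕ) - (n - k : ℕ) : ℤ) = 3 * N - 2 * n by omega,
      mem_wtSpace] at hw
    rw [mem_wtSpace, hwR, qH3_reassoc, hw, map_smul]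

lemma R12_hwL (hq : Generic h) (hk : k ≤ N) : R12 N h (hwL N n h k) = xi N h k • hwL N n h k := by
  rw [hwL, hwTmulR, map_sum, Finset.smul_sum]
  refine Finset.sum_congr rfl fun m _ => ?_
  rw [map_smul, R12, LinearMap.rTensor_tmul, R_Xm2_pow_phi hq hk, ← TensorProduct.smul_tmul',
    smul_comm]

lemma R23_hwR (hq : Generic h) (hk : k ≤ N) : R23 N h (hwR N n h k) = xi N h k • hwR N n h k := by
  rw [hwR, R23_reassoc, ← map_smul]
  congr 1
  rw [hwTmulL, map_sum, Finset.smul_sum]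
  refine Finset.sum_congr rfl fun m _ => ?_
  rw [map_smul, LinearMap.lTensor_tmul, R_Xm2_pow_phi hq hk, smul_comm,
    TensorProduct.tmul_smul]

end Vectors

/-! ### Components along `ω_s` of one of the three factors -/

/-- The component along `ω_s` in the first factor. -/
def topL (hq : Generic h) (N : ℕ) : V3 N →ₗ[ℂ] V2 N :=
  LinearMap.rTensor (V N) (slotL (V N) (ecoord hq N 0))

/-- The component along `ω_s` in the second factor. -/
def topM (hq : Generic h) (N : ℕ) : V3 N →ₗ[ℂ] V2 N :=
  LinearMap.rTensor (V N) (slotR (V N) (ecoord hq N 0))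

/-- The component along `ω_s` in the third factor. -/
def topR (hq : Generic h) (N : ℕ) : V3 N →ₗ[ℂ] V2 N := slotR (V2 N) (ecoord hq N 0)

lemma topL_reassoc (hq : Generic h) {N : ℕ} (z : V N ⊗[ℂ] V2 N) :
    topL hq N (reassoc N z) = slotL (V2 N) (ecoord hq N 0) z := by
  have : topL hq N ∘ₗ reassoc N = slotL (V2 N) (ecoord hq N 0) := by
    refine ext_right fun x y z => ?_
    rw [LinearMap.comp_apply, reassoc_tmul, topL, LinearMap.rTensor_tmul, slotL_tmul, slotL_tmul,
      TensorProduct.smul_tmul']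
  exact congrArg (fun T => T z) this

lemma topM_reassoc (hq : Generic h) {N : ℕ} (z : V N ⊗[ℂ] V2 N) :
    topM hq N (reassoc N z) = LinearMap.lTensor (V N) (slotL (V N) (ecoord hq N 0)) z := by
  have : topM hq N ∘ₗ reassoc N = LinearMap.lTensor (V N) (slotL (V N) (ecoord hq N 0)) := by
    refine ext_right fun x y z => ?_
    rw [LinearMap.comp_apply, reassoc_tmul, topM, LinearMap.rTensor_tmul, LinearMap.lTensor_tmul,
      slotR_tmul, slotL_tmul, TensorProduct.smul_tmul]
  exact congrArg (fun T => T z) this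

lemma topR_reassoc (hq : Generic h) {N : ℕ} (z : V N ⊗[ℂ] V2 N) :
    topR hq N (reassoc N z) = LinearMap.lTensor (V N) (slotR (V N) (ecoord hq N 0)) z := by
  have : topR hq N ∘ₗ reassoc N = LinearMap.lTensor (V N) (slotR (V N) (ecoord hq N 0)) := by
    refine ext_right fun x y z => ?_
    rw [LinearMap.comp_apply, reassoc_tmul, topR, LinearMap.lTensor_tmul, slotR_tmul, slotR_tmul,
      TensorProduct.tmul_smul]
  exact congrArg (fun T => T z) this

lemma topR_R12 (hq : Generic h) {N : ℕ} (ψ : V3 N) :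
    topR hq N (R12 N h ψ) = R N h (topR hq N ψ) := by
  induction ψ using TensorProduct.induction_on with
  | zero => simp only [map_zero]
  | add x y hx hy => simp only [map_add, hx, hy]
  | tmul z y => rw [R12, LinearMap.rTensor_tmul, topR, slotR_tmul, slotR_tmul, map_smul]

lemma topM_R12 (hq : Generic h) {N : ℕ} (ψ : V3 N) :
    topM hq N (R12 N h ψ) = LinearMap.rTensor (V N) ((qH N h) ^ N) (topL hq N ψ) := by
  induction ψ using TensorProduct.induction_on with
  | zero => simp only [map_zero]
  | add x y hx hy => simp only [map_add, hx, hy]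
  | tmul z y =>
    rw [R12, LinearMap.rTensor_tmul, topM, topL, LinearMap.rTensor_tmul, LinearMap.rTensor_tmul,
      LinearMap.rTensor_tmul, slotR_R]

lemma topR_R23 (hq : Generic h) {N : ℕ} (ψ : V3 N) :
    topR hq N (R23 N h ψ) = LinearMap.lTensor (V N) ((qH N h) ^ N) (topM hq N ψ) := by
  obtain ⟨z, rfl⟩ := exists_reassoc ψ
  rw [R23_reassoc, topR_reassoc, topM_reassoc]
  induction z using TensorProduct.induction_on with
  | zero => simp only [map_zero]
  | add x y hx hy => simp only [map_add, hx, hy]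
  | tmul z y =>
    rw [LinearMap.lTensor_tmul, LinearMap.lTensor_tmul, LinearMap.lTensor_tmul,
      LinearMap.lTensor_tmul, slotR_R]

/-- `R₁₂` moves the `ω_s`-component from the first factor to the second, `R₂₃` from there to the
third. Each of the other two factors picks up `q^{2sH}` once. -/
lemma topR_R23_R12 (hq : Generic h) {N : ℕ} (ψ : V3 N) :
    topR hq N (R23 N h (R12 N h ψ)) = ((qH2 N h) ^ N) (topL hq N ψ) := by
  rw [topR_R23, topM_R12, qH2, tensorMap_pow]
  generalize topL hq N ψ = z
  induction z using TensorProduct.induction_on with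
  | zero => simp only [map_zero]
  | add x y hx hy => simp only [map_add, hx, hy]
  | tmul z y => rw [LinearMap.rTensor_tmul, LinearMap.lTensor_tmul, TensorProduct.map_tmul]

lemma topR_hwL (hq : Generic h) (N n k : ℕ) :
    topR hq N (hwL N n h k) = ((Xm2 N h) ^ (n - k)) (phi N h k) :=
  slotR_hwTmulR hq _ _ _ _

lemma topL_hwR (hq : Generic h) (N n k : ℕ) :
    topL hq N (hwR N n h k) = ((Xm2 N h) ^ (n - k)) (phi N h k) := by
  rw [hwR, topL_reassoc, slotL_hwTmulL]

lemma eq_of_topR_eq (hq : Generic h) {N n : ℕ} {ψ ψ' : V3 N} (hψ : ψ ∈ W N n h)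
    (hψ' : ψ' ∈ W N n h) (H : topR hq N ψ = topR hq N ψ') : ψ = ψ' := by
  have hsub : Xp3 N h (ψ - ψ') = 0 := by
    rw [map_sub, (mem_W.mp hψ).1, (mem_W.mp hψ').1, sub_self]
  rw [← sub_eq_zero]
  refine (uqModule_V2 hq N).eq_zero_of_slotR hq hsub ?_
  change topR hq N (ψ - ψ') = 0
  rw [map_sub, H, sub_self]

/-- The operator `R₁₂ R₂₃ R₁₂` maps the one family of highest weight vectors to the other one. -/
lemma braid_hwR (hq : Generic h) {N n k : ℕ}
    (hk : k ∈ Finset.Icc (n - N) (min n (2 * N - n))) :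
    R12 N h (R23 N h (R12 N h (hwR N n h k))) =
      (qpow h (N * (N - n)) * xi N h k) • hwL N n h k := by
  have hR := hwR_mem hq hk
  have hL := hwL_mem hq hk
  have hw := (uqModule_V2 hq N).F_pow_mem (phi_mem hq N k) (n - k)
  rw [mem_Idx] at hk
  refine eq_of_topR_eq hq (R12_mem_W hq (R23_mem_W hq (R12_mem_W hq hR)))
    (Submodule.smul_mem _ _ hL) ?_
  -- The component of `hwR` along `ω_s` on the left equals that of `hwL` on the right. Its weight is
  -- `N - n`, whence the power `q^{N(N-n)}`; the last `R₁₂` acts by `ξ_k`.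
  rw [topR_R12, topR_R23_R12, topL_hwR, map_smul, topR_hwL, qH_pow_apply hw, map_smul,
    R_Xm2_pow_phi hq (by omega), smul_smul, Nat.cast_sub hk.2.1]
  push_cast
  ring_nf

/-! ### Coordinates of the highest weight vectors -/

/-- The coordinate of a vector of `V_s ⊗ V_s ⊗ V_s` at `(X⁻)^i ω_s ⊗ ω_s ⊗ (X⁻)^(n - i) ω_s`. -/
def midCoord (hq : Generic h) (N n i : ℕ) : V3 N →ₗ[ℂ] ℂ :=
  ecoord hq N i ∘ₗ slotR (V N) (ecoord hq N (n - i)) ∘ₗ topM hq N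

/-- The factor of the coordinates of `hwL N n h k` that depends on `k`. -/
def leftFactor (h : ℂ) (N n k : ℕ) : ℂ :=
  (-1) ^ (k + n) * qpow h (k * (N - k + 1) + N / 2 * k - n * (3 * (N / 2) - n + 1)) *
    (qfact h (n - k) / (qfact h (2 * N - k - n) * qfact h N))

/-- The factor of the coordinates of `hwR N n h k` that depends on `k`. -/
def rightFactor (h : ℂ) (N n k : ℕ) : ℂ :=
  qpow h (N / 2 * n - N / 2 * k) * (qfact h (n - k) / (qfact h (2 * N - k - n) * qfact h N))

/-- The factor of the coordinates that depends on the coordinate. -/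
def midFactor (h : ℂ) (N n i : ℕ) : ℂ :=
  (-1) ^ i * qpow h (i * (N - n + 1)) * (qfact h (N + i - n) / qfact h (n - i))

lemma Generic.leftFactor_ne_zero (hq : Generic h) (N n k : ℕ) : leftFactor h N n k ≠ 0 := by
  have n := hq.qfact_ne_zero
  simp [leftFactor, qpow_ne_zero, n]

lemma Generic.rightFactor_ne_zero (hq : Generic h) (N n k : ℕ) : rightFactor h N n k ≠ 0 := by
  have n := hq.qfact_ne_zero
  simp [rightFactor, qpow_ne_zero, n]

lemma Generic.midFactor_ne_zero (hq : Generic h) (N n i : ℕ) : midFactor h N n i ≠ 0 := by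
  have n := hq.qfact_ne_zero
  simp [midFactor, qpow_ne_zero, n]

section Coordinates

variable {N n k i : ℕ}

/-- With `ω_s` in the middle only the term `m = n - i` survives, and of `phi` only the component
along `ω_s` on the right enters. So the coordinate is a single product. -/
lemma midCoord_hwL (hq : Generic h) (hk : k ∈ Finset.Icc (n - N) (min n (2 * N - n)))
    (hi : i ∈ Finset.Icc (n - N) (min n (2 * N - n))) :
    midCoord hq N n i (hwL N n h k) = leftFactor h N n k * midFactor h N n i * triG h N k i := by
  rw [mem_Idx] at hk hi
  have hterm : ∀ m ≤ n - k, midCoord hq N n i (((Xm2 N h) ^ (n - k - m)) (phi N h k) ⊗ₜ e N h m) =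
      if m = n - i then qpow h ((n - k - m : ℕ) * -((N : ℂ) / 2)) *
        ((-1) ^ k * qpow h (k * (N - k + 1))) else 0 := by
    intro m hm
    rw [midCoord, LinearMap.comp_apply, LinearMap.comp_apply, topM, LinearMap.rTensor_tmul,
      slotR_tmul, map_smul, ecoord_e, slotR_Xm2_pow, slotR_phi hq (by omega), map_smul, map_smul,
      Xm_pow_e, map_smul, ecoord_e]
    by_cases hmi : m = n - i
    · rw [if_pos (by omega), if_pos (by omega), if_pos hmi]
      simp
    · rw [if_neg (by omega), if_neg hmi, zero_smul]
  rw [hwL, hwTmulR, map_sum, triG]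
  split_ifs with hki
  · rw [Finset.sum_eq_single (n - i), map_smul, hterm _ (by omega), if_pos rfl, cgCoeff]
    · obtain ⟨p, rfl⟩ : ∃ p, n = i + p := ⟨n - i, by omega⟩
      obtain ⟨r, rfl⟩ : ∃ r, i = k + r := ⟨i - k, by omega⟩
      obtain ⟨a, ha⟩ : ∃ a, 2 * N = k + r + p + k + a := ⟨2 * N - (k + r + p + k), by omega⟩
      obtain ⟨b, rfl⟩ : ∃ b, N = p + b := ⟨N - p, by omega⟩
      have hac : (2 * (p + b) : ℂ) = k + r + p + k + a := by exact_mod_cast ha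
      simp only [show k + r + p - (k + r) = p by omega, show k + r + p - k = r + p by omega,
        show 2 * (p + b) - k - (k + r + p) = a by omega, show r + p - p = r by omega,
        show p + b - p = b by omega, leftFactor, midFactor, show p + b + (k + r) - (k + r + p) = b
          by omega, show k + r - k = r by omega, show 2 * (p + b) - k - (k + r) = a + p by omega]
      have hs : (-1 : ℂ) ^ (k + (k + r + p)) * (-1) ^ (k + r) = (-1) ^ p * (-1) ^ k := by
        have h1 := neg_one_pow_mul_self k
        have h2 := neg_one_pow_mul_self r
        simp only [pow_add]
        linear_combination ((-1 : ℂ) ^ p * (-1) ^ k) * ((-1) ^ r * (-1) ^ r * h1 + h2)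
      have hp : qpow h (p * -((((p + b : ℕ) : ℂ) + a - (r + p : ℕ)) / 2 + 1)) *
          qpow h (r * -(((p + b : ℕ) : ℂ) / 2)) * qpow h (k * ((p + b : ℕ) - k + 1)) =
          qpow h (k * ((p + b : ℕ) - k + 1) + (p + b : ℕ) / 2 * k -
            (k + r + p : ℕ) * (3 * ((p + b : ℕ) / 2) - (k + r + p : ℕ) + 1)) *
          qpow h ((k + r : ℕ) * ((p + b : ℕ) - (k + r + p : ℕ) + 1)) := by
        rw [← qpow_add, ← qpow_add, ← qpow_add]
        congr 1
        push_cast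
        linear_combination (p : ℂ) / 2 * hac
      have n := hq.qfact_ne_zero
      have n1 := n r
      have n2 := n a
      have n3 := n p
      have n4 := n (p + b)
      rw [smul_eq_mul]
      field_simp
      linear_combination (norm := ring_nf) qfact h (r + p) * qfact h (a + p) * qfact h b *
        (((-1) ^ p * (-1) ^ k) * hp - qpow h (k * ((p + b : ℕ) - k + 1) + (p + b : ℕ) / 2 * k -
            (k + r + p : ℕ) * (3 * ((p + b : ℕ) / 2) - (k + r + p : ℕ) + 1)) *
          qpow h ((k + r : ℕ) * ((p + b : ℕ) - (k + r + p : ℕ) + 1)) * hs)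
    · intro m hm hmi
      rw [map_smul, hterm m (by simpa [Nat.lt_succ_iff] using hm), if_neg hmi, smul_zero]
    · intro hc
      exact absurd (Finset.mem_range.mpr (by omega)) hc
  · rw [mul_zero]
    refine Finset.sum_eq_zero fun m hm => ?_
    have hm : m ≤ n - k := by simpa [Nat.lt_succ_iff] using hm
    rw [map_smul, hterm m hm, if_neg (by omega), smul_zero]

/-- Here only the term `m = i` survives, and of `phi` only the component along `ω_s` on the left
enters. -/
lemma midCoord_hwR (hq : Generic h) (hk : k ∈ Finset.Icc (n - N) (min n (2 * N - n)))
    (hi : i ∈ Finset.Icc (n - N) (min n (2 * N - n))) :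
    midCoord hq N n i (hwR N n h k) =
      rightFactor h N n k * midFactor h N n i * midH h N n k i := by
  rw [mem_Idx] at hk hi
  have hterm : ∀ m ≤ n - k, midCoord hq N n i
      (reassoc N (e N h m ⊗ₜ ((Xm2 N h) ^ (n - k - m)) (phi N h k))) =
      if m = i then qpow h ((n - k - m : ℕ) * ((N : ℂ) / 2)) else 0 := by
    intro m hm
    rw [midCoord, LinearMap.comp_apply, LinearMap.comp_apply, topM_reassoc, LinearMap.lTensor_tmul,
      slotR_tmul, map_smul, ecoord_e, slotL_Xm2_pow, slotL_phi, map_smul, Xm_pow_e, ecoord_e]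
    by_cases hmi : m = i
    · rw [if_pos (by omega), if_pos (by omega), if_pos hmi]
      simp
    · rw [if_neg (c := m = i ∧ m ≤ N) (by omega), if_neg hmi, smul_zero]
  rw [hwR, hwTmulL, map_sum, map_sum, midH]
  split_ifs with hki
  · rw [Finset.sum_eq_single i, map_smul, map_smul, hterm _ (by omega), if_pos rfl, cgCoeff]
    · obtain ⟨d, rfl⟩ : ∃ d, n = i + k + d := ⟨n - (i + k), by omega⟩
      obtain ⟨a, ha⟩ : ∃ a, 2 * N = i + k + d + k + a := ⟨2 * N - (i + k + d + k), by omega⟩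
      have hac : (2 * N : ℂ) = i + k + d + k + a := by exact_mod_cast ha
      simp only [show i + k + d - k = i + d by omega, show i + k + d - i = k + d by omega,
        show 2 * N - k - (i + k + d) = a by omega, show i + d - i = d by omega,
        rightFactor, midFactor, show k + d - k = d by omega]
      have hp : qpow h (i * (((N : ℂ) + a - (i + d : ℕ)) / 2 + 1)) * qpow h (d * ((N : ℂ) / 2)) =
          qpow h ((N : ℂ) / 2 * (i + k + d : ℕ) - N / 2 * k) *
            qpow h (i * (N - (i + k + d : ℕ) + 1)) := by
        rw [← qpow_add, ← qpow_add]
        congr 1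
        push_cast
        linear_combination -(i : ℂ) / 2 * hac
      have n := hq.qfact_ne_zero
      have n1 := n d
      have n2 := n a
      have n3 := n i
      have n4 := n N
      have n5 := n (k + d)
      have n6 := n (N + i - (i + k + d))
      rw [smul_eq_mul]
      field_simp
      linear_combination (norm := ring_nf) qfact h (i + d) * qfact h (a + i) * qfact h (N - i) * hp
    · intro m hm hmi
      rw [map_smul, map_smul, hterm m (by simpa [Nat.lt_succ_iff] using hm), if_neg hmi, smul_zero]
    · intro hc
      exact absurd (Finset.mem_range.mpr (by omega)) hc
  · rw [mul_zero]
    refine Finset.sum_eq_zero fun m hm => ?_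
    have hm : m ≤ n - k := by simpa [Nat.lt_succ_iff] using hm
    rw [map_smul, map_smul, hterm m hm, if_neg (by omega), smul_zero]

end Coordinates

/-! ### A basis of the space of highest weight vectors -/

lemma topR_mem (hq : Generic h) {N : ℕ} {m : ℤ} {ψ : V3 N} (hψ : ψ ∈ wtSpace h (qH3 N h) m) :
    topR hq N ψ ∈ wtSpace h (qH2 N h) (m - N) := by
  have h1 : ∀ ψ : V3 N, topR hq N (qH3 N h ψ) = qpow h ((N : ℂ) / 2) • qH2 N h (topR hq N ψ) := by
    intro ψ
    induction ψ using TensorProduct.induction_on with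
    | zero => simp only [map_zero, smul_zero]
    | add x y hx hy => simp only [map_add, hx, hy, smul_add]
    | tmul x y =>
      rw [qH3, TensorProduct.map_tmul, topR, slotR_tmul, slotR_tmul, ecoord_qH, map_smul, smul_smul]
      simp
  have h2 := h1 ψ
  rw [mem_wtSpace.mp hψ, map_smul] at h2
  have h3 := congrArg (fun y => qpow h (-((N : ℂ) / 2)) • y) h2
  simp only [smul_smul, ← qpow_add, neg_add_cancel, qpow_zero, one_smul] at h3
  rw [mem_wtSpace, ← h3]
  push_cast
  ring_nf

/-- The component of `ψ` along `ω_s` in the last factor determines `ψ`. It is a sum of multiples of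
`(X⁻)^p phi_{n-p}` with `p ≤ N`, and the nonzero ones have `p ≤ 2N - 2(n - p)`. For `k = n - p ≤ n`
these bounds describe the index set, and each term is the component of a vector `hwL`. -/
lemma mem_span_hwL (hq : Generic h) {N n : ℕ} {ψ : V3 N} (hψ : ψ ∈ W N n h) :
    ψ ∈ Submodule.span ℂ (Set.range fun k : Idx N n => hwL N n h k) := by
  have hM := uqModule_V2 hq N
  have hv := topR_mem hq (mem_W.mp hψ).2
  rw [show (3 * N - 2 * n - N : ℤ) = 2 * N - 2 * n by ring] at hv
  have hE : ((Xp2 N h) ^ (N + 1)) (topR hq N ψ) = 0 := hM.E_pow_slotR hq (mem_W.mp hψ).1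
  obtain ⟨x, hx, hsum⟩ := hM.exists_sum_of_E_pow hq hv hE
  have hmem : topR hq N ψ ∈
      (Submodule.span ℂ (Set.range fun k : Idx N n => hwL N n h k)).map (topR hq N) := by
    rw [hsum]
    refine Submodule.sum_mem _ fun p hp => ?_
    rw [Finset.mem_range] at hp
    rcases Nat.lt_or_ge n p with hnp | hnp
    · rw [hM.eq_zero_of_lt hq (m := 2 * N - 2 * n + 2 * p)
        (by rw [lt_abs]; left; push_cast; omega) (hx p).1, map_zero]
      exact zero_mem _
    · obtain ⟨l, rfl⟩ : ∃ l, n = l + p := ⟨n - p, by omega⟩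
      have hxp := (hx p).1
      rw [show (2 * N - 2 * (l + p : ℕ) + 2 * p : ℤ) = 2 * N - 2 * l by push_cast; ring] at hxp
      have hphi := eq_smul_phi hq hxp (hx p).2
      rcases Nat.lt_or_ge N l with hl | hl
      · rw [hphi.2 hl, map_zero]
        exact zero_mem _
      · obtain ⟨c, hc⟩ := hphi.1 hl
        rcases Nat.lt_or_ge (2 * N - 2 * l) p with hlp | hlp
        · rw [hM.F_pow_eq_zero hq hlp (by convert hxp using 1; congr 1; omega) (hx p).2]
          exact zero_mem _
        · have hlI : l ∈ Finset.Icc (l + p - N) (min (l + p) (2 * N - (l + p))) := by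
            rw [mem_Idx]; omega
          refine ⟨c • hwL N (l + p) h l, Submodule.smul_mem _ _
            (Submodule.subset_span ⟨⟨l, hlI⟩, rfl⟩), ?_⟩
          rw [map_smul, topR_hwL, Nat.add_sub_cancel_left, hc, map_smul]
  obtain ⟨ψ', hψ', heq⟩ := hmem
  have hle : Submodule.span ℂ (Set.range fun k : Idx N n => hwL N n h k) ≤ W N n h := by
    rw [Submodule.span_le]
    rintro _ ⟨k, rfl⟩
    exact hwL_mem hq k.2
  rwa [eq_of_topR_eq hq hψ (hle hψ') heq.symm]

/-- The coordinate at `hwL N n h l`. -/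
lemma eq_sum_midCoord (hq : Generic h) {N n : ℕ} (c : Idx N n → ℂ) (l : Idx N n) :
    ∑ i : Idx N n, midCoord hq N n i (∑ k, c k • hwL N n h k) * (midFactor h N n i)⁻¹ *
      triGinv h N i l = leftFactor h N n l * c l := by
  have h1 : ∀ i : Idx N n, midCoord hq N n i (∑ k, c k • hwL N n h k) * (midFactor h N n i)⁻¹ *
      triGinv h N i l =
      ∑ k : Idx N n, c k * leftFactor h N n k * (triG h N k i * triGinv h N i l) := by
    intro i
    rw [map_sum, Finset.sum_mul, Finset.sum_mul]
    refine Finset.sum_congr rfl fun k _ => ?_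
    have := hq.midFactor_ne_zero N n i
    rw [map_smul, smul_eq_mul, midCoord_hwL hq k.2 i.2]
    field_simp
  have h2 : ∀ k : Idx N n, ∑ i : Idx N n, triG h N k i * triGinv h N i l =
      if (k : ℕ) = l then 1 else 0 := by
    intro k
    rw [← hq.sum_triG_mul_triGinv (N := N) (hi := min n (2 * N - n)) (by omega) k.2 l.2]
    exact Finset.sum_coe_sort (Finset.Icc (n - N) (min n (2 * N - n)))
      (fun i => triG h N k i * triGinv h N i l)
  simp only [h1]
  rw [Finset.sum_comm]
  simp only [← Finset.mul_sum, h2]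
  rw [Finset.sum_eq_single l]
  · simp [mul_comm]
  · intro k _ hk
    rw [if_neg fun hc => hk (Subtype.ext hc), mul_zero]
  · simp

lemma hwL_linearIndependent (hq : Generic h) (N n : ℕ) :
    LinearIndependent ℂ fun k : Idx N n => hwL N n h k := by
  rw [Fintype.linearIndependent_iffₛ]
  intro c c' hc l
  have h1 := eq_sum_midCoord hq c l
  rw [hc, eq_sum_midCoord hq c' l] at h1
  exact (mul_left_cancel₀ (hq.leftFactor_ne_zero N n l) h1).symm

/-- The basis of the space of highest weight vectors that consists of multiples of the vectors
`hwL N n h k`. -/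
lemma exists_basis_W (hq : Generic h) (N n : ℕ) {a : Idx N n → ℂ} (ha : ∀ k, a k ≠ 0) :
    ∃ b : Module.Basis (Idx N n) ℂ (W N n h), ∀ k, (b k : V3 N) = a k • hwL N n h k := by
  let v : Idx N n → W N n h := fun k => ⟨a k • hwL N n h k, Submodule.smul_mem _ _ (hwL_mem hq k.2)⟩
  have hli : LinearIndependent ℂ v := by
    refine LinearIndependent.of_comp (W N n h).subtype ?_
    exact (hwL_linearIndependent hq N n).units_smul (fun k => Units.mk0 (a k) (ha k))
  refine ⟨Module.Basis.mk hli ?_, fun k => by rw [Module.Basis.mk_apply]⟩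
  rintro ⟨ψ, hψ⟩ -
  obtain ⟨c, hc⟩ := (Submodule.mem_span_range_iff_exists_fun ℂ).mp (mem_span_hwL hq hψ)
  rw [Submodule.mem_span_range_iff_exists_fun]
  refine ⟨fun k => c k * (a k)⁻¹, Subtype.ext ?_⟩
  refine (Submodule.coe_sum _ _ _).trans (Eq.trans ?_ hc)
  refine Finset.sum_congr rfl fun k _ => ?_
  rw [Submodule.coe_smul, smul_smul, mul_assoc, inv_mul_cancel₀ (ha k), mul_one]

/-! ### The matrices of the braid group generators -/

lemma sum_midCoord_hwR (hq : Generic h) {N n : ℕ} (hn : 2 * n ≤ 3 * N) (k l : Idx N n) :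
    ∑ i : Idx N n, midCoord hq N n i (hwR N n h k) * (midFactor h N n i)⁻¹ * triGinv h N i l =
      rightFactor h N n k *
        ((-1) ^ (N + n) * rowFactor h N n l * colFactor h N n k * racahSum h N n l k) := by
  rw [← hq.sum_midH_mul_triGinv hn k.2 l.2, ← Finset.sum_coe_sort (Finset.Icc (n - N)
    (min n (2 * N - n))), Finset.mul_sum]
  refine Finset.sum_congr rfl fun i _ => ?_
  have := hq.midFactor_ne_zero N n i
  rw [midCoord_hwR hq k.2 i.2]
  field_simp

/-- The scalar that normalizes `hwL N n h k`. -/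
def leftNorm (h : ℂ) (N n k : ℕ) : ℂ :=
  normFactor h N n k / (leftFactor h N n k * colFactor h N n k)

/-- The scalar that normalizes `hwR N n h k`. -/
def rightNorm (h : ℂ) (N n k : ℕ) : ℂ :=
  normFactor h N n k / (rightFactor h N n k * colFactor h N n k)

/-- The coefficients of `hwR` with respect to `hwL` are read off by `eq_sum_midCoord`. By
`normFactor_sq`, the two normalizations turn them into the entries of `A`. -/
lemma smul_hwR (hq : Generic h) {N n : ℕ} (hn : 2 * n ≤ 3 * N) (k : Idx N n) :
    rightNorm h N n k • hwR N n h k =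
      ∑ l : Idx N n, A N n h l k • leftNorm h N n l • hwL N n h l := by
  obtain ⟨c, hc⟩ := (Submodule.mem_span_range_iff_exists_fun ℂ).mp
    (mem_span_hwL hq (hwR_mem hq k.2))
  rw [← hc, Finset.smul_sum]
  refine Finset.sum_congr rfl fun l _ => ?_
  have h1 := eq_sum_midCoord hq c l
  rw [hc, sum_midCoord_hwR hq hn] at h1
  rw [smul_smul, smul_smul, A_apply hn, leftNorm, rightNorm]
  congr 1
  have hl := normFactor_sq (h := h) hn l.2
  have n1 := hq.normFactor_ne_zero hn k.2
  have n2 := hq.colFactor_ne_zero N n k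
  have n3 := hq.colFactor_ne_zero N n l
  have n4 := hq.leftFactor_ne_zero N n l
  have n5 := hq.rightFactor_ne_zero N n k
  field_simp
  linear_combination -colFactor h N n l * h1 - rightFactor h N n k * (-1) ^ (N + n) *
    colFactor h N n k * racahSum h N n l k * hl

/-- The scalar in `braid_hwR`, corrected by the normalizations, is `θ_n` for all `k`. -/
lemma qpow_mul_xi_mul_leftFactor {N n k : ℕ} :
    qpow h (N * (N - n)) * xi N h k * leftFactor h N n k =
      theta N n h * rightFactor h N n k := by
  have hs := neg_one_pow_mul_self k
  rw [xi, theta, leftFactor, rightFactor, pow_add]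
  have hp : qpow h (N * (N - n)) * qpow h (rho (N - k) - 2 * rho (spin N)) *
      qpow h (k * (N - k + 1) + N / 2 * k - n * (3 * (N / 2) - n + 1)) =
      qpow h (rho (3 * spin N - n) - 3 * rho (spin N)) * qpow h (N / 2 * n - N / 2 * k) := by
    rw [← qpow_add, ← qpow_add, ← qpow_add, rho, rho, rho, spin]
    ring_nf
  linear_combination (qfact h (n - k) / (qfact h (2 * N - k - n) * qfact h N)) * (-1) ^ n *
    (hp + qpow h (N * (N - n)) * qpow h (rho (N - k) - 2 * rho (spin N)) *
      qpow h (k * (N - k + 1) + N / 2 * k - n * (3 * (N / 2) - n + 1)) * hs)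

/-- The basis is the normalized `hwL`. The operator with the matrix `A` maps it to the normalized
`hwR`, so the three relations express `R12_hwL`, `R23_hwR` and `braid_hwR`. Nothing about `A⁻¹`
beyond its existence is known at this stage. -/
lemma exists_basis_braid (hq : Generic h) {N n : ℕ} (hn : 2 * n ≤ 3 * N)
    (h12 : ∀ ψ ∈ W N n h, R12 N h ψ ∈ W N n h) (h23 : ∀ ψ ∈ W N n h, R23 N h ψ ∈ W N n h) :
    ∃ b : Module.Basis (Idx N n) ℂ (W N n h),
      LinearMap.toMatrix b b ((R12 N h).restrict h12) = D0 N n h ∧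
      LinearMap.toMatrix b b ((R23 N h).restrict h23) * A N n h = A N n h * D0 N n h ∧
      D0 N n h * LinearMap.toMatrix b b ((R23 N h).restrict h23) * D0 N n h * A N n h =
        theta N n h • 1 := by
  have n1 := fun k : Idx N n => hq.normFactor_ne_zero hn k.2
  have n2 := hq.colFactor_ne_zero N n
  have n3 := hq.leftFactor_ne_zero N n
  have n4 := hq.rightFactor_ne_zero N n
  obtain ⟨b, hb⟩ := exists_basis_W hq N n (a := fun k => leftNorm h N n k)
    (fun k => div_ne_zero (n1 k) (mul_ne_zero (n3 k) (n2 k)))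
  set T12 := (R12 N h).restrict h12
  set T23 := (R23 N h).restrict h23
  set S := Matrix.toLin b b (A N n h)
  have hS : ∀ k, (S (b k) : V3 N) = rightNorm h N n k • hwR N n h k := by
    intro k
    rw [Matrix.toLin_self, smul_hwR hq hn]
    refine (Submodule.coe_sum _ _ _).trans (Finset.sum_congr rfl fun l _ => ?_)
    rw [Submodule.coe_smul, hb]
  have hk : ∀ k : Idx N n, (k : ℕ) ≤ N := fun k => by
    have := mem_Idx.mp k.2
    omega
  have e12 : ∀ k, T12 (b k) = xi N h k • b k := by
    intro k
    refine Subtype.ext ?_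
    rw [LinearMap.coe_restrict_apply, Submodule.coe_smul, hb, map_smul, R12_hwL hq (hk k),
      smul_comm]
  have e23 : T23 * S = S * T12 := by
    refine b.ext fun k => Subtype.ext ?_
    rw [Module.End.mul_apply, Module.End.mul_apply, LinearMap.coe_restrict_apply, e12, map_smul,
      Submodule.coe_smul, hS, map_smul, R23_hwR hq (hk k), smul_comm]
  have eT : T12 * T23 * T12 * S = theta N n h • 1 := by
    refine b.ext fun k => Subtype.ext ?_
    rw [Module.End.mul_apply, Module.End.mul_apply, Module.End.mul_apply,
      LinearMap.coe_restrict_apply, LinearMap.coe_restrict_apply, LinearMap.coe_restrict_apply, hS,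
      map_smul, map_smul, map_smul, braid_hwR hq k.2, LinearMap.smul_apply, Module.End.one_apply,
      Submodule.coe_smul, hb, smul_smul, smul_smul]
    congr 1
    have := qpow_mul_xi_mul_leftFactor (h := h) (N := N) (n := n) (k := k)
    have n2 := n2 k
    have n3 := n3 k
    have n4 := n4 k
    rw [leftNorm, rightNorm]
    field_simp
    linear_combination normFactor h N n k * this
  have m12 : LinearMap.toMatrix b b T12 = D0 N n h := by
    have : T12 = Matrix.toLin b b (D0 N n h) := by
      refine b.ext fun k => ?_
      rw [Matrix.toLin_self, e12, Finset.sum_eq_single k, D0, Matrix.diagonal_apply_eq]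
      · intro l _ hl
        rw [D0, Matrix.diagonal_apply_ne _ hl, zero_smul]
      · simp
    rw [this, LinearMap.toMatrix_toLin]
  have mS : LinearMap.toMatrix b b S = A N n h := LinearMap.toMatrix_toLin b b _
  refine ⟨b, m12, ?_, ?_⟩
  · rw [← m12, ← mS, ← LinearMap.toMatrix_mul, ← LinearMap.toMatrix_mul, e23]
  · rw [← m12, ← mS, ← LinearMap.toMatrix_mul, ← LinearMap.toMatrix_mul, ← LinearMap.toMatrix_mul,
      eT, map_smul, LinearMap.toMatrix_one]

lemma D0_mul_D0_neg (N n : ℕ) (h : ℂ) : D0 N n h * D0 N n (-h) = 1 := by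
  rw [D0, D0, Matrix.diagonal_mul_diagonal, ← Matrix.diagonal_one]
  congr 1
  ext k
  rw [xi, xi, qpow_neg_left, mul_mul_mul_comm, neg_one_pow_mul_self, ← qpow_add, add_neg_cancel,
    qpow_zero, one_mul]

lemma theta_mul_theta_neg (N n : ℕ) (h : ℂ) : theta N n h * theta N n (-h) = 1 := by
  rw [theta, theta, qpow_neg_left, mul_mul_mul_comm, neg_one_pow_mul_self, ← qpow_add,
    add_neg_cancel, qpow_zero, one_mul]

section Matrices

variable {ι : Type*} [Fintype ι] [DecidableEq ι]

/-- Two braid relations with inverse diagonal matrices force `A * A = 1`. -/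
lemma mul_self_eq_one_of_braid {A D D' M M' : Matrix ι ι ℂ} {θ θ' : ℂ} (hD : D * D' = 1)
    (hθ : θ * θ' = 1) (h1 : M * A = A * D) (h2 : D * M * D * A = θ • 1) (h3 : M' * A = A * D')
    (h4 : D' * M' * D' * A = θ' • 1) : A * A = 1 := by
  have hD' : D' * D = 1 := mul_eq_one_comm.mp hD
  have key : ∀ {D D' M : Matrix ι ι ℂ} {θ θ' : ℂ}, D * D' = 1 → D' * D = 1 → θ * θ' = 1 →
      M * A = A * D → D * M * D * A = θ • 1 →
      ∃ C, C * A = 1 ∧ A * C = 1 ∧ M = A * D * C ∧ C = θ' • (D * M * D) := by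
    intro D D' M θ θ' hD hD' hθ h1 h2
    have hC : θ' • (D * M * D) * A = 1 := by
      rw [smul_mul_assoc, h2, smul_smul, mul_comm, hθ, one_smul]
    have hC' := mul_eq_one_comm.mp hC
    exact ⟨_, hC, hC', by rw [← h1, mul_assoc M, hC', mul_one], rfl⟩
  -- Both systems produce the same inverse `C` of `A`, with `M = A D C` and `M' = A D' C`.
  obtain ⟨C, hCA, hAC, hM, hC⟩ := key hD hD' hθ h1 h2
  obtain ⟨C', hCA', -, hM', hC'⟩ := key hD' hD (by rw [mul_comm, hθ]) h3 h4
  obtain rfl : C' = C := left_inv_eq_right_inv hCA' hAC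
  have e1 : D' * C' * D' = θ' • (A * D * C') := by
    conv_lhs => rw [hC, hM]
    simp only [mul_smul_comm, smul_mul_assoc, mul_assoc, hD, mul_one]
    rw [← mul_assoc D' D, hD', one_mul]
  have e2 : D * C' * D = θ • (A * D' * C') := by
    conv_lhs => rw [hC', hM']
    simp only [mul_smul_comm, smul_mul_assoc, mul_assoc, hD', mul_one]
    rw [← mul_assoc D D', hD, one_mul]
  have e3 : D * A * D * (D' * C' * D') = 1 := by
    simp only [mul_assoc]
    rw [← mul_assoc D D', hD, one_mul, ← mul_assoc A, hAC, one_mul, hD]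
  have e4 : D' * C' * D' * (D * C' * D) = 1 := by
    -- The product is `A D C A D' C = 1`. Thus `D' C D'` has both `D A D` and `D C D` as inverses,
    -- which gives `A = C`.
    rw [e1, e2, smul_mul_smul_comm, mul_comm θ', hθ, one_smul]
    simp only [mul_assoc]
    rw [← mul_assoc C' A, hCA, one_mul, ← mul_assoc D D', hD, one_mul, hAC]
  have e5 : D * A * D = D * C' * D := left_inv_eq_right_inv e3 e4
  have e6 : A = C' := by
    calc A = D' * (D * A * D) * D' := by
          simp only [mul_assoc, hD, mul_one]
          rw [← mul_assoc, hD', one_mul]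
      _ = C' := by
          rw [e5]
          simp only [mul_assoc, hD, mul_one]
          rw [← mul_assoc, hD', one_mul]
  rwa [← e6] at hAC

end Matrices

/-! ### The matrix relation -/

/-- The orthogonality of the 6-j symbols, deduced from the relations at `q` and at `q⁻¹` instead of
a summation formula. -/
lemma A_mul_A (hq : Generic h) {N n : ℕ} (hn : 2 * n ≤ 3 * N) : A N n h * A N n h = 1 := by
  obtain ⟨b, -, h1, h2⟩ := exists_basis_braid hq hn (fun _ => R12_mem_W hq) (fun _ => R23_mem_W hq)
  obtain ⟨b', -, h3, h4⟩ := exists_basis_braid hq.neg hn (fun _ => R12_mem_W hq.neg)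
    (fun _ => R23_mem_W hq.neg)
  rw [A_neg_left] at h3 h4
  exact mul_self_eq_one_of_braid (D0_mul_D0_neg N n h) (theta_mul_theta_neg N n h) h1 h2 h3 h4

lemma D0_inv (N n : ℕ) (h : ℂ) : (D0 N n h)⁻¹ = D0 N n (-h) :=
  Matrix.inv_eq_right_inv (D0_mul_D0_neg N n h)

lemma exists_basis_matrices (hq : Generic h) {N n : ℕ} (hn : 2 * n ≤ 3 * N)
    (h12 : ∀ ψ ∈ W N n h, R12 N h ψ ∈ W N n h) (h23 : ∀ ψ ∈ W N n h, R23 N h ψ ∈ W N n h) :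
    ∃ b : Module.Basis (Idx N n) ℂ (W N n h),
      LinearMap.toMatrix b b ((R12 N h).restrict h12) = D0 N n h ∧
      LinearMap.toMatrix b b ((R23 N h).restrict h23) = A N n h * D0 N n h * A N n h ∧
      D0 N n h * (A N n h * D0 N n h * A N n h) * D0 N n h = theta N n h • A N n h := by
  obtain ⟨b, h1, h2, h3⟩ := exists_basis_braid hq hn h12 h23
  have hA := A_mul_A hq hn
  have h4 : LinearMap.toMatrix b b ((R23 N h).restrict h23) = A N n h * D0 N n h * A N n h := by
    rw [← h2, mul_assoc, hA, mul_one]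
  refine ⟨b, h1, h4, ?_⟩
  rw [h4] at h3
  have h5 := congrArg (fun X => X * A N n h) h3
  simp only [smul_mul_assoc, one_mul] at h5
  rw [← h5, mul_assoc _ (A N n h) (A N n h), hA, mul_one]

lemma D0_A_D0_A_D0 (hq : Generic h) {N n : ℕ} (hn : 2 * n ≤ 3 * N) :
    D0 N n h * (A N n h * D0 N n h * A N n h) * D0 N n h = theta N n h • A N n h := by
  obtain ⟨b, -, -, h1⟩ := exists_basis_matrices hq hn (fun _ => R12_mem_W hq)
    (fun _ => R23_mem_W hq)
  exact h1

lemma A_D0_A (hq : Generic h) {N n : ℕ} (hn : 2 * n ≤ 3 * N) :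
    A N n h * D0 N n h * A N n h = theta N n h • ((D0 N n h)⁻¹ * A N n h * (D0 N n h)⁻¹) := by
  rw [D0_inv]
  have h1 := D0_mul_D0_neg N n h
  have h2 := mul_eq_one_comm.mp h1
  rw [← smul_mul_assoc, ← mul_smul_comm, ← D0_A_D0_A_D0 hq hn]
  simp only [mul_assoc, h1, mul_one]
  rw [← mul_assoc (D0 N n (-h)), h2, one_mul]

lemma A_D0_A_D0_A_D0_A (hq : Generic h) {N n : ℕ} (hn : 2 * n ≤ 3 * N) :
    A N n h * D0 N n h * A N n h * D0 N n h * (A N n h * D0 N n h * A N n h) =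
      theta N n h • A N n h := by
  have hA := A_mul_A hq hn
  calc A N n h * D0 N n h * A N n h * D0 N n h * (A N n h * D0 N n h * A N n h) =
        A N n h * (D0 N n h * (A N n h * D0 N n h * A N n h) * D0 N n h) * A N n h := by
        simp only [mul_assoc]
    _ = _ := by
        rw [D0_A_D0_A_D0 hq hn, mul_smul_comm, smul_mul_assoc, hA, one_mul]

/-- The square of an operator with the matrix `θ A` is `θ²`. -/
lemma sq_of_toMatrix (hq : Generic h) {N n : ℕ} (hn : 2 * n ≤ 3 * N)
    (b : Module.Basis (Idx N n) ℂ (W N n h)) {T : Module.End ℂ (W N n h)}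
    (hT : LinearMap.toMatrix b b T = theta N n h • A N n h) : T * T = (theta N n h ^ 2) • 1 := by
  apply (LinearMap.toMatrix b b).injective
  rw [LinearMap.toMatrix_mul, hT, map_smul, LinearMap.toMatrix_one, smul_mul_smul_comm,
    A_mul_A hq hn, pow_two]

lemma braid_sq_apply (hq : Generic h) {N n : ℕ} (hn : 2 * n ≤ 3 * N) {ψ : V3 N}
    (hψ : ψ ∈ W N n h) :
    ((R12 N h * R23 N h * R12 N h) ^ 2) ψ = theta N n h ^ 2 • ψ ∧
      ((R23 N h * R12 N h * R23 N h) ^ 2) ψ = theta N n h ^ 2 • ψ := by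
  obtain ⟨b, h1, h2, h3⟩ := exists_basis_matrices hq hn (fun _ => R12_mem_W hq)
    (fun _ => R23_mem_W hq)
  constructor
  · have := sq_of_toMatrix hq hn b (T := (R12 N h).restrict (fun _ => R12_mem_W hq) *
      (R23 N h).restrict (fun _ => R23_mem_W hq) * (R12 N h).restrict (fun _ => R12_mem_W hq))
      (by rw [LinearMap.toMatrix_mul, LinearMap.toMatrix_mul, h1, h2, h3])
    have := congrArg (fun T => (T ⟨ψ, hψ⟩ : V3 N)) this
    rw [pow_two]
    exact this
  · have := sq_of_toMatrix hq hn b (T := (R23 N h).restrict (fun _ => R23_mem_W hq) *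
      (R12 N h).restrict (fun _ => R12_mem_W hq) * (R23 N h).restrict (fun _ => R23_mem_W hq))
      (by rw [LinearMap.toMatrix_mul, LinearMap.toMatrix_mul, h1, h2, A_D0_A_D0_A_D0_A hq hn])
    have := congrArg (fun T => (T ⟨ψ, hψ⟩ : V3 N)) this
    rw [pow_two]
    exact this

/-! ### The ribbon element and the square of the half twist -/

lemma om3_mem (N : ℕ) (i : (Fin (N + 1) × Fin (N + 1)) × Fin (N + 1)) :
    om3 N i ∈ wtSpace h (qH3 N h)
      (2 * (i.1.1 : ℕ) - N + (2 * (i.1.2 : ℕ) - N) + (2 * (i.2 : ℕ) - N)) := by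
  rw [om3, om2, Module.Basis.tensorProduct_apply, Module.Basis.tensorProduct_apply]
  exact tmul_mem_wtSpace (tmul_mem_wtSpace (om_mem N _) (om_mem N _)) (om_mem N _)

/-- If no basis vector had weight `m`, the zero operator would act on `x` by every scalar, in
particular by `1`. -/
lemma exists_weight_eq {ι M : Type} [AddCommGroup M] [Module ℂ M] (hq : Generic h)
    {K : Module.End ℂ M} (b : Module.Basis ι ℂ M) (w : ι → ℤ) (hb : ∀ i, b i ∈ wtSpace h K (w i))
    {m : ℤ} {x : M} (hx : x ∈ wtSpace h K m) (h0 : x ≠ 0) : ∃ i, w i = m := by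
  by_contra hm
  have h1 : ∀ c : ℂ, diagOp b (fun _ => 0) x = c • x := fun c =>
    diagOp_apply_of_mem hq b w hb _ c (fun i hi => absurd ⟨i, hi⟩ hm) hx
  exact h0 (by rw [← one_smul ℂ x, ← h1 1, h1 0, zero_smul])

/-- The weights of `V_s ⊗ V_s ⊗ V_s` are congruent to `3s` modulo `1`. -/
lemma exists_add_two_mul_eq (hq : Generic h) {N m : ℕ} {x : V3 N}
    (hx : x ∈ wtSpace h (qH3 N h) m) (h0 : x ≠ 0) : ∃ n : ℕ, m + 2 * n = 3 * N := by
  obtain ⟨i, hi⟩ := exists_weight_eq (M := V3 N) (K := qH3 N h) hq (om3 N) _ (om3_mem N) hx h0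
  exact ⟨3 * N - ((i.1.1 : ℕ) + (i.1.2 : ℕ) + (i.2 : ℕ)), by omega⟩

lemma chi_eq (hq : Generic h) (N : ℕ) : chi N h = qpow h (-2 * rho (spin N)) • 1 := by
  refine hom_ext_e hq fun i hi => ?_
  exact (uqModule_V hq N).ribbon_apply hq (om N) (wt N) (fun i => 2 * (i : ℕ) - N) (wt_eq N)
    (om_mem N) hi (Nat.lt_succ_self N) (e_zero_mem N) (Xp_om_last N)

lemma chi123_eq (hq : Generic h) (N : ℕ) : chi123 N h = qpow h (-6 * rho (spin N)) • 1 := by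
  have : ∀ {M M' : Type} [AddCommGroup M] [Module ℂ M] [AddCommGroup M'] [Module ℂ M'] (a b : ℂ),
      TensorProduct.map (a • (1 : Module.End ℂ M)) (b • (1 : Module.End ℂ M')) = (a * b) • 1 := by
    intro M M' _ _ _ _ a b
    rw [TensorProduct.map_smul_left, TensorProduct.map_smul_right, TensorProduct.map_one, smul_smul]
  rw [chi123, chi_eq hq, this, this, ← qpow_add, ← qpow_add]
  ring_nf

lemma chi3_apply (hq : Generic h) {N m p : ℕ} (hp : p ≤ m) (hm : m ≤ 3 * N) {x : V3 N}
    (hx : x ∈ wtSpace h (qH3 N h) m) (hE : Xp3 N h x = 0) :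
    chi3 N h (((Xm3 N h) ^ p) x) = qpow h (-2 * rho ((m : ℂ) / 2)) • ((Xm3 N h) ^ p) x := by
  have hw : ∀ i : (Fin (N + 1) × Fin (N + 1)) × Fin (N + 1),
      wt N i.1.1 + wt N i.1.2 + wt N i.2 =
        ((2 * (i.1.1 : ℕ) - N + (2 * (i.1.2 : ℕ) - N) + (2 * (i.2 : ℕ) - N) : ℤ) : ℂ) / 2 := by
    intro i
    rw [wt_eq, wt_eq, wt_eq]
    push_cast
    ring
  rw [chi3]
  exact (uqModule_V3 hq N).ribbon_apply hq (om3 N) _ _ hw (om3_mem N) hp (Nat.lt_succ_of_le hm) hx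
    hE

lemma theta_sq (N n : ℕ) (h : ℂ) : theta N n h ^ 2 * qpow h (-2 * rho (3 * spin N - n)) =
    qpow h (-6 * rho (spin N)) := by
  rw [theta, mul_pow, ← pow_mul, mul_comm n 2, pow_mul, neg_one_sq, one_pow, one_mul, pow_two,
    ← qpow_add, ← qpow_add]
  ring_nf

/-- An operator that commutes with `X⁻` and squares to `θ_n²` on highest weight vectors. -/
lemma sq_eq_chi (hq : Generic h) {N : ℕ} {T : Module.End ℂ (V3 N)} (hF : Commute T (Xm3 N h))
    (hT : ∀ n, 2 * n ≤ 3 * N → ∀ ψ ∈ W N n h, (T ^ 2) ψ = theta N n h ^ 2 • ψ) :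
    IsUnit (chi3 N h) ∧ T ^ 2 = chi123 N h * Ring.inverse (chi3 N h) := by
  have hM := uqModule_V3 hq N
  have key : ∀ (m p : ℕ) (x : V3 N), p ≤ m → x ∈ wtSpace h (qH3 N h) m → Xp3 N h x = 0 →
      ∃ a c : ℂ, a * c = qpow h (-6 * rho (spin N)) ∧
        (T ^ 2) (((Xm3 N h) ^ p) x) = a • ((Xm3 N h) ^ p) x ∧
        chi3 N h (((Xm3 N h) ^ p) x) = c • ((Xm3 N h) ^ p) x := by
    intro m p x hp hx hE
    -- The zero vector lies in every weight space, also for `m` of the wrong parity, so it is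
    -- treated apart with arbitrary scalars of the right product.
    by_cases h0 : x = 0
    · refine ⟨1, qpow h (-6 * rho (spin N)), one_mul _, ?_, ?_⟩
      · rw [h0, map_zero, map_zero, smul_zero]
      · rw [h0, map_zero, map_zero, smul_zero]
    · obtain ⟨n, hn⟩ := exists_add_two_mul_eq hq hx h0
      have hmn : (m : ℂ) / 2 = 3 * spin N - n := by
        have : (m : ℂ) + 2 * n = 3 * N := by exact_mod_cast hn
        rw [spin]
        linear_combination this / 2
      refine ⟨theta N n h ^ 2, qpow h (-2 * rho (3 * spin N - n)), theta_sq N n h, ?_, ?_⟩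
      · have hW : x ∈ W N n h := mem_W.mpr ⟨hE, by convert hx using 1; congr 1; omega⟩
        have hc := hF.pow_pow 2 p
        rw [← Module.End.mul_apply, hc.eq, Module.End.mul_apply, hT n (by omega) x hW, map_smul]
      · rw [← hmn]
        exact chi3_apply hq hp (by omega) hx hE
  have e1 : T ^ 2 * chi3 N h = qpow h (-6 * rho (spin N)) • 1 := by
    refine hM.end_ext hq fun m p x hp hx hE => ?_
    obtain ⟨a, c, hac, h1, h2⟩ := key m p x hp hx hE
    rw [Module.End.mul_apply, h2, map_smul, h1, smul_smul, mul_comm, hac, LinearMap.smul_apply,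
      Module.End.one_apply]
  have e2 : chi3 N h * T ^ 2 = qpow h (-6 * rho (spin N)) • 1 := by
    refine hM.end_ext hq fun m p x hp hx hE => ?_
    obtain ⟨a, c, hac, h1, h2⟩ := key m p x hp hx hE
    rw [Module.End.mul_apply, h1, map_smul, h2, smul_smul, hac, LinearMap.smul_apply,
      Module.End.one_apply]
  have hu : IsUnit (chi3 N h) := by
    refine ⟨⟨chi3 N h, qpow h (6 * rho (spin N)) • T ^ 2, ?_, ?_⟩, rfl⟩
    · rw [mul_smul_comm, e2, smul_smul, ← qpow_add, neg_mul, add_neg_cancel, qpow_zero, one_smul]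
    · rw [smul_mul_assoc, e1, smul_smul, ← qpow_add, neg_mul, add_neg_cancel, qpow_zero, one_smul]
  refine ⟨hu, ?_⟩
  rw [chi123_eq hq, ← e1, mul_assoc, Ring.mul_inverse_cancel _ hu, mul_one]

end UqSl2

end

/-! ### The theorem. -/

theorem lemma1 (N n : ℕ) (hn : 2 * n ≤ 3 * N) (h : ℂ)
    (hq : ∀ m : ℕ, 0 < m → Complex.exp h ^ m ≠ 1) :
    -- the matrix relation
    UqSl2.A N n h * UqSl2.D0 N n h * UqSl2.A N n h =
        UqSl2.theta N n h • ((UqSl2.D0 N n h)⁻¹ * UqSl2.A N n h * (UqSl2.D0 N n h)⁻¹) ∧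
    -- the operator form of the relation on the space of highest weight vectors
    (∃ (h12 : ∀ ψ ∈ UqSl2.W N n h, UqSl2.R12 N h ψ ∈ UqSl2.W N n h)
       (h23 : ∀ ψ ∈ UqSl2.W N n h, UqSl2.R23 N h ψ ∈ UqSl2.W N n h),
      (∃ b : Module.Basis (UqSl2.Idx N n) ℂ (UqSl2.W N n h),
        LinearMap.toMatrix b b ((UqSl2.R12 N h).restrict h12) = UqSl2.D0 N n h ∧
        LinearMap.toMatrix b b ((UqSl2.R23 N h).restrict h23) =
          UqSl2.A N n h * UqSl2.D0 N n h * UqSl2.A N n h) ∧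
      (∀ b : Module.Basis (UqSl2.Idx N n) ℂ (UqSl2.W N n h),
        LinearMap.toMatrix b b ((UqSl2.R12 N h).restrict h12) = UqSl2.D0 N n h →
        LinearMap.toMatrix b b ((UqSl2.R23 N h).restrict h23) =
          UqSl2.A N n h * UqSl2.D0 N n h * UqSl2.A N n h →
        LinearMap.toMatrix b b ((UqSl2.R12 N h).restrict h12 * (UqSl2.R23 N h).restrict h23 *
            (UqSl2.R12 N h).restrict h12) = UqSl2.theta N n h • UqSl2.A N n h ∧
        LinearMap.toMatrix b b ((UqSl2.R23 N h).restrict h23 * (UqSl2.R12 N h).restrict h12 *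
            (UqSl2.R23 N h).restrict h23) = UqSl2.theta N n h • UqSl2.A N n h)) ∧
    -- the square root
    (IsUnit (UqSl2.chi3 N h) ∧
      (UqSl2.R12 N h * UqSl2.R23 N h * UqSl2.R12 N h) ^ 2 =
        UqSl2.chi123 N h * Ring.inverse (UqSl2.chi3 N h) ∧
      (UqSl2.R23 N h * UqSl2.R12 N h * UqSl2.R23 N h) ^ 2 =
        UqSl2.chi123 N h * Ring.inverse (UqSl2.chi3 N h)) := by
  have hq' : UqSl2.Generic h := hq
  have c12 := UqSl2.commute_R12_Xm3 hq' N
  have c23 := UqSl2.commute_R23_Xm3 hq' N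
  -- Part (iii) concerns the whole tensor cube, so the relations are used for all `n` with `2n ≤ 3N`
  -- and not only for the given one.
  have s1 := UqSl2.sq_eq_chi hq' ((c12.mul_left c23).mul_left c12)
    fun n hn ψ hψ => (UqSl2.braid_sq_apply hq' hn hψ).1
  have s2 := UqSl2.sq_eq_chi hq' ((c23.mul_left c12).mul_left c23)
    fun n hn ψ hψ => (UqSl2.braid_sq_apply hq' hn hψ).2
  refine ⟨UqSl2.A_D0_A hq' hn, ⟨fun _ => UqSl2.R12_mem_W hq', fun _ => UqSl2.R23_mem_W hq', ?_,
    fun b h1 h2 => ⟨?_, ?_⟩⟩, s1.1, s1.2, s2.2⟩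
  · obtain ⟨b, h1, h2, -⟩ := UqSl2.exists_basis_matrices hq' hn (fun _ => UqSl2.R12_mem_W hq')
      (fun _ => UqSl2.R23_mem_W hq')
    exact ⟨b, h1, h2⟩
  · rw [LinearMap.toMatrix_mul, LinearMap.toMatrix_mul, h1, h2, UqSl2.D0_A_D0_A_D0 hq' hn]
  · rw [LinearMap.toMatrix_mul, LinearMap.toMatrix_mul, h1, h2, UqSl2.A_D0_A_D0_A_D0_A hq' hn]
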